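/- A tracial von Neumann algebra $(M,\tau)$ is a von Neumann algebra with a faithful normal tracial state $\tau$; write $\|x\|_2=\tau(x^*x)^{1/2}$. A II$_1$ factor is an infinite dimensional tracial von Neumann algebra with trivial center; it is separable if it is separable in $\|\cdot\|_2$. Fix a non-principal ultrafilter $\omega$ on $\mathbb N$. The ultrapower of $(\tilde M,\tilde\tau)$ is $$\tilde M^\omega=\{(x_n)_n\subset\tilde M:\ \sup_n\|x_n\|<\infty\}\,\big/\,\{(x_n)_n:\ \lim_{n\to\omega}\tilde\tau(x_n^*x_n)=0\},$$ $\tilde M$ is embedded in $\tilde M^\omega$ by constant sequences, and for a von Neumann subalgebra $P\subset\tilde M$, $P^\omega\subset\tilde M^\omega$ denotes the set of classes of bounded sequences in $P$. An $M$-$M$-bimodule is a Hilbert space $\mathcal H$ with a normal unital $*$-homomorphism and a normal unital $*$-anti-homomorphism $M\to\mathcal B(\mathcal H)$ with commuting images, written $\xi\mapsto x\xi$ and $\xi\mapsto\xi y$. A vector $\xi\in\mathcal H$ is tracial if $\langle\xi,x\xi\rangle=\tau(x)=\langle\xi,\xi x\rangle$ for all $x\in M$. For a von Neumann subalgebra $A\subset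 M$ (with the same unit), $A\subset M$ has relative property (T) if for every $\varepsilon'>0$ there are a finite set $F\subset M$ and $\varepsilon>0$ such that for every $M$-$M$-bimodule $\mathcal H$ and every tracial unit vector $\xi\in\mathcal H$ with $\max_{x\in F}\|x\xi-\xi x\|\le\varepsilon$, there is $\eta\in\mathcal H$ with $a\eta=\eta a$ for all $a\in A$ and $\|\eta-\xi\|\le\varepsilon'$. **Theorem.** Let $M$ be a separable II$_1$ factor and let $A\subset M$ be a von Neumann subalgebra. Then $A\subset M$ has relative property (T) if and only if $$M'\cap\tilde M^\omega\subset(A'\cap\tilde M)^\omega$$ for every inclusion (injective normal unital $*$-homomorphism) of $M$ into a tracial von Neumann algebra $\tilde M$. -/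

import Mathlib

open Filter Topology
open scoped ComplexOrder

universe u

/-- A tracial von Neumann algebra `(M, τ)`: a von Neumann algebra `M` of operators on a complex
Hilbert space `H`, together with a faithful normal tracial state `τ` on `M`.
Normality means that `τ (sup d) = sup τ(d)` for every increasing net (directed set) `d` in `M`
possessing a supremum, for the operator order; this is Mathlib's `ScottContinuous`. -/
structure TracialVonNeumannAlgebra (H : Type u) [NormedAddCommGroup H] [InnerProductSpace ℂ H]
    [CompleteSpace H] extends VonNeumannAlgebra H where
  /-- The trace `τ`. -/
  trace : toStarSubalgebra →ₗ[ℂ] ℂ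
  trace_one : trace 1 = 1
  trace_mul_comm : ∀ x y, trace (x * y) = trace (y * x)
  trace_nonneg : ∀ x, 0 ≤ trace (star x * x)
  trace_faithful : ∀ x, trace (star x * x) = 0 → x = 0
  trace_normal : ScottContinuous trace

namespace TracialVonNeumannAlgebra

variable {H : Type u} [NormedAddCommGroup H] [InnerProductSpace ℂ H] [CompleteSpace H]

/-- A tracial von Neumann algebra is regarded as the type of its elements (a ⋆-algebra, ordered by
the order of operators: `x ≤ y` iff `y - x` is a positive operator). -/
instance : CoeSort (TracialVonNeumannAlgebra H) (Type u) := ⟨fun M => M.toStarSubalgebra⟩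

/-- `M` is a II₁ factor: it is infinite dimensional and has trivial center. -/
structure IsII₁Factor (M : TracialVonNeumannAlgebra H) : Prop where
  infinite_dimensional : ¬ FiniteDimensional ℂ M
  trivial_center : ∀ z : M, (∀ x : M, z * x = x * z) → ∃ c : ℂ, z = c • (1 : M)

/-- The square `‖x‖₂² = τ(x⋆x)` of the 2-norm. -/
noncomputable def normSq (M : TracialVonNeumannAlgebra H) (x : M) : ℝ :=
  (M.trace (star x * x)).re

/-- `M` is separable: it is separable for the 2-norm, i.e. `L²(M, τ)` is separable. -/
def IsSeparable (M : TracialVonNeumannAlgebra H) : Prop :=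
  ∃ s : Set M, s.Countable ∧ ∀ x : M, ∀ ε : ℝ, 0 < ε → ∃ y ∈ s, M.normSq (x - y) < ε

/-! ### Bimodules and relative property (T) -/

/-- An `M`-`M`-bimodule structure on a Hilbert space `K`: a normal unital ⋆-homomorphism
`M → B(K)` and a normal unital ⋆-anti-homomorphism `M → B(K)` with commuting images. -/
structure Bimodule (M : TracialVonNeumannAlgebra H) (K : Type u) [NormedAddCommGroup K]
    [InnerProductSpace ℂ K] [CompleteSpace K] where
  /-- `left x ξ` is `x ξ`. -/
  left : M →⋆ₐ[ℂ] (K →L[ℂ] K)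
  /-- `right (op x) ξ` is `ξ x`. -/
  right : (M : Type u)ᵐᵒᵖ →⋆ₐ[ℂ] (K →L[ℂ] K)
  left_normal : ScottContinuous left
  right_normal : ScottContinuous fun x : M => right (MulOpposite.op x)
  commute : ∀ x y, Commute (left x) (right y)

namespace Bimodule

variable {M : TracialVonNeumannAlgebra H} {K : Type u} [NormedAddCommGroup K]
  [InnerProductSpace ℂ K] [CompleteSpace K]

/-- The commutator `x ξ - ξ x`. -/
noncomputable def commutator (B : Bimodule M K) (x : M) (ξ : K) : K :=
  B.left x ξ - B.right (MulOpposite.op x) ξ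

/-- `ξ` is tracial: `⟨ξ, x ξ⟩ = τ(x) = ⟨ξ, ξ x⟩` (for all `x`, equivalently for all `x ≥ 0`). -/
def IsTracial (B : Bimodule M K) (ξ : K) : Prop :=
  ∀ x : M, inner ℂ ξ (B.left x ξ) = M.trace x ∧
    inner ℂ ξ (B.right (MulOpposite.op x) ξ) = M.trace x

/-- `ξ` is `(F, ε)`-almost central: `‖x ξ - ξ x‖ ≤ ε` for all `x ∈ F`. -/
def IsAlmostCentral (B : Bimodule M K) (F : Finset M) (ε : ℝ) (ξ : K) : Prop :=
  ∀ x ∈ F, ‖B.commutator x ξ‖ ≤ ε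

/-- `η` is `A`-central: `a η = η a` for all `a ∈ A`. -/
def IsCentral (B : Bimodule M K) (A : VonNeumannAlgebra H) (η : K) : Prop :=
  ∀ x : M, (x : H →L[ℂ] H) ∈ A → B.commutator x η = 0

end Bimodule

/-- The inclusion `A ⊂ M` has relative property (T). -/
def RelativePropertyT (M : TracialVonNeumannAlgebra H) (A : VonNeumannAlgebra H) : Prop :=
  ∀ ε' : ℝ, 0 < ε' → ∃ (F : Finset M) (ε : ℝ), 0 < ε ∧
    ∀ (K : Type u) [NormedAddCommGroup K] [InnerProductSpace ℂ K] [CompleteSpace K]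
      (B : Bimodule M K) (ξ : K), ‖ξ‖ = 1 → B.IsTracial ξ → B.IsAlmostCentral F ε ξ →
      ∃ η : K, B.IsCentral A η ∧ ‖η - ξ‖ ≤ ε'

/-! ### The ultrapower -/

section normSq

variable (M : TracialVonNeumannAlgebra H)

lemma normSq_nonneg (x : M) : 0 ≤ M.normSq x :=
  (Complex.nonneg_iff.1 (M.trace_nonneg x)).1

lemma normSq_zero : M.normSq 0 = 0 := by simp [normSq]

lemma normSq_neg (x : M) : M.normSq (-x) = M.normSq x := by simp [normSq]

lemma normSq_star (x : M) : M.normSq (star x) = M.normSq x := by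
  simp [normSq, M.trace_mul_comm x]

lemma normSq_add_le (x y : M) : M.normSq (x + y) ≤ 2 * (M.normSq x + M.normSq y) := by
  have h : M.normSq (x + y) + M.normSq (x - y) = 2 * (M.normSq x + M.normSq y) := by
    simp only [normSq, star_add, star_sub, add_mul, mul_add, sub_mul, mul_sub, map_add, map_sub,
      Complex.add_re, Complex.sub_re]
    ring
  linarith [M.normSq_nonneg (x - y)]

lemma normSq_mul_le_left (a x : M) :
    M.normSq (a * x) ≤ ‖(a : H →L[ℂ] H)‖ ^ 2 * M.normSq x := by
  have h : star (a * x) * (a * x) ≤ ((‖(a : H →L[ℂ] H)‖ ^ 2 : ℝ) : ℂ) • (star x * x) := by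
    have h1 : star (a : H →L[ℂ] H) * (a : H →L[ℂ] H) ≤
        algebraMap ℝ (H →L[ℂ] H) (‖(a : H →L[ℂ] H)‖ ^ 2) := by
      exact CStarAlgebra.star_mul_le_algebraMap_norm_sq
    have h2 := star_left_conjugate_le_conjugate h1 (x : H →L[ℂ] H)
    change star ((a : H →L[ℂ] H) * x) * ((a : H →L[ℂ] H) * x) ≤
      ((‖(a : H →L[ℂ] H)‖ ^ 2 : ℝ) : ℂ) • (star (x : H →L[ℂ] H) * x)
    convert h2 using 1
    · simp [mul_assoc]
    · rw [Algebra.algebraMap_eq_smul_one]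
      ext v
      simp [← Complex.coe_smul]
  have h3 := (Complex.le_def.1 (M.trace_normal.monotone h)).1
  rwa [map_smul, smul_eq_mul, Complex.re_ofReal_mul] at h3

lemma normSq_mul_le_right (x a : M) :
    M.normSq (x * a) ≤ ‖(a : H →L[ℂ] H)‖ ^ 2 * M.normSq x := by
  have h := M.normSq_mul_le_left (star a) (star x)
  rw [← star_mul, normSq_star, normSq_star] at h
  simpa using h

end normSq

/-- The ⋆-algebra `∏ M` of norm-bounded sequences in `M`. -/
def boundedSeq (M : TracialVonNeumannAlgebra H) : StarSubalgebra ℂ (ℕ → M) where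
  carrier := {x | ∃ C : ℝ, ∀ n, ‖(x n : H →L[ℂ] H)‖ ≤ C}
  mul_mem' := by
    rintro x y ⟨C, hC⟩ ⟨D, hD⟩
    exact ⟨C * D, fun n => (norm_mul_le _ _).trans
      (mul_le_mul (hC n) (hD n) (norm_nonneg _) ((norm_nonneg _).trans (hC n)))⟩
  add_mem' := by
    rintro x y ⟨C, hC⟩ ⟨D, hD⟩
    exact ⟨C + D, fun n => (norm_add_le _ _).trans (add_le_add (hC n) (hD n))⟩
  algebraMap_mem' c := ⟨‖algebraMap ℂ (H →L[ℂ] H) c‖, fun _ => le_rfl⟩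
  star_mem' := by
    rintro x ⟨C, hC⟩
    exact ⟨C, fun n => (norm_star (x n : H →L[ℂ] H)).trans_le (hC n)⟩

/-- The two-sided ideal `I_ω` of bounded sequences `(xₙ)` with `lim_ω τ(xₙ⋆ xₙ) = 0`. -/
noncomputable def ultraIdeal (M : TracialVonNeumannAlgebra H) (ω : Ultrafilter ℕ) :
    TwoSidedIdeal M.boundedSeq :=
  TwoSidedIdeal.mk'
    {x | Tendsto (fun n => M.normSq (x.1 n)) ω (𝓝 0)}
    (by simp [normSq_zero])
    (by
      intro x y hx hy
      refine squeeze_zero (fun n => M.normSq_nonneg _)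
        (fun n => M.normSq_add_le (x.1 n) (y.1 n)) ?_
      simpa using (Tendsto.add hx hy).const_mul 2)
    (by
      intro x hx
      simpa [normSq_neg] using hx)
    (by
      rintro ⟨a, C, hC⟩ x hx
      refine squeeze_zero (g := fun n => C ^ 2 * M.normSq (x.1 n))
        (fun n => M.normSq_nonneg _) (fun n => ?_) (by simpa using Tendsto.const_mul (C ^ 2) hx)
      refine (M.normSq_mul_le_left (a n) (x.1 n)).trans ?_
      gcongr
      · exact M.normSq_nonneg _
      · exact hC n)
    (by
      rintro x ⟨a, C, hC⟩ hx
      refine squeeze_zero (g := fun n => C ^ 2 * M.normSq (x.1 n))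
        (fun n => M.normSq_nonneg _) (fun n => ?_) (by simpa using Tendsto.const_mul (C ^ 2) hx)
      refine (M.normSq_mul_le_right (x.1 n) (a n)).trans ?_
      gcongr
      · exact M.normSq_nonneg _
      · exact hC n)

/-- The ultrapower `M^ω = (∏ M) / I_ω`. -/
abbrev Ultrapower (M : TracialVonNeumannAlgebra H) (ω : Ultrafilter ℕ) : Type u :=
  (M.ultraIdeal ω).ringCon.Quotient

/-- The quotient map `∏ M → M^ω`. -/
noncomputable def toUltrapower (M : TracialVonNeumannAlgebra H) (ω : Ultrafilter ℕ) :
    M.boundedSeq →+* M.Ultrapower ω :=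
  (M.ultraIdeal ω).ringCon.mk'

/-- The canonical embedding `M → M^ω` by constant sequences. -/
noncomputable def diagonal (M : TracialVonNeumannAlgebra H) (ω : Ultrafilter ℕ) (x : M) :
    M.Ultrapower ω :=
  M.toUltrapower ω ⟨fun _ => x, ‖(x : H →L[ℂ] H)‖, fun _ => le_rfl⟩

/-- For a von Neumann subalgebra `P ⊂ M`, the ultrapower `P^ω` as a subset of `M^ω`: the classes
of the bounded sequences with all terms in `P`. -/
def subUltrapower (M : TracialVonNeumannAlgebra H) (ω : Ultrafilter ℕ) (P : Set M) :
    Set (M.Ultrapower ω) :=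
  M.toUltrapower ω '' {x | ∀ n, x.1 n ∈ P}

end TracialVonNeumannAlgebra

/-! From relative property (T) to central sequences. Let `ι : M → N` be an extension. As `M` is a
factor, `ι` preserves the trace (`trace_embedding`). A unitary `u` of `N` is then a tracial vector
of the `M`-`M`-bimodule `L²(N)`, because `τ(u⋆xu) = τ(x)`. If `u` almost commutes with a suitable
finite set, there is an `A`-central vector near it, so `u` almost commutes with all unitaries of `A`
uniformly (`RelativePropertyT.exists_unitary_bound`). A Cayley transform carries this over to
bounded self-adjoint elements, and averaging over the unitaries of `A` moves such an element into
`A' ∩ N` at a small cost in 2-norm (`exists_commutant_approx`). Real and imaginary parts settle the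
general case.

Conversely, suppose relative property (T) fails. There are tracial unit vectors `ξₙ` in bimodules,
asymptotically central on a 2-norm dense sequence of `M`, and unitaries `uₙ` of `A` whose
conjugation moves `ξₙ` by more than a fixed `ε'`; otherwise the point of minimal norm in the closed
convex hull of the orbit would be an `A`-central vector close to `ξₙ`. These vectors must be
realised by uniformly bounded operators in a single extension of `M`. The coefficient `⟨ξₙ, a ξₙ b⟩`
is `τ(φₙ(a) b)` for a trace preserving unital completely positive map `φₙ`. On the full Fock space
built from the `φₙ` and their adjoints, the field operators `Xₙ` (creation plus annihilation) have
norm at most `2`, and `Xₙ Ω` has the same coefficients as `ξₙ`; hence commutators and conjugates of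
`Xₙ` have the 2-norms prescribed by `ξₙ` (`exists_extension_of_coefficients`). The vacuum state is a
trace because right field operators commute with left ones and agree with them on `Ω`. The sequence
`(Xₙ)` then violates the inclusion.

The analytic input is the completeness of balls of `M` in 2-norm (`exists_limit_of_cauchy`), a
noncommutative Egorov argument. It keeps averages inside the algebra
(`IsCompleteTrace.exists_average`) and yields the Radon-Nikodym theorem that produces `φₙ`
(`IsCompleteTrace.exists_density`). Positivity of the Fock form rests on
`exists_matrix_factorization`. -/

set_option linter.unusedSectionVars false

/-! ### Monotone nets of operators and their strong limits -/

namespace ContinuousLinearMap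

variable {H : Type*} [NormedAddCommGroup H] [InnerProductSpace ℂ H] [CompleteSpace H]

/-- Over `ℂ`, operator inequalities can be tested on quadratic forms. -/
lemma le_iff_inner_nonneg {S T : H →L[ℂ] H} : S ≤ T ↔ ∀ v, 0 ≤ inner ℂ v ((T - S) v) := by
  rw [le_def]
  refine ⟨fun h v => h.inner_nonneg_right v, fun h => (isPositive_iff_complex _).2 fun v => ?_⟩
  have h2 := Complex.nonneg_iff.1 (h v)
  have h3 : inner ℂ ((T - S) v) v = inner ℂ v ((T - S) v) := by
    rw [← inner_conj_symm]
    exact Complex.ext (Complex.conj_re _) (by rw [Complex.conj_im, ← h2.2, neg_zero])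
  rw [← h3] at h2
  exact ⟨Complex.ext rfl h2.2, h2.1⟩

lemma re_inner_le_of_le {S T : H →L[ℂ] H} (h : S ≤ T) (v : H) :
    (inner ℂ v (S v)).re ≤ (inner ℂ v (T v)).re := by
  have h1 := (Complex.nonneg_iff.1 (le_iff_inner_nonneg.1 h v)).1
  rw [sub_apply, inner_sub_right, Complex.sub_re] at h1
  linarith

/-- Write `S = s⋆s`: then `⟨v, Sv⟩ = ‖sv‖²` and `‖Sv‖ ≤ ‖s‖ ‖sv‖`. This upgrades convergence of
quadratic forms to strong convergence. -/
lemma norm_sq_apply_le_of_nonneg {S : H →L[ℂ] H} (h : 0 ≤ S) (v : H) :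
    ‖S v‖ ^ 2 ≤ ‖S‖ * (inner ℂ v (S v)).re := by
  obtain ⟨s, hs⟩ : ∃ s : H →L[ℂ] H, S = star s * s :=
    ⟨CFC.sqrt S, by
      rw [(IsSelfAdjoint.of_nonneg (CFC.sqrt_nonneg S)).star_eq, CFC.sqrt_mul_sqrt_self S h]⟩
  have h1 : (inner ℂ v (S v)).re = ‖s v‖ ^ 2 := by
    rw [hs, star_eq_adjoint, ContinuousLinearMap.mul_def, comp_apply, adjoint_inner_right, inner_self_eq_norm_sq_to_K]
    norm_cast
  have h2 : ‖S‖ = ‖s‖ ^ 2 := by rw [hs, CStarRing.norm_star_mul_self, sq]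
  rw [h1, h2, ← mul_pow]
  gcongr
  calc ‖S v‖ = ‖star s (s v)‖ := by rw [hs]; rfl
    _ ≤ ‖star s‖ * ‖s v‖ := le_opNorm _ _
    _ = _ := by rw [norm_star]

/-- A pointwise limit of an eventually bounded net of operators is a bounded operator. -/
lemma exists_limit_of_eventually_norm_le {ι : Type*} {l : Filter ι} [l.NeBot]
    {f : ι → H →L[ℂ] H} {C : ℝ} (hC : ∀ᶠ i in l, ‖f i‖ ≤ C)
    (hf : ∀ v, ∃ w, Tendsto (fun i => f i v) l (𝓝 w)) :
    ∃ T : H →L[ℂ] H, ‖T‖ ≤ C ∧ ∀ v, Tendsto (fun i => f i v) l (𝓝 (T v)) := by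
  choose g hg using hf
  have hC0 : 0 ≤ C := by
    obtain ⟨i, hi⟩ := hC.exists
    exact (norm_nonneg _).trans hi
  let T₀ : H →ₗ[ℂ] H := linearMapOfTendsto g (fun i => (f i : H →ₗ[ℂ] H))
    (tendsto_pi_nhds.2 fun v => hg v)
  have hb : ∀ v, ‖T₀ v‖ ≤ C * ‖v‖ := fun v => by
    refine le_of_tendsto (hg v).norm ?_
    filter_upwards [hC] with i hi
    exact (le_opNorm _ _).trans (by gcongr)
  exact ⟨T₀.mkContinuous C hb, LinearMap.mkContinuous_norm_le _ hC0 _, hg⟩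

/-- A monotone net of operators that is bounded above converges strongly. -/
theorem exists_strong_limit_of_monotone {ι : Type*} [Preorder ι] [IsDirectedOrder ι] [Nonempty ι]
    {f : ι → H →L[ℂ] H} (hf : Monotone f) {B : H →L[ℂ] H} (hB : ∀ i, f i ≤ B) :
    ∃ T : H →L[ℂ] H, ∀ v, Tendsto (fun i => f i v) atTop (𝓝 (T v)) := by
  obtain ⟨i₀⟩ := ‹Nonempty ι›
  have : Nonempty ι := ⟨i₀⟩
  set K := ‖B - f i₀‖
  -- A monotone net is norm bounded only beyond a fixed index, hence the restriction to `i₀ ≤ i`.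
  have hK : ∀ i j, i₀ ≤ i → i ≤ j → ‖f j - f i‖ ≤ K := fun i j h1 h2 =>
    CStarAlgebra.norm_le_norm_of_nonneg_of_le (sub_nonneg.2 (hf h2))
      (sub_le_sub (hB j) (hf h1))
  have hcauchy : ∀ v, ∃ w, Tendsto (fun i => f i v) atTop (𝓝 w) := by
    intro v
    set q : ι → ℝ := fun i => (inner ℂ v (f i v)).re
    have hq : Monotone q := fun i j h => re_inner_le_of_le (hf h) v
    have hqb : BddAbove (Set.range q) :=
      ⟨(inner ℂ v (B v)).re, by rintro _ ⟨i, rfl⟩; exact re_inner_le_of_le (hB i) v⟩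
    have hqt := tendsto_atTop_ciSup hq hqb
    refine cauchy_map_iff_exists_tendsto.1 (Metric.cauchy_iff.2 ⟨inferInstance, fun ε hε => ?_⟩)
    have hsmall : 0 < (ε / 2) ^ 2 / (K + 1) := by positivity
    obtain ⟨i₁, hi₁⟩ := (eventually_atTop.1
      ((tendsto_order.1 hqt).1 _ (sub_lt_self (⨆ i, q i) hsmall)))
    obtain ⟨k, hk0, hk1⟩ := exists_ge_ge i₀ i₁
    have key : ∀ j, k ≤ j → ‖f j v - f k v‖ < ε / 2 := by
      intro j hj
      have h1 := norm_sq_apply_le_of_nonneg (sub_nonneg.2 (hf hj)) v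
      have h2 : (inner ℂ v ((f j - f k) v)).re = q j - q k := by
        simp [q]
      rw [h2, sub_apply] at h1
      have h3 : q j - q k < (ε / 2) ^ 2 / (K + 1) := by
        have := hi₁ k hk1
        have := le_ciSup hqb j
        linarith
      have h4 : 0 ≤ q j - q k := sub_nonneg.2 (hq hj)
      have h5 : ‖f j v - f k v‖ ^ 2 < (ε / 2) ^ 2 := by
        have h6 : (K + 1) * (q j - q k) < (ε / 2) ^ 2 := by
          rw [lt_div_iff₀ (by positivity)] at h3
          linarith
        have := hK k j hk0 hj
        nlinarith [norm_nonneg (f j - f k)]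
      exact lt_of_pow_lt_pow_left₀ 2 (by positivity) h5
    refine ⟨(fun i => f i v) '' Set.Ici k, image_mem_map (mem_atTop k), ?_⟩
    rintro _ ⟨i, hi, rfl⟩ _ ⟨j, hj, rfl⟩
    have h1 := key i hi
    have h2 := key j hj
    rw [dist_eq_norm]
    calc ‖f i v - f j v‖ = ‖(f i v - f k v) - (f j v - f k v)‖ := by abel_nf
      _ ≤ _ := norm_sub_le _ _
      _ < ε := by linarith
  obtain ⟨T, -, hT⟩ := exists_limit_of_eventually_norm_le (l := atTop) (C := ‖f i₀‖ + K)
    (by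
      filter_upwards [mem_atTop i₀] with i hi
      calc ‖f i‖ = ‖f i₀ + (f i - f i₀)‖ := by abel_nf
        _ ≤ _ := (norm_add_le _ _).trans (by gcongr; exact hK i₀ i le_rfl hi)) hcauchy
  exact ⟨T, hT⟩

end ContinuousLinearMap

/-! ### Suprema and strong limits in a von Neumann algebra -/

namespace VonNeumannAlgebra

variable {H : Type u} [NormedAddCommGroup H] [InnerProductSpace ℂ H] [CompleteSpace H]

theorem isClosed_toStarSubalgebra (A : VonNeumannAlgebra H) :
    IsClosed (A.toStarSubalgebra : Set (H →L[ℂ] H)) := by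
  have := A.centralizer_centralizer
  rw [VonNeumannAlgebra.coe_toStarSubalgebra, ← this]
  exact Set.isClosed_centralizer _

noncomputable instance (A : VonNeumannAlgebra H) : CStarAlgebra A.toStarSubalgebra :=
  StarSubalgebra.cstarAlgebra A.toStarSubalgebra (h_closed := A.isClosed_toStarSubalgebra)

lemma mem_of_commute (A : VonNeumannAlgebra H) {x : H →L[ℂ] H}
    (h : ∀ c ∈ Set.centralizer (A : Set (H →L[ℂ] H)), c * x = x * c) : x ∈ A := by
  rw [← SetLike.mem_coe, ← A.centralizer_centralizer]
  exact h

lemma mem_of_tendsto (A : VonNeumannAlgebra H) {ι : Type*} {l : Filter ι} [l.NeBot]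
    {f : ι → H →L[ℂ] H} {T : H →L[ℂ] H} (hf : ∀ i, f i ∈ A)
    (hT : ∀ v, Tendsto (fun i => f i v) l (𝓝 (T v))) : T ∈ A := by
  refine A.mem_of_commute fun c hc => ?_
  ext v
  refine tendsto_nhds_unique ((c.continuous.tendsto _).comp (hT v)) ?_
  refine (hT (c v)).congr fun i => ?_
  exact congr($(hc (f i) (hf i)) v)

/-- The order is that of operators. A positive element of `A` is a square inside `A`, because its
square root commutes with the commutant. -/
instance (A : VonNeumannAlgebra H) : StarOrderedRing A.toStarSubalgebra := by
  refine StarOrderedRing.of_nonneg_iff' (fun h z => add_le_add_right h z) fun x => ⟨fun hx => ?_, ?_⟩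
  · have hx' : (0 : H →L[ℂ] H) ≤ x := hx
    have hs : CFC.sqrt (x : H →L[ℂ] H) ∈ A := A.mem_of_commute fun c hc =>
      ((Commute.cfcₙ_nnreal (a := (x : H →L[ℂ] H)) (b := c) (hc x x.2) _).eq).symm
    refine ⟨⟨_, hs⟩, Subtype.ext ?_⟩
    change (x : H →L[ℂ] H) = star (CFC.sqrt (x : H →L[ℂ] H)) * CFC.sqrt (x : H →L[ℂ] H)
    rw [(IsSelfAdjoint.of_nonneg (CFC.sqrt_nonneg (x : H →L[ℂ] H))).star_eq,
      CFC.sqrt_mul_sqrt_self (x : H →L[ℂ] H) hx']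
  · rintro ⟨s, rfl⟩
    exact star_mul_self_nonneg (s : H →L[ℂ] H)

variable (A : VonNeumannAlgebra H)

/-- A monotone net in `A` with least upper bound `x` converges strongly to `x`. -/
lemma tendsto_of_isLUB {ι : Type*} [Preorder ι] [IsDirectedOrder ι] [Nonempty ι]
    {f : ι → A.toStarSubalgebra} (hf : Monotone f) {x : A.toStarSubalgebra} (hx : IsLUB (Set.range f) x) (v : H) :
    Tendsto (fun i => (f i : H →L[ℂ] H) v) atTop (𝓝 ((x : H →L[ℂ] H) v)) := by
  obtain ⟨T, hT⟩ := ContinuousLinearMap.exists_strong_limit_of_monotone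
    (f := fun i => (f i : H →L[ℂ] H)) (fun i j h => hf h) (B := x)
    (fun i => hx.1 ⟨i, rfl⟩)
  have hTA : T ∈ A := A.mem_of_tendsto (fun i => (f i).2) hT
  have h1 : ∀ S : H →L[ℂ] H, ∀ v, Tendsto (fun i => inner ℂ v ((S - f i) v)) atTop
      (𝓝 (inner ℂ v ((S - T) v))) := fun S v =>
    (tendsto_const_nhds.inner (tendsto_const_nhds.sub (hT v)))
  have hub : ∀ i, (f i : H →L[ℂ] H) ≤ T := fun i =>
    ContinuousLinearMap.le_iff_inner_nonneg.2 fun v => by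
      refine ge_of_tendsto (tendsto_const_nhds.inner ((hT v).sub tendsto_const_nhds)) ?_
      filter_upwards [mem_atTop i] with j hj
      exact ContinuousLinearMap.le_iff_inner_nonneg.1
        (show (f i : H →L[ℂ] H) ≤ f j from hf hj) v
  -- The strong limit lies in `A`, so it competes with `x` among the upper bounds in `A`.
  have h2 : (x : H →L[ℂ] H) ≤ T := by
    have := hx.2 (show (⟨T, hTA⟩ : A.toStarSubalgebra) ∈ upperBounds (Set.range f) by
      rintro _ ⟨i, rfl⟩; exact hub i)
    exact this
  have h3 : T ≤ x := ContinuousLinearMap.le_iff_inner_nonneg.2 fun v =>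
    ge_of_tendsto (h1 x v) (Eventually.of_forall fun i =>
      ContinuousLinearMap.le_iff_inner_nonneg.1 (hx.1 ⟨i, rfl⟩ : f i ≤ x) v)
  rw [le_antisymm h2 h3]
  exact hT v

/-- A strong limit of a monotone net in `A` is its least upper bound. -/
lemma isLUB_of_tendsto {ι : Type*} [Preorder ι] [IsDirectedOrder ι] [Nonempty ι]
    {f : ι → A.toStarSubalgebra} (hf : Monotone f) {x : A.toStarSubalgebra}
    (hx : ∀ v, Tendsto (fun i => (f i : H →L[ℂ] H) v) atTop (𝓝 ((x : H →L[ℂ] H) v))) :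
    IsLUB (Set.range f) x := by
  constructor
  · rintro _ ⟨i, rfl⟩
    refine ContinuousLinearMap.le_iff_inner_nonneg.2 fun v => ?_
    refine ge_of_tendsto (tendsto_const_nhds.inner ((hx v).sub tendsto_const_nhds)) ?_
    filter_upwards [mem_atTop i] with j hj
    exact ContinuousLinearMap.le_iff_inner_nonneg.1 (hf hj) v
  · intro S hS
    refine ContinuousLinearMap.le_iff_inner_nonneg.2 fun v => ?_
    exact ge_of_tendsto (tendsto_const_nhds.inner (tendsto_const_nhds.sub (hx v)))
      (Eventually.of_forall fun i =>
        ContinuousLinearMap.le_iff_inner_nonneg.1 (hS ⟨i, rfl⟩ : f i ≤ S) v)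

end VonNeumannAlgebra

namespace TracialVonNeumannAlgebra

variable {H : Type u} [NormedAddCommGroup H] [InnerProductSpace ℂ H] [CompleteSpace H]
variable (M : TracialVonNeumannAlgebra H)

/-- Normality of the trace along monotone nets. -/
lemma tendsto_trace {ι : Type*} [Preorder ι] [IsDirectedOrder ι] [Nonempty ι]
    {f : ι → M} (hf : Monotone f) {x : M}
    (hx : ∀ v, Tendsto (fun i => (f i : H →L[ℂ] H) v) atTop (𝓝 ((x : H →L[ℂ] H) v))) :
    Tendsto (fun i => (M.trace (f i)).re) atTop (𝓝 (M.trace x).re) := by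
  have h1 := M.trace_normal (d := Set.range f) (Set.range_nonempty _) hf.directed_le.directedOn_range
    (M.isLUB_of_tendsto hf hx)
  rw [← Set.range_comp] at h1
  have h2 : Monotone fun i => (M.trace (f i)).re := fun i j h =>
    (Complex.le_def.1 (M.trace_normal.monotone (hf h))).1
  refine tendsto_atTop_isLUB h2 ⟨?_, fun b hb => ?_⟩
  · rintro _ ⟨i, rfl⟩
    exact (Complex.le_def.1 (h1.1 ⟨i, rfl⟩)).1
  · have h3 : ∀ i, (M.trace (f i)).im = (M.trace x).im := fun i =>
      (Complex.le_def.1 (h1.1 ⟨i, rfl⟩)).2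
    have h4 : (M.trace x) ≤ (⟨b, (M.trace x).im⟩ : ℂ) := h1.2 (by
      rintro _ ⟨i, rfl⟩
      exact Complex.le_def.2 ⟨hb ⟨i, rfl⟩, h3 i⟩)
    exact (Complex.le_def.1 h4).1

end TracialVonNeumannAlgebra

/-! ### Inverses of elements above 1 -/

section OneLe

variable {A : Type*} [CStarAlgebra A] [PartialOrder A] [StarOrderedRing A]

lemma isUnit_of_one_le {b : A} (hb : 1 ≤ b) : IsUnit b := CStarAlgebra.isUnit_of_le 1 hb

lemma ringInverse_nonneg_of_one_le {b : A} (hb : 1 ≤ b) : 0 ≤ Ring.inverse b := by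
  obtain ⟨u, rfl⟩ := isUnit_of_one_le hb
  have h0 : (0 : A) ≤ u := zero_le_one.trans hb
  have h := star_left_conjugate_nonneg h0 (↑u⁻¹ : A)
  have hs : star (↑u⁻¹ : A) * u = 1 := by
    have h1 : star (↑(u⁻¹) : A) * star (u : A) = 1 := by rw [← star_mul, u.mul_inv, star_one]
    rwa [(IsSelfAdjoint.of_nonneg h0).star_eq] at h1
  rwa [hs, one_mul, ← Ring.inverse_unit] at h

lemma one_sub_ringInverse_nonneg {b : A} (hb : 1 ≤ b) : 0 ≤ 1 - Ring.inverse b := by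
  have := CStarAlgebra.ringInverse_le_ringInverse (a := (1 : A)) (b := b) hb
  rw [Ring.inverse_one] at this
  exact sub_nonneg.2 this

/-- The difference of the two sides, `b - 2 + b⁻¹`, equals `(b - 1) b⁻¹ (b - 1)`. -/
lemma one_sub_ringInverse_le {b : A} (hb : 1 ≤ b) : 1 - Ring.inverse b ≤ b - 1 := by
  have hu := isUnit_of_one_le hb
  have hbs : IsSelfAdjoint (b - 1) := IsSelfAdjoint.of_nonneg (sub_nonneg.2 hb)
  have h := star_left_conjugate_nonneg (ringInverse_nonneg_of_one_le hb) (b - 1)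
  rw [hbs.star_eq, sub_mul, Ring.mul_inverse_cancel _ hu, one_mul, sub_mul, one_mul,
    mul_sub, Ring.inverse_mul_cancel _ hu, mul_one] at h
  rw [← sub_nonneg]
  convert h using 1

/-- With `a = b⁻¹`, conjugating the hypothesis by `a` gives `c (da)⋆(da) ≤ aba = a ≤ 1`. -/
lemma norm_mul_ringInverse_sq_le {b d : A} {c : ℕ} (hb : 1 ≤ b) (hd : c • (star d * d) ≤ b) :
    c * ‖d * Ring.inverse b‖ ^ 2 ≤ 1 := by
  have hu := isUnit_of_one_le hb
  set a := Ring.inverse b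
  have ha : IsSelfAdjoint a := IsSelfAdjoint.of_nonneg (ringInverse_nonneg_of_one_le hb)
  have h := star_left_conjugate_le_conjugate hd a
  have e1 : star a * (c • (star d * d)) * a = c • (star (d * a) * (d * a)) := by
    simp only [mul_smul_comm, smul_mul_assoc, star_mul, mul_assoc]
  rw [e1, ha.star_eq, Ring.inverse_mul_cancel _ hu, one_mul] at h
  have h1 : c • (star (d * a) * (d * a)) ≤ 1 := h.trans (sub_nonneg.1 (one_sub_ringInverse_nonneg hb))
  have h0 : 0 ≤ c • (star (d * a) * (d * a)) := nsmul_nonneg (star_mul_self_nonneg _) _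
  have h2 := CStarAlgebra.norm_le_norm_of_nonneg_of_le h0 h1
  have h3 : ‖(1 : A)‖ ≤ 1 := by
    rcases subsingleton_or_nontrivial A with hs | hs
    · simp [Subsingleton.elim (1 : A) 0]
    · exact CStarRing.norm_one.le
  rw [← Nat.cast_smul_eq_nsmul ℝ, norm_smul, CStarRing.norm_star_mul_self] at h2
  simp only [Real.norm_natCast] at h2
  nlinarith

end OneLe

/-! ### Completeness of balls for the 2-norm -/

namespace TracialVonNeumannAlgebra

variable {H : Type u} [NormedAddCommGroup H] [InnerProductSpace ℂ H] [CompleteSpace H]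
variable (M : TracialVonNeumannAlgebra H)

lemma normSq_one : M.normSq 1 = 1 := by simp [normSq, M.trace_one]

lemma normSq_le_norm_sq (x : M) : M.normSq x ≤ ‖x‖ ^ 2 := by
  have := M.normSq_mul_le_left x 1
  rwa [mul_one, normSq_one, mul_one] at this

lemma trace_re_mono {x y : M} (h : x ≤ y) : (M.trace x).re ≤ (M.trace y).re :=
  (Complex.le_def.1 (M.trace_normal.monotone h)).1

lemma normSq_le_trace {p : M} (h0 : 0 ≤ p) (h1 : p ≤ 1) : M.normSq p ≤ (M.trace p).re := by
  refine M.trace_re_mono ?_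
  rw [(IsSelfAdjoint.of_nonneg h0).star_eq]
  obtain ⟨s, hs, rfl⟩ : ∃ s : M, star s = s ∧ p = s * s :=
    ⟨CFC.sqrt p, (IsSelfAdjoint.of_nonneg (CFC.sqrt_nonneg p)).star_eq,
      (CFC.sqrt_mul_sqrt_self p h0).symm⟩
  have h := star_left_conjugate_le_conjugate h1 s
  rw [hs, mul_one] at h
  simpa only [mul_assoc] using h

lemma eq_zero_of_trace_eq_zero {p : M} (h0 : 0 ≤ p) (h : M.trace p = 0) : p = 0 := by
  obtain ⟨s, rfl⟩ := CStarAlgebra.nonneg_iff_eq_star_mul_self.1 h0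
  rw [M.trace_faithful s h, mul_zero]

lemma trace_re_nonneg {p : M} (h0 : 0 ≤ p) : 0 ≤ (M.trace p).re := by
  simpa using M.trace_re_mono h0

lemma trace_im_eq_zero {p : M} (h0 : 0 ≤ p) : (M.trace p).im = 0 := by
  simpa using (Complex.le_def.1 (M.trace_normal.monotone h0)).2.symm

section FastCauchy

variable {x : ℕ → M}

/-- `1 + ∑ 2ᵏ |x_{k+1} - x_k|²` over `m ≤ k < n`. -/
noncomputable def incrementSum (x : ℕ → M) (m n : ℕ) : M :=
  1 + ∑ k ∈ Finset.Ico m n, (2 ^ k) • (star (x (k + 1) - x k) * (x (k + 1) - x k))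

lemma incrementSum_mono (x : ℕ → M) {m m' n n' : ℕ} (hm : m' ≤ m) (hn : n ≤ n') :
    M.incrementSum x m n ≤ M.incrementSum x m' n' := by
  unfold incrementSum
  gcongr
  exact fun k _ _ => nsmul_nonneg (star_mul_self_nonneg (x (k + 1) - x k)) _

lemma one_le_incrementSum (x : ℕ → M) (m n : ℕ) : 1 ≤ M.incrementSum x m n :=
  le_add_of_nonneg_right (Finset.sum_nonneg fun k _ =>
    nsmul_nonneg (star_mul_self_nonneg (x (k + 1) - x k)) _)

lemma le_incrementSum (x : ℕ → M) {m n k : ℕ} (hm : m ≤ k) (hn : k < n) :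
    (2 ^ k) • (star (x (k + 1) - x k) * (x (k + 1) - x k)) ≤ M.incrementSum x m n :=
  (Finset.single_le_sum (f := fun k => (2 ^ k) • (star (x (k + 1) - x k) * (x (k + 1) - x k)))
    (fun _ _ => nsmul_nonneg (star_mul_self_nonneg _) _) (Finset.mem_Ico.2 ⟨hm, hn⟩)).trans
    (le_add_of_nonneg_left zero_le_one)

/-- Since `1 - b⁻¹ ≤ b - 1`, the trace is at most the sum of `2ᵏ 8⁻ᵏ = 4⁻ᵏ` over `k ≥ m`. -/
lemma trace_one_sub_inverse_incrementSum_le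
    (hx : ∀ k, M.normSq (x (k + 1) - x k) ≤ (1 / 8) ^ k) (m n : ℕ) :
    (M.trace (1 - Ring.inverse (M.incrementSum x m n))).re ≤ 2 * (1 / 4) ^ m := by
  refine (M.trace_re_mono (one_sub_ringInverse_le (M.one_le_incrementSum x m n))).trans ?_
  have e : (M.trace (M.incrementSum x m n - 1)).re =
      ∑ k ∈ Finset.Ico m n, 2 ^ k * M.normSq (x (k + 1) - x k) := by
    simp only [incrementSum, normSq, add_sub_cancel_left, map_sum, map_nsmul, Complex.re_sum]
    refine Finset.sum_congr rfl fun k _ => ?_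
    rw [nsmul_eq_mul, ← Complex.re_ofReal_mul]
    push_cast
    rfl
  rw [e]
  have h1 : ∀ k ∈ Finset.Ico m n, 2 ^ k * M.normSq (x (k + 1) - x k) ≤ (1 / 4 : ℝ) ^ k := by
    intro k _
    calc (2 : ℝ) ^ k * M.normSq (x (k + 1) - x k) ≤ 2 ^ k * (1 / 8) ^ k := by gcongr; exact hx k
      _ = (1 / 4 : ℝ) ^ k := by rw [← mul_pow]; norm_num
  refine (Finset.sum_le_sum h1).trans ?_
  rcases le_total n m with hmn | hmn
  · rw [Finset.Ico_eq_empty_of_le hmn]; simp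
  · rw [geom_sum_Ico (by norm_num) hmn]
    rw [div_le_iff_of_neg (by norm_num)]
    have : (0 : ℝ) < (1 / 4) ^ n := by positivity
    have : (0 : ℝ) < (1 / 4) ^ m := by positivity
    linarith

/-- A bounded sequence whose increments are `2`-norm small converges strongly, in the following
quantitative sense: the increments are uniformly small off an operator of small trace. -/
lemma exists_uniform_increment_bound
    (hx : ∀ k, M.normSq (x (k + 1) - x k) ≤ (1 / 8) ^ k) :
    ∃ P : ℕ → M, (∀ m, 0 ≤ P m ∧ P m ≤ 1) ∧ (∀ m, (M.trace (P m)).re ≤ 2 * (1 / 4) ^ m) ∧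
      (∀ v, Tendsto (fun m => (P m : H →L[ℂ] H) v) atTop (𝓝 0)) ∧
      ∀ m k, m ≤ k → ∀ v, 2 ^ k * ‖((x (k + 1) - x k) * (1 - P m) : H →L[ℂ] H) v‖ ^ 2
        ≤ ‖v‖ ^ 2 := by
  -- Noncommutative Egorov, with `1 - b⁻¹` in the role of the exceptional projection: it has small
  -- trace, while its complement `b⁻¹` makes every increment small in norm. As inversion is
  -- antitone, it increases with `n` and decreases with `m`.
  set p : ℕ → ℕ → M := fun m n => 1 - Ring.inverse (M.incrementSum x m n) with hp
  have hp0 : ∀ m n, 0 ≤ p m n := fun m n =>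
    one_sub_ringInverse_nonneg (M.one_le_incrementSum x m n)
  have hp1 : ∀ m n, p m n ≤ 1 := fun m n => sub_le_self _
    (ringInverse_nonneg_of_one_le (M.one_le_incrementSum x m n))
  have hpm : ∀ {m m' n n'}, m' ≤ m → n ≤ n' → p m n ≤ p m' n' := fun {m m' n n'} h1 h2 =>
    sub_le_sub_left (CStarAlgebra.ringInverse_le_ringInverse (M.incrementSum_mono x h1 h2)
      (isStrictlyPositive_one.of_le (M.one_le_incrementSum x m n))) _
  have hlim : ∀ m, ∃ P : M, ∀ v,
      Tendsto (fun n => (p m n : H →L[ℂ] H) v) atTop (𝓝 ((P : H →L[ℂ] H) v)) := fun m => by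
    obtain ⟨T, hT⟩ := ContinuousLinearMap.exists_strong_limit_of_monotone
      (f := fun n => (p m n : H →L[ℂ] H)) (fun i j h => hpm le_rfl h) (B := 1) (hp1 m)
    exact ⟨⟨T, M.mem_of_tendsto (fun n => (p m n).2) hT⟩, hT⟩
  choose P hP using hlim
  have hlub : ∀ m, IsLUB (Set.range (p m)) (P m) := fun m =>
    M.isLUB_of_tendsto (fun i j h => hpm le_rfl h) (hP m)
  have hP0 : ∀ m, 0 ≤ P m := fun m => (hp0 m 0).trans ((hlub m).1 ⟨0, rfl⟩)
  have hP1 : ∀ m, P m ≤ 1 := fun m => (hlub m).2 (by rintro _ ⟨n, rfl⟩; exact hp1 m n)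
  have hPanti : Antitone P := fun m m' h => (hlub m').2 (by
    rintro _ ⟨n, rfl⟩
    exact (hpm h le_rfl).trans ((hlub m).1 ⟨n, rfl⟩))
  have htr : ∀ m, (M.trace (P m)).re ≤ 2 * (1 / 4) ^ m := fun m =>
    le_of_tendsto (M.tendsto_trace (fun i j h => hpm le_rfl h) (hP m))
      (Eventually.of_forall fun n => M.trace_one_sub_inverse_incrementSum_le hx m n)
  refine ⟨P, fun m => ⟨hP0 m, hP1 m⟩, htr, ?_, ?_⟩
  -- The strong limit `E` of `1 - P m` satisfies `τ(1 - E) = 0` by normality, so `E = 1` by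
  -- faithfulness.
  · have hmono : Monotone fun m => 1 - P m := fun i j h => sub_le_sub_left (hPanti h) _
    obtain ⟨E, hE⟩ := ContinuousLinearMap.exists_strong_limit_of_monotone
      (f := fun m => ((1 - P m : M) : H →L[ℂ] H)) (fun i j h => hmono h) (B := 1)
      (fun m => sub_le_self (1 : M) (hP0 m))
    let E' : M := ⟨E, M.mem_of_tendsto (fun n => (1 - P n).2) hE⟩
    have hElub := M.isLUB_of_tendsto (x := E') hmono hE
    have hE1 : 0 ≤ 1 - E' := sub_nonneg.2 (hElub.2 (by
      rintro _ ⟨m, rfl⟩; exact sub_le_self (1 : M) (hP0 m)))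
    have htrE : (M.trace (1 - E')).re = 0 := by
      have h1 := M.tendsto_trace (x := E') hmono hE
      have h2 : Tendsto (fun m => (M.trace (1 - P m)).re) atTop (𝓝 1) := by
        have h3 : Tendsto (fun m => (M.trace (P m)).re) atTop (𝓝 0) := by
          refine squeeze_zero (fun m => M.trace_re_nonneg (hP0 m)) htr ?_
          simpa using (tendsto_pow_atTop_nhds_zero_of_lt_one (r := (1 / 4 : ℝ)) (by norm_num)
            (by norm_num)).const_mul 2
        simpa [M.trace_one] using h3.const_sub 1
      have h4 := tendsto_nhds_unique h1 h2
      simp [M.trace_one, h4]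
    have hE2 : E' = 1 := by
      have := M.eq_zero_of_trace_eq_zero hE1 (Complex.ext htrE (M.trace_im_eq_zero hE1))
      exact (sub_eq_zero.1 this).symm
    have hE3 : E = 1 := congrArg Subtype.val hE2
    intro v
    have h := (hE v).const_sub v
    rw [hE3] at h
    simpa using h
  · intro m k hmk v
    have h1 : ∀ᶠ n in atTop, 2 ^ k * ‖((x (k + 1) - x k) * (1 - p m n) : H →L[ℂ] H) v‖ ^ 2
        ≤ ‖v‖ ^ 2 := by
      filter_upwards [eventually_gt_atTop k] with n hn
      have h2 := norm_mul_ringInverse_sq_le (M.one_le_incrementSum x m n)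
        (M.le_incrementSum x hmk hn)
      have h3 : ((x (k + 1) - x k) * (1 - p m n) : H →L[ℂ] H) =
          ((x (k + 1) - x k) * Ring.inverse (M.incrementSum x m n) : M) := by
        simp [hp]
      rw [h3]
      set z := (x (k + 1) - x k) * Ring.inverse (M.incrementSum x m n)
      have h4 : ‖(z : H →L[ℂ] H) v‖ ≤ ‖z‖ * ‖v‖ := ContinuousLinearMap.le_opNorm _ _
      push_cast at h2
      calc 2 ^ k * ‖(z : H →L[ℂ] H) v‖ ^ 2 ≤ 2 ^ k * (‖z‖ * ‖v‖) ^ 2 := by gcongr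
        _ = 2 ^ k * ‖z‖ ^ 2 * ‖v‖ ^ 2 := by ring
        _ ≤ 1 * ‖v‖ ^ 2 := by gcongr
        _ = _ := one_mul _
    refine le_of_tendsto ?_ h1
    have h2 : Tendsto (fun n => ((x (k + 1) - x k) * (1 - p m n) : H →L[ℂ] H) v) atTop
        (𝓝 (((x (k + 1) - x k) * (1 - P m) : H →L[ℂ] H) v)) := by
      refine ((x (k + 1) - x k : H →L[ℂ] H).continuous.tendsto _).comp ?_
      simpa using (hP m v).const_sub v
    exact (h2.norm.pow 2).const_mul _

/-- Split `v = (1 - P m)v + (P m)v`. On the first part the increments are dominated by a geometric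
series; on the second, boundedness leaves `2C‖(P m)v‖`, which tends to `0`. So the sequence
converges strongly, and the same splitting of `y - x m` gives convergence in 2-norm. -/
theorem exists_limit_of_fast_cauchy {C : ℝ} (hC : ∀ n, ‖x n‖ ≤ C)
    (hx : ∀ k, M.normSq (x (k + 1) - x k) ≤ (1 / 8) ^ k) :
    ∃ y : M, ‖y‖ ≤ C ∧ Tendsto (fun n => M.normSq (x n - y)) atTop (𝓝 0) := by
  obtain ⟨P, hP01, htr, hP, hinc⟩ := M.exists_uniform_increment_bound hx
  have hC0 : 0 ≤ C := (norm_nonneg _).trans (hC 0)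
  -- The bound on increments concerns squared norms, `2ᵏ‖·‖² ≤ ‖v‖²`, hence the ratio `√(1/2)`.
  set r : ℝ := √(1 / 2) with hr
  have hr0 : 0 ≤ r := Real.sqrt_nonneg _
  have hr1 : r < 1 := by rw [hr, Real.sqrt_lt' one_pos]; norm_num
  have hr2 : r ^ 2 = 1 / 2 := Real.sq_sqrt (by norm_num)
  have hinc' : ∀ m k, m ≤ k → ∀ v,
      ‖((x (k + 1) - x k) * (1 - P m) : H →L[ℂ] H) v‖ ≤ r ^ k * ‖v‖ := fun m k h v => by
    refine le_of_sq_le_sq (a := _) ?_ (by positivity)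
    have h1 := hinc m k h v
    have h2 : (r ^ k * ‖v‖) ^ 2 = (1 / 2) ^ k * ‖v‖ ^ 2 := by
      rw [mul_pow, ← pow_mul, mul_comm k, pow_mul, hr2]
    rw [h2, one_div, inv_pow, inv_mul_eq_div, le_div_iff₀ (by positivity)]
    linarith
  have hdiff : ∀ m k, m ≤ k → ∀ v,
      ‖((x k - x m) * (1 - P m) : H →L[ℂ] H) v‖ ≤ r ^ m / (1 - r) * ‖v‖ := by
    intro m k h v
    have h1 : ∀ k, m ≤ k → ‖((x k - x m) * (1 - P m) : H →L[ℂ] H) v‖ ≤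
        (∑ j ∈ Finset.Ico m k, r ^ j) * ‖v‖ := by
      intro k hk
      induction k, hk using Nat.le_induction with
      | base => simp
      | succ k hk ih =>
        have e : ((x (k + 1) - x m) * (1 - P m) : H →L[ℂ] H) v =
            ((x (k + 1) - x k) * (1 - P m) : H →L[ℂ] H) v +
            ((x k - x m) * (1 - P m) : H →L[ℂ] H) v := by
          rw [← add_apply, ← add_mul]
          congr 2
          abel
        rw [e, Finset.sum_Ico_succ_top hk, add_mul]
        refine (norm_add_le _ _).trans ?_
        rw [add_comm]
        exact add_le_add ih (hinc' m k hk v)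
    refine (h1 k h).trans ?_
    gcongr
    rw [geom_sum_Ico' hr1.ne h]
    have : 0 ≤ r ^ k := by positivity
    have h1r : 0 < 1 - r := by linarith
    gcongr
    linarith
  have hsplit : ∀ m k, m ≤ k → ∀ v, ‖(x k : H →L[ℂ] H) v - (x m : H →L[ℂ] H) v‖ ≤
      r ^ m / (1 - r) * ‖v‖ + 2 * C * ‖(P m : H →L[ℂ] H) v‖ := by
    intro m k h v
    have e : (x k : H →L[ℂ] H) v - (x m : H →L[ℂ] H) v =
        ((x k - x m) * (1 - P m) : H →L[ℂ] H) v + (x k - x m : H →L[ℂ] H) ((P m : H →L[ℂ] H) v) := by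
      change _ = (x k - x m : H →L[ℂ] H) ((1 - P m : H →L[ℂ] H) v) + _
      rw [← map_add]
      simp
    rw [e]
    refine (norm_add_le _ _).trans (add_le_add (hdiff m k h v) ?_)
    refine (ContinuousLinearMap.le_opNorm _ _).trans ?_
    gcongr
    refine (norm_sub_le _ _).trans ?_
    have h1 : ‖(x k : H →L[ℂ] H)‖ ≤ C := hC k
    have h2 : ‖(x m : H →L[ℂ] H)‖ ≤ C := hC m
    linarith
  have hrt : Tendsto (fun m => r ^ m / (1 - r)) atTop (𝓝 0) := by
    simpa using (tendsto_pow_atTop_nhds_zero_of_lt_one hr0 hr1).div_const (1 - r)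
  have hconv : ∀ v, ∃ w, Tendsto (fun k => (x k : H →L[ℂ] H) v) atTop (𝓝 w) := by
    intro v
    refine cauchySeq_tendsto_of_complete (cauchySeq_of_le_tendsto_0'
      (fun m => r ^ m / (1 - r) * ‖v‖ + 2 * C * ‖(P m : H →L[ℂ] H) v‖) (fun m k h => ?_) ?_)
    · rw [dist_comm, dist_eq_norm]
      exact hsplit m k h v
    · simpa using (hrt.mul_const ‖v‖).add ((hP v).norm.const_mul (2 * C))
  obtain ⟨T, hTC, hT⟩ := ContinuousLinearMap.exists_limit_of_eventually_norm_le
    (l := atTop) (f := fun k => (x k : H →L[ℂ] H)) (C := C) (Eventually.of_forall hC) hconv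
  let y : M := ⟨T, M.mem_of_tendsto (fun n => (x n).2) hT⟩
  refine ⟨y, hTC, ?_⟩
  have h1r : 0 < 1 - r := by linarith
  have hy : ∀ m, ‖(y - x m) * (1 - P m)‖ ≤ r ^ m / (1 - r) := fun m => by
    refine ContinuousLinearMap.opNorm_le_bound _ (by positivity) fun v => ?_
    refine le_of_tendsto (f := fun k => ‖((x k - x m) * (1 - P m) : H →L[ℂ] H) v‖) ?_
      (eventually_atTop.2 ⟨m, fun k hk => hdiff m k hk v⟩)
    exact ((hT _).sub tendsto_const_nhds).norm
  have hmain : ∀ m, M.normSq (x m - y) ≤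
      2 * ((r ^ m / (1 - r)) ^ 2 + (2 * C) ^ 2 * (2 * (1 / 4) ^ m)) := fun m => by
    have e : x m - y = -((y - x m) * (1 - P m) + (y - x m) * P m) := by noncomm_ring
    rw [e, normSq_neg]
    refine (M.normSq_add_le _ _).trans ?_
    gcongr
    · refine (M.normSq_le_norm_sq _).trans ?_
      gcongr
      exact hy m
    · refine (M.normSq_mul_le_left _ _).trans ?_
      have h1 : ‖(y - x m : M)‖ ≤ 2 * C := by
        refine (norm_sub_le _ _).trans ?_
        have h1 : ‖y‖ ≤ C := hTC
        linarith [hC m]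
      have h2 := (M.normSq_le_trace (hP01 m).1 (hP01 m).2).trans (htr m)
      exact mul_le_mul (pow_le_pow_left₀ (norm_nonneg _) h1 2) h2 (M.normSq_nonneg _)
        (by positivity)
  refine squeeze_zero (fun m => M.normSq_nonneg _) hmain ?_
  have h4 : Tendsto (fun m : ℕ => (1 / 4 : ℝ) ^ m) atTop (𝓝 0) :=
    tendsto_pow_atTop_nhds_zero_of_lt_one (by norm_num) (by norm_num)
  simpa using ((hrt.pow 2).add ((h4.const_mul 2).const_mul ((2 * C) ^ 2))).const_mul 2

end FastCauchy

/-- Balls of `M` are complete for the `2`-norm. -/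
theorem exists_limit_of_cauchy {x : ℕ → M} {C : ℝ} (hC : ∀ n, ‖x n‖ ≤ C)
    (hx : ∀ ε : ℝ, 0 < ε → ∃ N, ∀ m ≥ N, ∀ n ≥ N, M.normSq (x m - x n) < ε) :
    ∃ y : M, ‖y‖ ≤ C ∧ Tendsto (fun n => M.normSq (x n - y)) atTop (𝓝 0) := by
  choose N hN using fun k : ℕ => hx ((1 / 8) ^ k) (by positivity)
  -- Partial sums of `N` give indices that are monotone in `k` and dominate each `N k`.
  set φ : ℕ → ℕ := fun k => ∑ i ∈ Finset.range (k + 1), N i with hφ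
  have hφN : ∀ k, N k ≤ φ k := fun k =>
    Finset.single_le_sum (f := N) (fun _ _ => Nat.zero_le _) (Finset.self_mem_range_succ k)
  have hφm : ∀ k, φ k ≤ φ (k + 1) := fun k => by
    rw [hφ]; simp only [Finset.sum_range_succ _ (k + 1)]; omega
  obtain ⟨y, hy, hlim⟩ := M.exists_limit_of_fast_cauchy (x := fun k => x (φ k))
    (fun k => hC _) (fun k => (hN k _ ((hφN k).trans (hφm k)) _ (hφN k)).le)
  refine ⟨y, hy, ?_⟩
  rw [Metric.tendsto_atTop]
  intro ε hε
  have h8 : Tendsto (fun k : ℕ => (1 / 8 : ℝ) ^ k) atTop (𝓝 0) :=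
    tendsto_pow_atTop_nhds_zero_of_lt_one (by norm_num) (by norm_num)
  obtain ⟨k, hk1, hk2⟩ := ((h8.eventually_lt_const (show 0 < ε / 4 by positivity)).and
    (hlim.eventually_lt_const (show 0 < ε / 4 by positivity))).exists
  refine ⟨φ k, fun n hn => ?_⟩
  rw [Real.dist_eq, sub_zero, abs_of_nonneg (M.normSq_nonneg _)]
  have h1 := hN k n ((hφN k).trans hn) (φ k) (hφN k)
  have h2 := M.normSq_add_le (x n - x (φ k)) (x (φ k) - y)
  rw [sub_add_sub_cancel] at h2
  linarith

end TracialVonNeumannAlgebra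

/-! ### Hilbert spaces from positive semidefinite forms -/

/-- A complex vector space with a chosen positive semidefinite form. -/
def PreHilbert {V : Type*} [AddCommGroup V] [Module ℂ V]
    (_ : PreInnerProductSpace.Core ℂ V) : Type _ := V

namespace PreHilbert

variable {V : Type*} [AddCommGroup V] [Module ℂ V] (c : PreInnerProductSpace.Core ℂ V)

noncomputable instance : SeminormedAddCommGroup (PreHilbert c) :=
  InnerProductSpace.Core.toSeminormedAddCommGroup (𝕜 := ℂ) (F := V) (c := c)
noncomputable instance : InnerProductSpace ℂ (PreHilbert c) :=
  InnerProductSpace.ofCore (𝕜 := ℂ) (F := V) c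

/-- The Hilbert space completion. -/
abbrev Hilb : Type _ := UniformSpace.Completion (PreHilbert c)

/-- The canonical map into the completion. -/
noncomputable def of : V →ₗ[ℂ] Hilb c :=
  { toFun v := ((show PreHilbert c from v : PreHilbert c) : Hilb c)
    map_add' v w := UniformSpace.Completion.coe_add (α := PreHilbert c) v w
    map_smul' r v := UniformSpace.Completion.coe_smul (X := PreHilbert c) r v }

lemma inner_of (v w : V) : inner ℂ (of c v) (of c w) = c.inner v w :=
  UniformSpace.Completion.inner_coe (𝕜 := ℂ) (E := PreHilbert c) v w

lemma norm_sq_of (v : V) : ‖of c v‖ ^ 2 = (c.inner v v).re := by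
  rw [← inner_of, ← inner_self_eq_norm_sq (𝕜 := ℂ)]
  rfl

lemma denseRange_of : DenseRange (of c) :=
  UniformSpace.Completion.denseRange_coe (α := PreHilbert c)

lemma ext_op {K : Type*} [NormedAddCommGroup K] [NormedSpace ℂ K] {S T : Hilb c →L[ℂ] K}
    (h : ∀ v, S (of c v) = T (of c v)) : S = T :=
  ContinuousLinearMap.coeFn_injective ((denseRange_of c).equalizer S.continuous T.continuous
    (funext h))

variable {c}

lemma of_eq_of {v w : V} (h : ∀ z, c.inner z v = c.inner z w) : of c v = of c w := by
  refine (denseRange_of c).eq_of_inner_right ℂ fun z => ?_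
  rw [inner_of, inner_of, h]

/-- Boundedness of a linear map for the seminorm of `c`. -/
def BoundedBy (c : PreInnerProductSpace.Core ℂ V) (T : V →ₗ[ℂ] V) (C : ℝ) : Prop :=
  ∀ v, ‖of c (T v)‖ ≤ C * ‖of c v‖

/-- The extension of a bounded linear map to the completion. -/
noncomputable def op (T : V →ₗ[ℂ] V) {C : ℝ} (h : BoundedBy c T C) : Hilb c →L[ℂ] Hilb c :=
  (LinearMap.mkContinuous (E := PreHilbert c) (F := PreHilbert c) (𝕜 := ℂ) (𝕜₂ := ℂ)
    (σ := RingHom.id ℂ) { toFun := T, map_add' := T.map_add, map_smul' := T.map_smul } C (fun v => by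
      have h1 := h v
      have h2 : ∀ w : V, ‖of c w‖ = ‖(show PreHilbert c from w)‖ := fun w =>
        UniformSpace.Completion.norm_coe (E := PreHilbert c) w
      have e1 := h2 (T v)
      have e2 := h2 v
      rw [e1, e2] at h1
      exact h1)).completion

lemma op_of (T : V →ₗ[ℂ] V) {C : ℝ} (h : BoundedBy c T C) (v : V) :
    op T h (of c v) = of c (T v) :=
  ContinuousLinearMap.completion_apply_coe _ _

lemma norm_op_le (T : V →ₗ[ℂ] V) {C : ℝ} (hC : 0 ≤ C) (h : BoundedBy c T C) : ‖op T h‖ ≤ C :=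
  ContinuousLinearMap.opNorm_le_bound _ hC fun x => by
    induction x using UniformSpace.Completion.induction_on with
    | hp => exact isClosed_le (by fun_prop) (by fun_prop)
    | ih v => exact (congrArg norm (op_of T h v)).trans_le (h v)

lemma adjoint_op {T T' : V →ₗ[ℂ] V} {C C' : ℝ} (h : BoundedBy c T C) (h' : BoundedBy c T' C')
    (hT : ∀ v w, c.inner (T v) w = c.inner v (T' w)) : star (op T h) = op T' h' := by
  refine ext_op c fun w => (denseRange_of c).eq_of_inner_right ℂ fun v => ?_
  rw [ContinuousLinearMap.star_eq_adjoint, ContinuousLinearMap.adjoint_inner_right, op_of, op_of,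
    inner_of, inner_of, hT]

lemma BoundedBy.adjoint {T T' : V →ₗ[ℂ] V} {C : ℝ} (h : BoundedBy c T C)
    (hT : ∀ v w, c.inner (T v) w = c.inner v (T' w)) : BoundedBy c T' C := fun w => by
  have h1 : ‖of c (T' w)‖ ^ 2 = (inner ℂ (of c (T (T' w))) (of c w)).re := by
    rw [norm_sq_of, ← hT, inner_of]
  have h2 : (inner ℂ (of c (T (T' w))) (of c w)).re ≤ ‖of c (T (T' w))‖ * ‖of c w‖ :=
    re_inner_le_norm (𝕜 := ℂ) _ _
  have h3 : ‖of c (T' w)‖ * ‖of c (T' w)‖ ≤ ‖of c (T' w)‖ * (C * ‖of c w‖) := by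
    rw [← sq, h1]
    refine h2.trans ?_
    calc _ ≤ (C * ‖of c (T' w)‖) * ‖of c w‖ := by gcongr; exact h _
      _ = _ := by ring
  -- `C` is not assumed nonnegative, so the case `‖T'w‖ = 0` needs its own argument.
  rcases (norm_nonneg (of c (T' w))).eq_or_lt with h0 | h0
  · rw [← h0]
    by_contra hneg
    push Not at hneg
    have h5 : 0 < ‖of c w‖ := by
      by_contra h6
      have : ‖of c w‖ = 0 := le_antisymm (not_lt.1 h6) (norm_nonneg _)
      rw [this, mul_zero] at hneg
      exact lt_irrefl _ hneg
    have h6 : C < 0 := by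
      by_contra h7
      exact absurd hneg (not_lt.2 (mul_nonneg (not_lt.1 h7) h5.le))
    have h7 := h w
    have h8 : C * ‖of c w‖ < 0 := mul_neg_of_neg_of_pos h6 h5
    linarith [norm_nonneg (of c (T w))]
  · exact le_of_mul_le_mul_left h3 h0

/-- A `⋆`-action of a C⋆-algebra by linear maps, in the sense of the form `c`. -/
structure StarAction {A : Type*} [CStarAlgebra A] (c : PreInnerProductSpace.Core ℂ V)
    (π : A → V →ₗ[ℂ] V) : Prop where
  adjoint : ∀ x v w, c.inner (π x v) w = c.inner v (π (star x) w)
  mul : ∀ x y v w, c.inner v (π (x * y) w) = c.inner v (π x (π y w))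
  add : ∀ x y v w, c.inner v (π (x + y) w) = c.inner v (π x w) + c.inner v (π y w)
  smul : ∀ (r : ℂ) x v w, c.inner v (π (r • x) w) = r * c.inner v (π x w)
  one : ∀ v w, c.inner v (π 1 w) = c.inner v w

section StarAction

variable {A : Type*} [CStarAlgebra A] {π : A → V →ₗ[ℂ] V}

/-- Boundedness is automatic: `‖x‖² - x⋆x = y⋆y` for some `y`, whence `‖π(x)v‖² + ‖π(y)v‖² =
‖x‖²‖v‖²`. -/
lemma StarAction.boundedBy (h : StarAction c π) (x : A) : BoundedBy c (π x) ‖x‖ := fun v => by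
  let := CStarAlgebra.spectralOrder A
  have := CStarAlgebra.spectralOrderedRing A
  have h1 : star x * x ≤ algebraMap ℝ A (‖x‖ ^ 2) := CStarAlgebra.star_mul_le_algebraMap_norm_sq
  obtain ⟨y, hy⟩ := CStarAlgebra.nonneg_iff_eq_star_mul_self.1 (sub_nonneg.2 h1)
  have key : ∀ z, (c.inner (π z v) (π z v)).re = (c.inner v (π (star z * z) v)).re := fun z => by
    rw [h.adjoint, h.mul]
  have h2 : ((‖x‖ ^ 2 : ℝ) : ℂ) • (1 : A) = star x * x + star y * y := by
    rw [← hy, Algebra.algebraMap_eq_smul_one, add_sub_cancel, Complex.coe_smul]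
  have h3 : (c.inner v (π (((‖x‖ ^ 2 : ℝ) : ℂ) • (1 : A)) v)).re = ‖x‖ ^ 2 * (c.inner v v).re := by
    rw [h.smul, h.one, Complex.re_ofReal_mul]
  rw [h2, h.add, Complex.add_re, ← key, ← key, ← norm_sq_of, ← norm_sq_of, ← norm_sq_of] at h3
  refine le_of_sq_le_sq (a := _) ?_ (by positivity)
  rw [mul_pow]
  nlinarith [sq_nonneg ‖of c (π y v)‖]

/-- The ⋆-representation on the completion defined by a ⋆-action. -/
noncomputable def StarAction.rep (h : StarAction c π) : A →⋆ₐ[ℂ] (Hilb c →L[ℂ] Hilb c) where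
  toFun x := op (π x) (h.boundedBy x)
  map_one' := ext_op c fun v => by
    rw [op_of]
    exact of_eq_of fun z => h.one z v
  map_mul' x y := ext_op c fun v => by
    rw [ContinuousLinearMap.mul_def, ContinuousLinearMap.comp_apply, op_of, op_of, op_of]
    exact of_eq_of fun z => h.mul x y z v
  map_zero' := ext_op c fun v => by
    rw [op_of, zero_apply, ← map_zero (of c)]
    refine of_eq_of fun z => ?_
    have := h.smul 0 0 z v
    rw [zero_smul, zero_mul] at this
    rw [this, ← inner_of, map_zero, inner_zero_right]
  map_add' x y := ext_op c fun v => by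
    rw [add_apply, op_of, op_of, op_of, ← map_add]
    refine of_eq_of fun z => ?_
    rw [h.add, ← inner_of c z (π x v + π y v), map_add, inner_add_right, inner_of, inner_of]
  commutes' r := ext_op c fun v => by
    rw [op_of, Algebra.algebraMap_eq_smul_one, Algebra.algebraMap_eq_smul_one,
      smul_apply, one_apply_eq_self, ← map_smul]
    refine of_eq_of fun z => ?_
    rw [h.smul, h.one, ← inner_of c z (r • v), map_smul, inner_smul_right, inner_of]
  map_star' x := (adjoint_op _ _ (h.adjoint x)).symm

lemma StarAction.rep_of (h : StarAction c π) (x : A) (v : V) :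
    h.rep x (of c v) = of c (π x v) :=
  op_of _ (h.boundedBy x) _

end StarAction

end PreHilbert

/-! ### Averaging in Hilbert spaces -/

section Averaging

variable {K : Type*} [NormedAddCommGroup K] [InnerProductSpace ℂ K] [CompleteSpace K]

/-- In a closed convex set, a point of minimal norm is characterised by an obtuse angle condition;
we use it in the following form for the real part of the inner product. -/
lemma exists_nearest_point {D : Set K} (hne : D.Nonempty) (hD : IsClosed D) (hc : Convex ℝ D)
    (u : K) : ∃ p ∈ D, ∀ w ∈ D, (inner ℂ (u - p) (w - p)).re ≤ 0 := by
  let : InnerProductSpace ℝ K := InnerProductSpace.rclikeToReal ℂ K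
  obtain ⟨p, hp, h⟩ := exists_norm_eq_iInf_of_complete_convex hne hD.isComplete hc u
  exact ⟨p, hp, fun w hw => (norm_eq_iInf_iff_real_inner_le_zero hc hp).1 h w hw⟩

/-- The point `p` of minimal norm is fixed. As `Tp` stays in the convex set, `‖p‖² ≤ Re⟨p, Tp⟩`; as
`T` is isometric, `‖Tp - p‖² = 2‖p‖² - 2 Re⟨p, Tp⟩ ≤ 0`. -/
theorem exists_fixed_point_closure_convexHull {O : Set K} (hO : O.Nonempty)
    (S : Set (K →L[ℂ] K)) (hS : ∀ T ∈ S, ∀ v, ‖T v‖ = ‖v‖) (hSO : ∀ T ∈ S, ∀ v ∈ O, T v ∈ O) :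
    ∃ ζ ∈ closure (convexHull ℝ O), ∀ T ∈ S, T ζ = ζ := by
  set D := closure (convexHull ℝ O)
  obtain ⟨p, hp, h⟩ := exists_nearest_point (D := D) (hO.convexHull.closure) isClosed_closure
    (convex_convexHull ℝ O).closure 0
  refine ⟨p, hp, fun T hT => ?_⟩
  have h1 : T p ∈ D := by
    have hmaps : Set.MapsTo T (convexHull ℝ O) (convexHull ℝ O) := by
      have h2 : convexHull ℝ O ⊆ (T.restrictScalars ℝ) ⁻¹' (convexHull ℝ O) :=
        convexHull_min (fun v hv => subset_convexHull ℝ O (hSO T hT v hv))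
          ((convex_convexHull ℝ O).linear_preimage (T.restrictScalars ℝ).toLinearMap)
      exact h2
    exact hmaps.closure T.continuous hp
  have h2 := h _ h1
  have h3 : ‖T p - p‖ ^ 2 ≤ 0 := by
    have e := norm_sub_sq (𝕜 := ℂ) (T p) p
    have e2 : (inner ℂ p (T p)).re = RCLike.re (inner ℂ (T p) p) := by
      rw [← inner_conj_symm]; rfl
    have e3 : (inner ℂ p p).re = ‖p‖ ^ 2 := inner_self_eq_norm_sq (𝕜 := ℂ) p
    rw [zero_sub, inner_neg_left, inner_sub_right, Complex.neg_re, Complex.sub_re, e2, e3] at h2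
    rw [e, hS T hT]
    linarith
  have h4 : ‖T p - p‖ = 0 := by nlinarith [norm_nonneg (T p - p)]
  exact sub_eq_zero.1 (norm_eq_zero.1 h4)

end Averaging

/-! ### `L²` of a complete trace: averaging and Radon-Nikodym -/

/-- A faithful tracial state on a C⋆-algebra whose balls are complete in the `2`-norm. -/
structure IsCompleteTrace {A : Type*} [CStarAlgebra A] (τ : A →ₗ[ℂ] ℂ) : Prop where
  map_one : τ 1 = 1
  mul_comm : ∀ x y, τ (x * y) = τ (y * x)
  nonneg : ∀ x, 0 ≤ τ (star x * x)
  faithful : ∀ x, τ (star x * x) = 0 → x = 0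
  complete : ∀ (x : ℕ → A) (C : ℝ), (∀ n, ‖x n‖ ≤ C) →
    (∀ ε : ℝ, 0 < ε → ∃ N, ∀ m ≥ N, ∀ n ≥ N, (τ (star (x m - x n) * (x m - x n))).re < ε) →
    ∃ y, ‖y‖ ≤ C ∧ Tendsto (fun n => (τ (star (x n - y) * (x n - y))).re) atTop (𝓝 0)

lemma TracialVonNeumannAlgebra.isCompleteTrace {H : Type u} [NormedAddCommGroup H]
    [InnerProductSpace ℂ H] [CompleteSpace H] (M : TracialVonNeumannAlgebra H) :
    IsCompleteTrace M.trace where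
  map_one := M.trace_one
  mul_comm := M.trace_mul_comm
  nonneg := M.trace_nonneg
  faithful := M.trace_faithful
  complete _ _ h1 h2 := M.exists_limit_of_cauchy h1 h2

namespace IsCompleteTrace

open PreHilbert

variable {A : Type*} [CStarAlgebra A] {τ : A →ₗ[ℂ] ℂ} (h : IsCompleteTrace τ)
include h

/-- For self-adjoint `a`, the identity `4a = |1 + a|² - |1 - a|²` shows that `τ(a)` is real. -/
lemma map_star (x : A) : τ (star x) = star (τ x) := by
  have hsa : ∀ a : A, IsSelfAdjoint a → (τ a).im = 0 := fun a ha => by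
    have h1 := (Complex.nonneg_iff.1 (h.nonneg (1 + a))).2
    have h2 := (Complex.nonneg_iff.1 (h.nonneg (1 - a))).2
    have e : (4 : ℂ) • a = star (1 + a) * (1 + a) - star (1 - a) * (1 - a) := by
      rw [star_add, star_sub, star_one, ha.star_eq]
      have : (4 : ℂ) • a = a + a + a + a := by
        rw [show (4 : ℂ) = 1 + 1 + 1 + 1 by norm_num]; simp only [add_smul, one_smul]
      rw [this]; noncomm_ring
    have h3 := congrArg Complex.im (congrArg τ e)
    rw [map_sub, map_smul, Complex.sub_im, ← h1, ← h2, smul_eq_mul] at h3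
    simpa using h3
  have hx := realPart_add_I_smul_imaginaryPart x
  have h1 := hsa _ (realPart x).2
  have h2 := hsa _ (imaginaryPart x).2
  rw [← hx, star_add, star_smul, (realPart x).2.star_eq, (imaginaryPart x).2.star_eq]
  simp only [map_add, map_smul, smul_eq_mul]
  apply Complex.ext <;> simp [h1, h2]

/-- The form `⟨x, y⟩ = τ(x⋆y)`. -/
noncomputable def core : PreInnerProductSpace.Core ℂ A where
  inner x y := τ (star x * y)
  conj_inner_symm x y := by
    change star (τ (star y * x)) = _
    rw [← h.map_star, star_mul, star_star]
  re_inner_nonneg x := (Complex.nonneg_iff.1 (h.nonneg x)).1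
  add_left x y z := by rw [star_add, add_mul, map_add]
  smul_left x y r := by rw [star_smul, smul_mul_assoc, map_smul]; rfl

lemma inner_L2 (x y : A) : inner ℂ (of h.core x) (of h.core y) = τ (star x * y) := inner_of _ _ _

lemma norm_sq_L2 (x : A) : ‖of h.core x‖ ^ 2 = (τ (star x * x)).re := norm_sq_of _ _

lemma norm_sq_L2' (x : A) : ((‖of h.core x‖ ^ 2 : ℝ) : ℂ) = τ (star x * x) := by
  rw [norm_sq_L2]
  exact Complex.ext rfl (Complex.nonneg_iff.1 (h.nonneg x)).2

lemma of_injective : Function.Injective (of h.core) := fun x y hxy => by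
  have h1 : ‖of h.core (x - y)‖ ^ 2 = 0 := by rw [map_sub, hxy, sub_self]; simp
  exact sub_eq_zero.1 (h.faithful _ (by rw [← h.norm_sq_L2', h1, Complex.ofReal_zero]))

lemma leftAction : StarAction h.core (fun x : A => LinearMap.mulLeft ℂ x) where
  adjoint x v w := by
    change τ (star (x * v) * w) = τ (star v * (star x * w))
    rw [star_mul, mul_assoc]
  mul x y v w := by
    change τ (star v * (x * y * w)) = τ (star v * (x * (y * w)))
    rw [mul_assoc]
  add x y v w := by
    change τ (star v * ((x + y) * w)) = τ (star v * (x * w)) + τ (star v * (y * w))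
    rw [add_mul, mul_add, map_add]
  smul r x v w := by
    change τ (star v * (r • x * w)) = r * τ (star v * (x * w))
    rw [smul_mul_assoc, mul_smul_comm, map_smul, smul_eq_mul]
  one v w := by
    change τ (star v * (1 * w)) = τ (star v * w)
    rw [one_mul]

lemma rightAction : StarAction h.core (fun x : Aᵐᵒᵖ => LinearMap.mulRight ℂ x.unop) where
  adjoint x v w := by
    change τ (star (v * x.unop) * w) = τ (star v * (w * star x.unop))
    rw [star_mul, mul_assoc, h.mul_comm, mul_assoc]
  mul x y v w := by
    change τ (star v * (w * (y.unop * x.unop))) = τ (star v * (w * y.unop * x.unop))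
    rw [mul_assoc]
  add x y v w := by
    change τ (star v * (w * (x.unop + y.unop))) = τ (star v * (w * x.unop)) + τ (star v * (w * y.unop))
    rw [mul_add, mul_add, map_add]
  smul r x v w := by
    change τ (star v * (w * (r • x.unop))) = r * τ (star v * (w * x.unop))
    rw [mul_smul_comm, mul_smul_comm, map_smul, smul_eq_mul]
  one v w := by
    change τ (star v * (w * 1)) = τ (star v * w)
    rw [mul_one]

/-- Left multiplication on `L²(A, τ)`. -/
noncomputable def left : A →⋆ₐ[ℂ] (Hilb h.core →L[ℂ] Hilb h.core) := h.leftAction.rep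

/-- Right multiplication on `L²(A, τ)`. -/
noncomputable def right : Aᵐᵒᵖ →⋆ₐ[ℂ] (Hilb h.core →L[ℂ] Hilb h.core) := h.rightAction.rep

lemma left_of (x y : A) : h.left x (of h.core y) = of h.core (x * y) := h.leftAction.rep_of x y

lemma right_of (x y : A) : h.right (MulOpposite.op x) (of h.core y) = of h.core (y * x) :=
  h.rightAction.rep_of (MulOpposite.op x) y

lemma commute_left_right (x : A) (y : Aᵐᵒᵖ) : Commute (h.left x) (h.right y) := by
  refine ext_op _ fun v => ?_
  induction y using MulOpposite.rec' with
  | h y =>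
    change h.left x (h.right _ (of _ v)) = h.right _ (h.left x (of _ v))
    rw [left_of, right_of, right_of, left_of, mul_assoc]

/-- A `2`-norm limit of a bounded sequence, seen in `L²`, comes from an element. -/
lemma exists_of_tendsto {x : ℕ → A} {C : ℝ} (hC : ∀ n, ‖x n‖ ≤ C) {ζ : Hilb h.core}
    (hx : Tendsto (fun n => of h.core (x n)) atTop (𝓝 ζ)) : ∃ y, ‖y‖ ≤ C ∧ of h.core y = ζ := by
  obtain ⟨y, hy, hlim⟩ := h.complete x C hC fun ε hε => by
    obtain ⟨N, hN⟩ := Metric.cauchySeq_iff.1 hx.cauchySeq (√ε) (Real.sqrt_pos.2 hε)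
    refine ⟨N, fun m hm n hn => ?_⟩
    rw [← norm_sq_L2 h, map_sub, ← dist_eq_norm]
    calc _ < √ε ^ 2 := by gcongr; exact hN m hm n hn
      _ = ε := Real.sq_sqrt hε.le
  refine ⟨y, hy, tendsto_nhds_unique ?_ hx⟩
  rw [tendsto_iff_norm_sub_tendsto_zero]
  simp only [← norm_sq_L2 h, map_sub] at hlim
  simpa using hlim.sqrt

/-- The ball of radius `C`, seen in `L²`, is closed. -/
lemma isClosed_ball (C : ℝ) : IsClosed (of h.core '' Metric.closedBall 0 C) := by
  refine isClosed_of_closure_subset fun ζ hζ => ?_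
  obtain ⟨z, hz, hlim⟩ := mem_closure_iff_seq_limit.1 hζ
  choose x hx hxz using hz
  obtain ⟨y, hy, hyζ⟩ := h.exists_of_tendsto (x := x) (C := C)
    (fun n => by simpa using hx n) (ζ := ζ) (by simpa only [hxz] using hlim)
  exact ⟨y, by simpa using hy, hyζ⟩

/-- Averaging: the `2`-norm closed convex hull of `{u x u⋆ : u ∈ G}` meets the commutant of `G`. -/
theorem exists_average (G : Submonoid (unitary A)) (x : A) :
    ∃ y : A, ‖y‖ ≤ ‖x‖ ∧ (∀ u ∈ G, (u : A) * y = y * u) ∧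
      ∀ ε : ℝ, 0 < ε → ∃ z ∈ convexHull ℝ ((fun u : unitary A => (u : A) * x * star (u : A)) '' G),
        ‖of h.core z - of h.core y‖ < ε := by
  set X : Set A := (fun u : unitary A => (u : A) * x * star (u : A)) '' G
  set O : Set (Hilb h.core) := of h.core '' X
  have hXne : X.Nonempty := ⟨_, 1, G.one_mem, rfl⟩
  let T : unitary A → (Hilb h.core →L[ℂ] Hilb h.core) := fun u =>
    h.left u * h.right (MulOpposite.op (star (u : A)))
  have hT : ∀ u v, T u (of h.core v) = of h.core (u * v * star (u : A)) := fun u v => by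
    change h.left u (h.right _ _) = _
    rw [right_of, left_of, mul_assoc]
  have hTn : ∀ u v, ‖T u v‖ = ‖v‖ := fun u v => by
    have h1 : star (T u) * T u = 1 := by
      refine ext_op _ fun w => (denseRange_of h.core).eq_of_inner_right ℂ fun z => ?_
      change inner ℂ _ (star (T u) (T u _)) = _
      rw [ContinuousLinearMap.star_eq_adjoint, ContinuousLinearMap.adjoint_inner_right, hT, hT,
        one_apply_eq_self, inner_L2, inner_L2]
      simp only [star_mul, star_star, mul_assoc]
      rw [← mul_assoc (star (u : A)) u, Unitary.coe_star_mul_self, one_mul, h.mul_comm]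
      simp only [mul_assoc]
      rw [Unitary.coe_star_mul_self, mul_one]
    have h2 : ‖T u v‖ ^ 2 = ‖v‖ ^ 2 := by
      rw [← inner_self_eq_norm_sq (𝕜 := ℂ), ← ContinuousLinearMap.adjoint_inner_right,
        ← ContinuousLinearMap.star_eq_adjoint, ← ContinuousLinearMap.comp_apply,
        ← ContinuousLinearMap.mul_def, h1, one_apply_eq_self, inner_self_eq_norm_sq]
    exact (sq_eq_sq₀ (norm_nonneg _) (norm_nonneg _)).1 h2
  obtain ⟨ζ, hζ, hfix⟩ := exists_fixed_point_closure_convexHull (O := O) (hXne.image _)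
    (T '' G) (by rintro _ ⟨u, -, rfl⟩; exact hTn u) (by
      rintro _ ⟨u, hu, rfl⟩ _ ⟨_, ⟨w, hw, rfl⟩, rfl⟩
      refine ⟨_, ⟨u * w, G.mul_mem hu hw, rfl⟩, ?_⟩
      rw [hT]
      simp only [Submonoid.coe_mul, star_mul, mul_assoc])
  have hO : convexHull ℝ O = of h.core '' convexHull ℝ X :=
    (((of h.core).restrictScalars ℝ).image_convexHull X).symm
  have hXball : convexHull ℝ X ⊆ Metric.closedBall 0 ‖x‖ := by
    refine convexHull_min ?_ (convex_closedBall 0 ‖x‖)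
    rintro _ ⟨u, -, rfl⟩
    rw [mem_closedBall_zero_iff]
    have h1 : ‖(u : A) * x * star (u : A)‖ = ‖x‖ := by
      rw [← Unitary.coe_star, CStarRing.norm_mul_coe_unitary, CStarRing.norm_coe_unitary_mul]
    exact h1.le
  -- Completeness enters here: the hull lies in a ball of the algebra, which is closed in `L²`, so
  -- the fixed vector is an element of the algebra.
  have hζ2 : ζ ∈ of h.core '' Metric.closedBall 0 ‖x‖ := by
    rw [← (h.isClosed_ball ‖x‖).closure_eq]
    refine closure_mono ?_ hζ
    rw [hO]
    exact Set.image_mono hXball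
  obtain ⟨y, hy, rfl⟩ := hζ2
  refine ⟨y, by simpa using hy, fun u hu => ?_, fun ε hε => ?_⟩
  · have h1 := h.of_injective (((hT u y).symm.trans (hfix _ ⟨u, hu, rfl⟩)))
    calc (u : A) * y = u * y * (star (u : A) * u) := by rw [Unitary.coe_star_mul_self, mul_one]
      _ = u * y * star (u : A) * u := by simp only [mul_assoc]
      _ = y * u := by rw [h1]
  · rw [hO] at hζ
    obtain ⟨_, ⟨z, hz, rfl⟩, hlt⟩ := Metric.mem_closure_iff.1 hζ ε hε
    exact ⟨z, hz, by rwa [dist_comm, dist_eq_norm] at hlt⟩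

end IsCompleteTrace

namespace PreHilbert

variable {V : Type*} [AddCommGroup V] [Module ℂ V] (c : PreInnerProductSpace.Core ℂ V)

/-- A bounded functional on a pre-Hilbert space is represented by a vector of the completion. -/
lemma exists_riesz (ψ : V →ₗ[ℂ] ℂ) {C : ℝ} (hψ : ∀ v, ‖ψ v‖ ≤ C * ‖of c v‖) :
    ∃ ζ : Hilb c, ∀ v, ψ v = inner ℂ ζ (of c v) := by
  have h2 : ∀ w : V, ‖of c w‖ = ‖(show PreHilbert c from w)‖ := fun w =>
    UniformSpace.Completion.norm_coe (E := PreHilbert c) w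
  let f : PreHilbert c →L[ℂ] ℂ := LinearMap.mkContinuous (E := PreHilbert c) (𝕜 := ℂ) (𝕜₂ := ℂ)
    (σ := RingHom.id ℂ) { toFun := ψ, map_add' := ψ.map_add, map_smul' := ψ.map_smul } C
    (fun v => by
      have h1 := hψ v
      have e2 := h2 v
      rw [e2] at h1
      exact h1)
  let e : PreHilbert c →L[ℂ] Hilb c := UniformSpace.Completion.toComplL
  let F : Hilb c →L[ℂ] ℂ := f.extend e
  have hF : ∀ v, F (of c v) = ψ v := fun v =>
    ContinuousLinearMap.extend_eq f (UniformSpace.Completion.denseRange_coe (α := PreHilbert c))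
      (UniformSpace.Completion.isUniformInducing_coe (PreHilbert c)) v
  refine ⟨(InnerProductSpace.toDual ℂ (Hilb c)).symm F, fun v => ?_⟩
  rw [InnerProductSpace.toDual_symm_apply, hF]

end PreHilbert

namespace IsCompleteTrace

open PreHilbert

variable {A : Type*} [CStarAlgebra A] {τ : A →ₗ[ℂ] ℂ} (h : IsCompleteTrace τ)
include h

lemma norm_L2_le (x : A) : ‖of h.core x‖ ≤ ‖x‖ := by
  have h1 := h.leftAction.boundedBy x 1
  have h2 : ‖of h.core (1 : A)‖ = 1 := by
    have := h.norm_sq_L2 1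
    rw [star_one, one_mul, h.map_one, Complex.one_re] at this
    exact (pow_eq_one_iff_of_nonneg (norm_nonneg _) two_ne_zero).1 this
  rw [h2, mul_one] at h1
  simpa using h1

lemma norm_trace_le (x : A) : ‖τ x‖ ≤ ‖x‖ := by
  have h1 := h.inner_L2 1 x
  rw [star_one, one_mul] at h1
  rw [← h1]
  refine (norm_inner_le_norm _ _).trans ?_
  have h2 : ‖of h.core (1 : A)‖ = 1 := by
    have := h.norm_sq_L2 1
    rw [star_one, one_mul, h.map_one, Complex.one_re] at this
    exact (pow_eq_one_iff_of_nonneg (norm_nonneg _) two_ne_zero).1 this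
  rw [h2, one_mul]
  exact h.norm_L2_le x

/-- `d` is `C` times the regularised phase `b w^(-1/2)`, where `w = ε + b⋆b`; the polar
decomposition proper need not exist in `A`. Factoring `b = (b w^(-1/4)) w^(1/4)`, the hypothesis
bounds `Re ψ(b)` by `C τ(w^(1/2))`, and this exceeds `Re τ(d⋆b)` by at most `C√ε`. In the proof, `t
= w^(1/4)` and `r = t⁻¹`. -/
lemma exists_near_polar {ψ : A →ₗ[ℂ] ℂ} {C : ℝ} (hC : 0 ≤ C)
    (hψ : ∀ x y, ‖ψ (x * star y)‖ ≤ C * ‖of h.core x‖ * ‖of h.core y‖) (b : A) {ε : ℝ}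
    (hε : 0 < ε) :
    ∃ d : A, ‖d‖ ≤ C ∧ (ψ b).re ≤ (τ (star d * b)).re + C * √ε := by
  let _ := CStarAlgebra.spectralOrder A
  have _ := CStarAlgebra.spectralOrderedRing A
  rcases subsingleton_or_nontrivial A with hsub | hnt
  · refine ⟨0, by simpa, ?_⟩
    rw [Subsingleton.elim b 0]
    simp; positivity
  set w : A := algebraMap ℝ A ε + star b * b with hw
  have hεA : IsStrictlyPositive (algebraMap ℝ A ε) :=
    ⟨algebraMap_nonneg A hε.le, (IsUnit.mk0 ε hε.ne').map _⟩
  have hwle : algebraMap ℝ A ε ≤ w := le_add_of_nonneg_right (star_mul_self_nonneg b)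
  have hw0 : 0 ≤ w := hεA.nonneg.trans hwle
  have hwu : IsUnit w := CStarAlgebra.isUnit_of_le _ hwle
  obtain ⟨t, htsa, ht4⟩ : ∃ t : A, star t = t ∧ t ^ 4 = w := by
    refine ⟨CFC.sqrt (CFC.sqrt w), (IsSelfAdjoint.of_nonneg (CFC.sqrt_nonneg _)).star_eq, ?_⟩
    rw [show (4 : ℕ) = 2 * 2 by norm_num, pow_mul, sq (CFC.sqrt (CFC.sqrt w)),
      CFC.sqrt_mul_sqrt_self _ (CFC.sqrt_nonneg _), sq, CFC.sqrt_mul_sqrt_self _ hw0]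
  obtain ⟨u, rfl⟩ : IsUnit t := (isUnit_pow_iff (n := 4) (by norm_num)).1 (ht4 ▸ hwu)
  set t : A := ↑u
  set r : A := ↑u⁻¹ with hr
  have htr : t * r = 1 := u.mul_inv
  have hrt : r * t = 1 := u.inv_mul
  have hrsa : star r = r := by
    have h1 : star r * t = 1 := by
      rw [← htsa, ← star_mul, htr, star_one]
    calc star r = star r * (t * r) := by rw [htr, mul_one]
      _ = r := by rw [← mul_assoc, h1, one_mul]
  have hbb : star b * b = t * t * t * t - algebraMap ℝ A ε := by
    rw [show t * t * t * t = t ^ 4 by noncomm_ring, ht4, hw]; abel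
  have hcomm : ∀ z : A, algebraMap ℝ A ε * z = z * algebraMap ℝ A ε := Algebra.commutes ε
  have hsm : ∀ z : A, algebraMap ℝ A ε * z = (ε : ℂ) • z := fun z => by
    rw [Algebra.algebraMap_eq_smul_one, smul_mul_assoc, one_mul, Complex.coe_smul]
  have e1 : star (b * r) * (b * r) = t * t - (ε : ℂ) • (r * r) := by
    calc star (b * r) * (b * r) = r * (star b * b) * r := by
          rw [star_mul, hrsa]; noncomm_ring
      _ = (r * t) * t * t * (t * r) - r * (algebraMap ℝ A ε * r) := by rw [hbb]; noncomm_ring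
      _ = t * t - r * (algebraMap ℝ A ε * r) := by rw [hrt, htr]; noncomm_ring
      _ = _ := by rw [hsm, mul_smul_comm]
  have e2 : star (b * r * r) * b = r * (r * (star b * b)) := by
    rw [star_mul, star_mul, hrsa]; noncomm_ring
  have e3 : r * (r * (star b * b)) = t * t - (ε : ℂ) • (r * r) := by
    calc r * (r * (star b * b)) = r * (r * t) * t * t * t - r * (r * algebraMap ℝ A ε) := by
          rw [hbb]; noncomm_ring
      _ = t * t - r * (algebraMap ℝ A ε * r) := by
          rw [hrt, mul_one, hrt, one_mul, ← hcomm r]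
      _ = _ := by rw [hsm, mul_smul_comm]
  have e4 : star (b * r * r) * (b * r * r) = 1 - (ε : ℂ) • ((r * r) * (r * r)) := by
    calc star (b * r * r) * (b * r * r) = (star (b * r * r) * b) * (r * r) := by noncomm_ring
      _ = (t * t - (ε : ℂ) • (r * r)) * (r * r) := by rw [e2, e3]
      _ = t * (t * r) * r - (ε : ℂ) • ((r * r) * (r * r)) := by
          rw [sub_mul, smul_mul_assoc]; noncomm_ring
      _ = _ := by rw [htr, mul_one, htr]
  have hrr : star (r * r) * (r * r) = (r * r) * (r * r) := by rw [star_mul, hrsa]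
  have hrr0 : 0 ≤ r * r := by
    have := star_mul_self_nonneg r
    rwa [hrsa] at this
  have hsmul : ∀ z : A, (ε : ℂ) • z = ε • z := fun z => Complex.coe_smul ε z
  have n1 : ‖b * r * r‖ ≤ 1 := by
    have h1 : star (b * r * r) * (b * r * r) ≤ 1 := by
      rw [e4, hsmul]
      refine sub_le_self _ (smul_nonneg hε.le ?_)
      rw [← hrr]
      exact star_mul_self_nonneg _
    have h2 := CStarAlgebra.norm_le_norm_of_nonneg_of_le (star_mul_self_nonneg _) h1
    rw [CStarRing.norm_star_mul_self, CStarRing.norm_one] at h2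
    nlinarith [norm_nonneg (b * r * r)]
  -- By `e4`, `1 - ε r⁴` is of the form `y⋆y`, so `ε‖r²‖² ≤ 1`.
  have n2 : ε * ‖r * r‖ ≤ √ε := by
    have h1 : ε • ((r * r) * (r * r)) ≤ 1 := by
      rw [← hsmul, ← sub_nonneg, ← e4]
      exact star_mul_self_nonneg _
    have h0 : 0 ≤ ε • ((r * r) * (r * r)) := smul_nonneg hε.le (by
      rw [← hrr]
      exact star_mul_self_nonneg _)
    have h2 := CStarAlgebra.norm_le_norm_of_nonneg_of_le h0 h1
    rw [norm_smul, ← hrr, CStarRing.norm_star_mul_self, CStarRing.norm_one, Real.norm_eq_abs,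
      abs_of_pos hε] at h2
    refine Real.le_sqrt_of_sq_le ?_
    nlinarith
  have hττ : (τ (t * t - (ε : ℂ) • (r * r))).re = (τ (t * t)).re - ε * (τ (r * r)).re := by
    rw [map_sub, map_smul, Complex.sub_re, smul_eq_mul, Complex.re_ofReal_mul]
  have hr0 : 0 ≤ (τ (r * r)).re := by
    have := (Complex.nonneg_iff.1 (h.nonneg r)).1
    rwa [hrsa] at this
  have hr1 : (τ (r * r)).re ≤ ‖r * r‖ := (Complex.re_le_norm _).trans (h.norm_trace_le _)
  have hx := h.norm_sq_L2 (b * r)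
  have hy := h.norm_sq_L2 t
  rw [e1, hττ] at hx
  rw [htsa] at hy
  refine ⟨(C : ℂ) • (b * r * r), ?_, ?_⟩
  · rw [norm_smul, Complex.norm_real, Real.norm_eq_abs, abs_of_nonneg hC]
    nlinarith
  · have h1 := hψ (b * r) t
    rw [htsa, mul_assoc, hrt, mul_one] at h1
    have h2 : ‖of h.core (b * r)‖ ≤ ‖of h.core t‖ := by
      refine le_of_sq_le_sq (a := _) ?_ (norm_nonneg _)
      rw [hx, hy]
      nlinarith
    have h3 : (ψ b).re ≤ C * (τ (t * t)).re := by
      refine (Complex.re_le_norm _).trans (h1.trans ?_)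
      rw [← hy, sq, mul_assoc]
      gcongr
    have h4 : (τ (star ((C : ℂ) • (b * r * r)) * b)).re =
        C * ((τ (t * t)).re - ε * (τ (r * r)).re) := by
      rw [star_smul, smul_mul_assoc, map_smul, e2, e3, Complex.star_def, Complex.conj_ofReal,
        smul_eq_mul, Complex.re_ofReal_mul, hττ]
    rw [h4]
    have h5 : ε * (τ (r * r)).re ≤ √ε := (by gcongr : _ ≤ ε * ‖r * r‖).trans n2
    nlinarith

/-- A Radon-Nikodym theorem: a functional dominated by the trace is `τ(h ·)`. -/
theorem exists_density (ψ : A →ₗ[ℂ] ℂ) {C : ℝ} (hC : 0 ≤ C)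
    (hψ : ∀ x y, ‖ψ (x * star y)‖ ≤ C * ‖of h.core x‖ * ‖of h.core y‖) :
    ∃ k : A, ∀ b, ψ b = τ (k * b) := by
  obtain ⟨ζ, hζ⟩ := exists_riesz h.core ψ (C := C * ‖of h.core (1 : A)‖) fun v => by
    have := hψ v 1
    rw [star_one, mul_one] at this
    linarith
  -- The functional is `⟨ζ, ·⟩`, and `ζ` must be shown to lie in the ball of radius `C`. Let `k` be
  -- the nearest point, `e = ζ - k` and `d` an approximate phase of `e`, times `C`. Then `‖e‖² =
  -- Re⟨e, ζ - d⟩ + Re⟨e, d - k⟩`; the first term is almost nonpositive by `exists_near_polar`, the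
  -- second is nonpositive by the choice of `k`.
  obtain ⟨p, ⟨k, hk, rfl⟩, hp⟩ := exists_nearest_point
    (D := of h.core '' Metric.closedBall 0 C) ⟨_, 0, by simpa using hC, rfl⟩ (h.isClosed_ball C)
    ((convex_closedBall (0 : A) C).linear_image ((of h.core).restrictScalars ℝ)) ζ
  set e := ζ - of h.core k with he
  have key : ∀ δ : ℝ, 0 < δ → ‖e‖ ^ 2 ≤ C * δ + (‖ζ‖ + C) * δ := by
    intro δ hδ
    obtain ⟨b, hb⟩ : ∃ b, ‖e - of h.core b‖ < δ := by
      obtain ⟨b, hb⟩ := (denseRange_of h.core).exists_dist_lt e hδ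
      exact ⟨b, by rwa [dist_eq_norm] at hb⟩
    obtain ⟨d, hd, hdb⟩ := h.exists_near_polar hC hψ b (ε := δ ^ 2) (by positivity)
    rw [Real.sqrt_sq hδ.le, hζ, ← h.inner_L2] at hdb
    have h1 := hp _ ⟨d, by simpa using hd, rfl⟩
    have h2 : ‖e‖ ^ 2 = (inner ℂ e (ζ - of h.core k)).re :=
      (inner_self_eq_norm_sq (𝕜 := ℂ) e).symm
    have h3 : (inner ℂ e (ζ - of h.core d)).re = (inner ℂ (ζ - of h.core d) e).re := by
      rw [← inner_conj_symm]; exact Complex.conj_re _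
    have h4 : (inner ℂ (ζ - of h.core d) e).re = (inner ℂ (ζ - of h.core d) (of h.core b)).re +
        (inner ℂ (ζ - of h.core d) (e - of h.core b)).re := by
      rw [← Complex.add_re, ← inner_add_right, add_sub_cancel]
    have h5 : (inner ℂ (ζ - of h.core d) (of h.core b)).re ≤ C * δ := by
      rw [inner_sub_left, Complex.sub_re]; linarith
    have h6 : (inner ℂ (ζ - of h.core d) (e - of h.core b)).re ≤ (‖ζ‖ + C) * δ := by
      refine (Complex.re_le_norm _).trans ((norm_inner_le_norm _ _).trans ?_)
      gcongr
      exact (norm_sub_le _ _).trans (by gcongr; exact (h.norm_L2_le d).trans hd)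
    have h7 : (inner ℂ e (ζ - of h.core k)).re = (inner ℂ e (ζ - of h.core d)).re +
        (inner ℂ e (of h.core d - of h.core k)).re := by
      rw [← Complex.add_re, ← inner_add_right, sub_add_sub_cancel]
    linarith
  have he0 : ‖e‖ ^ 2 ≤ 0 := by
    have hlim : Tendsto (fun δ : ℝ => C * δ + (‖ζ‖ + C) * δ) (𝓝[>] 0) (𝓝 0) := by
      have : Tendsto (fun δ : ℝ => C * δ + (‖ζ‖ + C) * δ) (𝓝 0) (𝓝 (C * 0 + (‖ζ‖ + C) * 0)) :=
        Continuous.tendsto (by fun_prop) 0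
      simp only [mul_zero, add_zero] at this
      exact this.mono_left nhdsWithin_le_nhds
    exact ge_of_tendsto hlim (by filter_upwards [self_mem_nhdsWithin] with δ hδ using key δ hδ)
  have he1 : e = 0 := norm_eq_zero.1 (by nlinarith [norm_nonneg e])
  refine ⟨star k, fun b => ?_⟩
  rw [hζ, sub_eq_zero.1 he1, h.inner_L2]

end IsCompleteTrace

/-! ### Positive matrices over the algebra -/

/-- `s` is the square root of the negative part of `g`. No order appears in the statement, so it
applies to matrices over `A` without fixing an order on them. -/
lemma exists_negPart_decomposition {B : Type*} [CStarAlgebra B] {g : B} (hg : IsSelfAdjoint g) :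
    ∃ s : B, star s = s ∧ g * (s * s) = -(s * s * (s * s)) ∧
      (s * s = 0 → ∃ C, g = star C * C) := by
  let _ := CStarAlgebra.spectralOrder B
  have _ := CStarAlgebra.spectralOrderedRing B
  have hN0 : 0 ≤ g⁻ := CFC.negPart_nonneg g
  have hss := CFC.sqrt_mul_sqrt_self g⁻ hN0
  refine ⟨CFC.sqrt g⁻, (IsSelfAdjoint.of_nonneg (CFC.sqrt_nonneg _)).star_eq, ?_, fun h0 => ?_⟩
  · rw [hss]
    calc g * g⁻ = (g⁺ - g⁻) * g⁻ := by rw [CFC.posPart_sub_negPart g hg]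
      _ = _ := by rw [sub_mul, CFC.posPart_mul_negPart, zero_sub]
  · rw [hss] at h0
    refine CStarAlgebra.nonneg_iff_eq_star_mul_self.1 ?_
    rw [← CFC.posPart_sub_negPart g hg, h0, sub_zero]
    exact CFC.posPart_nonneg g

namespace IsCompleteTrace

variable {A : Type*} [CStarAlgebra A] {τ : A →ₗ[ℂ] ℂ} (h : IsCompleteTrace τ)
include h

/-- A matrix over `A` that is positive on `L²(A, τ)ⁿ` is of the form `C⋆C`. -/
theorem exists_matrix_factorization {ι : Type*} [Fintype ι] (G : ι → ι → A)
    (hG : ∀ p q, star (G p q) = G q p)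
    (hpos : ∀ b : ι → A, 0 ≤ (∑ p, ∑ q, τ (star (b p) * G p q * b q)).re) :
    ∃ C : ι → ι → A, ∀ p q, G p q = ∑ r, star (C r p) * C r q := by
  classical
  let _ := CStarAlgebra.spectralOrder A
  have _ := CStarAlgebra.spectralOrderedRing A
  let g : CStarMatrix ι ι A := CStarMatrix.ofMatrix (Matrix.of G)
  have hgsa : IsSelfAdjoint g := by
    ext p q
    exact hG q p
  obtain ⟨s, hs, hgN, hfac⟩ := exists_negPart_decomposition hgsa
  obtain ⟨N, hss⟩ : ∃ N, s * s = N := ⟨_, rfl⟩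
  rw [hss] at hgN hfac
  have hNsa : star N = N := by rw [← hss, star_mul, hs]
  -- Here `N` is the negative part of `g`. Positivity is tested on the columns of `N`: since `N⋆gN =
  -- -N³ = -W⋆W`, the diagonal entries of `W⋆W` have trace zero. Faithfulness gives `W = 0`, and
  -- then `N = 0`.
  set W := s * N with hW
  have e1 : star N * g * N = -(star W * W) := by
    rw [mul_assoc, hgN, hW, star_mul, hs, hNsa, mul_neg]
    congr 1
    conv_lhs => rw [← hss]
    conv_rhs => rw [← hss]
    simp only [mul_assoc]
  have hentry : ∀ (X Y : CStarMatrix ι ι A) i j, (X * Y) i j = ∑ k, X i k * Y k j :=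
    fun X Y i j => CStarMatrix.mul_apply
  have hstar : ∀ (X : CStarMatrix ι ι A) i j, star X i j = star (X j i) :=
    fun X i j => CStarMatrix.star_apply
  have hW0 : W = 0 := by
    ext k j
    have h1 := hpos (fun p => N p j)
    have h2 : ∑ p, ∑ q, τ (star (N p j) * G p q * N q j) = τ ((star N * g * N) j j) := by
      rw [hentry, map_sum, Finset.sum_comm]
      refine Finset.sum_congr rfl fun q _ => ?_
      rw [hentry, Finset.sum_mul, map_sum]
      refine Finset.sum_congr rfl fun p _ => ?_
      rw [hstar]
      rfl
    have h3 : (star W * W) j j = ∑ k, star (W k j) * W k j := by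
      rw [hentry]
      exact Finset.sum_congr rfl fun k _ => by rw [hstar]
    have h4 : (star N * g * N) j j = -∑ k, star (W k j) * W k j := by
      rw [← h3, e1]
      rfl
    rw [h2, h4, map_neg, Complex.neg_re, map_sum, Complex.re_sum] at h1
    have h5 : ∀ k ∈ Finset.univ, 0 ≤ (τ (star (W k j) * W k j)).re := fun k _ =>
      (Complex.nonneg_iff.1 (h.nonneg _)).1
    have h6 := (Finset.sum_eq_zero_iff_of_nonneg h5).1
      (le_antisymm (by linarith) (Finset.sum_nonneg h5)) k (Finset.mem_univ k)
    exact h.faithful _ (Complex.ext h6 (Complex.nonneg_iff.1 (h.nonneg _)).2.symm)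
  have hN3 : N * N = 0 := by
    rw [← hss, mul_assoc, ← mul_assoc s s s, hss, ← mul_assoc]
    have : N * s = 0 := by
      have h1 := congrArg star hW0
      rwa [hW, star_mul, hs, hNsa, star_zero] at h1
    rw [mul_assoc, this, mul_zero]
  have hNz : N = 0 := by
    rw [← CStarRing.star_mul_self_eq_zero_iff, hNsa, hN3]
  obtain ⟨C, hC⟩ := hfac hNz
  refine ⟨fun r p => C r p, fun p q => ?_⟩
  have h1 : g p q = (star C * C) p q := by rw [hC]
  rw [hentry] at h1
  refine h1.trans (Finset.sum_congr rfl fun r _ => by rw [hstar])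

end IsCompleteTrace

/-! ### The Fock form of a family of completely positive maps -/

/-- A family of trace preserving completely positive maps on `A`, stable under adjoints with respect
to the trace. -/
structure SymmetricCPFamily {A : Type u} [CStarAlgebra A] (τ : A →ₗ[ℂ] ℂ) (I : Type) where
  bar : I → I
  bar_bar : ∀ i, bar (bar i) = i
  φ : I → A →ₗ[ℂ] A
  φ_one : ∀ i, φ i 1 = 1
  φ_star : ∀ i a, φ i (star a) = star (φ i a)
  symm : ∀ i a b, τ (φ i a * b) = τ (a * φ (bar i) b)
  cp : ∀ i {ι : Type u} [Fintype ι] (a b : ι → A),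
    0 ≤ (∑ p, ∑ q, τ (star (b p) * φ i (star (a p) * a q) * b q)).re

namespace SymmetricCPFamily

open PreHilbert

variable {A : Type u} [CStarAlgebra A] {τ : A →ₗ[ℂ] ℂ} {I : Type} [DecidableEq I]
variable (D : SymmetricCPFamily τ I)

lemma trace_φ (i : I) (a : A) : τ (D.φ i a) = τ a := by
  have := D.symm i a 1
  rwa [D.φ_one, mul_one, mul_one] at this

/-- The `A`-valued inner product of the words `a₀ i₁ a₁ i₂ ⋯ iₖ aₖ`, with `c` inserted. -/
noncomputable def form : List (A × I) → A → List (A × I) → A → A → A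
  | [], x, [], y, c => star x * c * y
  | (a, i) :: w, x, (b, j) :: w', y, c =>
      if i = j then form w x w' y (D.φ i (star a * c * b)) else 0
  | [], _, _ :: _, _, _ => 0
  | _ :: _, _, [], _, _ => 0

@[simp] lemma form_nil_nil (x y c : A) : D.form [] x [] y c = star x * c * y := by
  simp [form]

@[simp] lemma form_cons_cons (a b x y c : A) (i j : I) (w w' : List (A × I)) :
    D.form ((a, i) :: w) x ((b, j) :: w') y c =
      if i = j then D.form w x w' y (D.φ i (star a * c * b)) else 0 := by
  simp [form]

@[simp] lemma form_nil_cons (x y c : A) (p : A × I) (w : List (A × I)) :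
    D.form [] x (p :: w) y c = 0 := by simp [form]

@[simp] lemma form_cons_nil (x y c : A) (p : A × I) (w : List (A × I)) :
    D.form (p :: w) x [] y c = 0 := by simp [form]

lemma form_induction {P : List (A × I) → List (A × I) → Prop} (nn : P [] [])
    (nc : ∀ q w', P [] (q :: w')) (cn : ∀ p w, P (p :: w) [])
    (cc : ∀ a i b j w w', P w w' → P ((a, i) :: w) ((b, j) :: w')) : ∀ w w', P w w'
  | [], [] => nn
  | [], _ :: _ => nc _ _
  | _ :: _, [] => cn _ _
  | (_, _) :: w, (_, _) :: w' => cc _ _ _ _ _ _ (form_induction nn nc cn cc w w')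

lemma form_add (w w' : List (A × I)) (x y : A) :
    ∀ c d, D.form w x w' y (c + d) = D.form w x w' y c + D.form w x w' y d := by
  refine form_induction (P := fun w w' => ∀ c d, D.form w x w' y (c + d) =
    D.form w x w' y c + D.form w x w' y d) ?_ ?_ ?_ ?_ w w'
  · intro c d; simp [mul_add, add_mul]
  · simp
  · simp
  · intro a i b j w w' ih c d
    simp only [form_cons_cons, mul_add, add_mul, map_add]
    split_ifs
    · exact ih _ _
    · simp

lemma form_smul (w w' : List (A × I)) (x y : A) :
    ∀ (r : ℂ) c, D.form w x w' y (r • c) = r • D.form w x w' y c := by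
  refine form_induction (P := fun w w' => ∀ (r : ℂ) c, D.form w x w' y (r • c) =
    r • D.form w x w' y c) ?_ ?_ ?_ ?_ w w'
  · intro c d; simp
  · simp
  · simp
  · intro a i b j w w' ih c d
    simp only [form_cons_cons, mul_smul_comm, smul_mul_assoc, map_smul]
    split_ifs
    · exact ih _ _
    · simp

lemma form_zero (w w' : List (A × I)) (x y : A) : D.form w x w' y 0 = 0 := by
  simpa using D.form_smul w w' x y 0 0

lemma star_form (w w' : List (A × I)) (x y : A) :
    ∀ c, star (D.form w x w' y c) = D.form w' y w x (star c) := by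
  refine form_induction (P := fun w w' => ∀ c, star (D.form w x w' y c) =
    D.form w' y w x (star c)) ?_ ?_ ?_ ?_ w w'
  · intro c; simp [mul_assoc]
  · simp
  · simp
  · intro a i b j w w' ih c
    simp only [form_cons_cons]
    split_ifs with h1 h2 h2
    · subst h1
      rw [ih, ← D.φ_star]
      simp [mul_assoc]
    · exact absurd h1.symm h2
    · exact absurd h2.symm h1
    · simp

lemma form_mul_right (w w' : List (A × I)) (x y z : A) :
    ∀ c, D.form w x w' (y * z) c = D.form w x w' y c * z := by
  refine form_induction (P := fun w w' => ∀ c, D.form w x w' (y * z) c =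
    D.form w x w' y c * z) ?_ ?_ ?_ ?_ w w'
  · intro c; simp [mul_assoc]
  · simp
  · simp
  · intro a i b j w w' ih c
    simp only [form_cons_cons]
    split_ifs
    · exact ih _
    · simp

lemma form_mul_left (w w' : List (A × I)) (x y z c : A) :
    D.form w (x * z) w' y c = star z * D.form w x w' y c := by
  rw [← star_star (D.form w (x * z) w' y c), star_form, form_mul_right, star_mul, star_form,
    star_star]

lemma form_snoc_nil (w : List (A × I)) (p : A × I) (x y c : A) :
    D.form (w ++ [p]) x [] y c = 0 := by
  cases w <;> simp

lemma form_nil_snoc (w : List (A × I)) (p : A × I) (x y c : A) :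
    D.form [] x (w ++ [p]) y c = 0 := by
  cases w <;> simp

/-- `form` consumes letters from the left. This is the recursion from the right, needed for right
creation and annihilation. -/
lemma form_snoc_snoc (a b x y : A) (i j : I) (w w' : List (A × I)) :
    ∀ c, D.form (w ++ [(a, i)]) x (w' ++ [(b, j)]) y c =
      if i = j then star x * D.φ i (D.form w a w' b c) * y else 0 := by
  refine form_induction (P := fun w w' => ∀ c, D.form (w ++ [(a, i)]) x (w' ++ [(b, j)]) y c =
      if i = j then star x * D.φ i (D.form w a w' b c) * y else 0) ?_ ?_ ?_ ?_ w w'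
  · intro c; simp
  · rintro ⟨b', j'⟩ w' c
    simp [form_nil_snoc]
  · rintro ⟨b', j'⟩ w c
    simp [form_snoc_nil]
  · intro a' i' b' j' w w' ih c
    simp only [List.cons_append, form_cons_cons]
    split_ifs with h1 h2 h2
    · rw [ih, if_pos h2]
    · rw [ih, if_neg h2]
    · simp
    · rfl

/-- Words `a₀ i₁ a₁ i₂ ⋯ iₖ aₖ` with `aⱼ ∈ A`, `iⱼ ∈ I`. -/
abbrev Word (A : Type u) (I : Type) : Type u := List (A × I) × A

/-- The scalar kernel on words. -/
noncomputable def kernel (p q : Word A I) : ℂ := τ (D.form p.1 p.2 q.1 q.2 1)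

section Positivity

variable (h : IsCompleteTrace τ)
include h

/-- Words without letters contribute the quadratic form of `G`. The others are grouped by their
first index and lose their first letter, which replaces `G` by `G'`. Factoring `G = C⋆C` over `A`
turns `a_p⋆ G_pq a_q` into a sum of terms `(C_rp a_p)⋆(C_rq a_q)`, so complete positivity makes `G'`
positive, and induction on the length applies. -/
lemma form_positive {ι : Type u} [Fintype ι] (x : ι → A) (n : ℕ) :
    ∀ (w : ι → List (A × I)), (∀ p, (w p).length ≤ n) → ∀ G : ι → ι → A,
      (∀ p q, star (G p q) = G q p) →
      (∀ b : ι → A, 0 ≤ (∑ p, ∑ q, τ (star (b p) * G p q * b q)).re) →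
      0 ≤ (∑ p, ∑ q, τ (D.form (w p) (x p) (w q) (x q) (G p q))).re := by
  classical
  induction n with
  | zero =>
    intro w hw G hG hpos
    have hw0 : ∀ p, w p = [] := fun p => List.length_eq_zero_iff.1 (Nat.le_zero.1 (hw p))
    simpa only [hw0, form_nil_nil] using hpos x
  | succ n ih =>
    intro w hw G hG hpos
    -- The index `none` marks words without letters. As `ψ none = 0`, they drop out of `G'`, and the
    -- default letter `0` in `a` is immaterial.
    let ψ : Option I → A →ₗ[ℂ] A := fun o => o.elim 0 D.φ
    have hψcp : ∀ o (a b : ι → A),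
        0 ≤ (∑ p, ∑ q, τ (star (b p) * ψ o (star (a p) * a q) * b q)).re := by
      rintro (_ | i) a b
      · simp [ψ]
      · exact D.cp i a b
    have hψstar : ∀ o a, star (ψ o a) = ψ o (star a) := by
      rintro (_ | i) a
      · simp [ψ]
      · exact (D.φ_star i a).symm
    let hd : ι → Option I := fun p => (w p).head?.map Prod.snd
    let a : ι → A := fun p => ((w p).head?.map Prod.fst).getD 0
    let G' : ι → ι → A := fun p q =>
      if hd p = hd q then ψ (hd p) (star (a p) * G p q * a q) else 0
    have hsplit : ∀ p q, D.form (w p) (x p) (w q) (x q) (G p q) =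
        star (if w p = [] then x p else 0) * G p q * (if w q = [] then x q else 0) +
        D.form (w p).tail (x p) (w q).tail (x q) (G' p q) := by
      intro p q
      rcases hp : w p with _ | ⟨⟨a₁, i₁⟩, w₁⟩ <;> rcases hq : w q with _ | ⟨⟨a₂, i₂⟩, w₂⟩
      · have : G' p q = 0 := by simp [G', hd, hp, hq, ψ]
        simp [this]
      · have : G' p q = 0 := by simp [G', hd, hp, hq]
        simp [this, form_zero]
      · have : G' p q = 0 := by simp [G', hd, hp, hq]
        simp [this, form_zero]
      · have : G' p q = if i₁ = i₂ then D.φ i₁ (star a₁ * G p q * a₂) else 0 := by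
          simp [G', hd, hp, hq, ψ, a]
        rw [this]
        by_cases hi : i₁ = i₂
        · simp [hi]
        · simp [hi, form_zero]
    obtain ⟨C, hC⟩ := h.exists_matrix_factorization G hG hpos
    have h1 := hpos (fun p => if w p = [] then x p else 0)
    have h2 := ih (fun p => (w p).tail) (fun p => by
      have := hw p
      rw [List.length_tail]
      omega) G' (fun p q => by
        simp only [G']
        by_cases hpq : hd p = hd q
        · rw [if_pos hpq, if_pos hpq.symm, hψstar, star_mul, star_mul, star_star, hG, hpq, mul_assoc]
        · rw [if_neg hpq, if_neg (fun h => hpq h.symm), star_zero]) (fun b => by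
        -- `G'` is block diagonal with respect to the first index; the indicators isolate the block
        -- of `o`, on which a single completely positive map acts.
        have e : ∑ p, ∑ q, τ (star (b p) * G' p q * b q) =
            ∑ o ∈ Finset.univ.image hd, ∑ r, ∑ p, ∑ q,
              τ (star (if hd p = o then b p else 0) *
                ψ o (star (C r p * a p) * (C r q * a q)) * (if hd q = o then b q else 0)) := by
          have e1 : ∀ o r, ∑ p, ∑ q,
              τ (star (if hd p = o then b p else 0) *
                ψ o (star (C r p * a p) * (C r q * a q)) * (if hd q = o then b q else 0)) =
              ∑ p, ∑ q, τ (star (if hd p = o then b p else 0) *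
                ψ o (star (a p) * (star (C r p) * C r q) * a q) *
                  (if hd q = o then b q else 0)) := fun o r => by
            simp only [star_mul, mul_assoc]
          simp only [e1]
          have e2 : ∀ o, ∑ r, ∑ p, ∑ q, τ (star (if hd p = o then b p else 0) *
                ψ o (star (a p) * (star (C r p) * C r q) * a q) *
                  (if hd q = o then b q else 0)) =
              ∑ p, ∑ q, τ (star (if hd p = o then b p else 0) *
                ψ o (star (a p) * G p q * a q) * (if hd q = o then b q else 0)) := fun o => by
            rw [Finset.sum_comm]
            refine Finset.sum_congr rfl fun p _ => ?_
            rw [Finset.sum_comm]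
            refine Finset.sum_congr rfl fun q _ => ?_
            simp only [hC p q, Finset.mul_sum, Finset.sum_mul, map_sum]
          simp only [e2]
          symm
          rw [Finset.sum_comm]
          refine Finset.sum_congr rfl fun p _ => ?_
          rw [Finset.sum_comm]
          refine Finset.sum_congr rfl fun q _ => ?_
          rw [Finset.sum_eq_single (hd p)]
          · simp only [G', if_true]
            by_cases hpq : hd p = hd q
            · rw [if_pos hpq, if_pos hpq.symm]
            · rw [if_neg hpq, if_neg (fun h => hpq h.symm)]
              simp
          · intro o _ ho
            rw [if_neg (Ne.symm ho)]
            simp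
          · intro hmem
            exact absurd (Finset.mem_image_of_mem hd (Finset.mem_univ p)) hmem
        rw [e, Complex.re_sum]
        refine Finset.sum_nonneg fun o _ => ?_
        rw [Complex.re_sum]
        exact Finset.sum_nonneg fun r _ => hψcp o _ _)
    simp only [hsplit, map_add, Finset.sum_add_distrib, Complex.add_re]
    exact add_nonneg h1 h2

/-- The positive semidefinite form on the space of formal linear combinations of words. -/
@[reducible]
noncomputable def core : PreInnerProductSpace.Core ℂ (Word A I →₀ ℂ) where
  inner v w := v.sum fun p a => w.sum fun q b => star a * b * D.kernel p q
  conj_inner_symm v w := by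
    have hk : ∀ p q, star (D.kernel p q) = D.kernel q p := fun p q => by
      rw [kernel, ← h.map_star, star_form, star_one]; rfl
    change star (w.sum fun p a => v.sum fun q b => star a * b * D.kernel p q) = _
    simp only [Finsupp.sum]
    simp only [star_sum, star_mul', hk, star_star]
    rw [Finset.sum_comm]
    exact Finset.sum_congr rfl fun p _ => Finset.sum_congr rfl fun q _ => by ring
  re_inner_nonneg v := by
    change 0 ≤ (v.sum fun p a => v.sum fun q b => star a * b * D.kernel p q).re
    let ι := {p // p ∈ v.support}
    -- The coefficients of the linear combination are absorbed into `G`, a positive matrix of rank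
    -- one with scalar entries.
    have := D.form_positive h (ι := ι) (fun p => p.1.2)
      (Finset.univ.sup fun p : ι => p.1.1.length) (fun p => p.1.1)
      (fun p => Finset.le_sup (f := fun p : ι => p.1.1.length) (Finset.mem_univ p))
      (fun p q => star (v p.1 • (1 : A)) * (v q.1 • (1 : A)))
      (fun p q => by rw [star_mul, star_star]) (fun b => by
        have := h.nonneg (∑ q : ι, v q.1 • b q)
        rw [star_sum, Finset.sum_mul_sum, map_sum] at this
        simp only [map_sum] at this
        convert (Complex.nonneg_iff.1 this).1 using 5 with p _ q _
        simp)
    convert this using 2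
    simp only [Finsupp.sum]
    rw [← Finset.sum_coe_sort]
    refine Finset.sum_congr rfl fun p _ => ?_
    rw [← Finset.sum_coe_sort]
    refine Finset.sum_congr rfl fun q _ => ?_
    have e : star (v p.1 • (1 : A)) * (v q.1 • (1 : A)) = (star (v p.1) * v q.1) • (1 : A) := by
      simp [smul_smul, mul_comm]
    rw [e, form_smul, map_smul, smul_eq_mul]
    rfl
  add_left v v' w := by
    refine Finsupp.sum_add_index' (by simp) ?_
    intro p a b
    simp [add_mul]
  smul_left v w r := by
    change (r • v).sum _ = star r * v.sum _
    rw [Finsupp.sum_smul_index (by simp), Finsupp.mul_sum]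
    simp only [Finsupp.mul_sum, star_mul', mul_assoc]

end Positivity

end SymmetricCPFamily

/-! ### Left and right field operators on words -/

namespace SymmetricCPFamily

open PreHilbert

variable {A : Type u} [CStarAlgebra A] {τ : A →ₗ[ℂ] ℂ} {I : Type} [DecidableEq I]
variable (D : SymmetricCPFamily τ I)

/-- The basis vector of a word. -/
noncomputable def wd (p : Word A I) : Word A I →₀ ℂ := Finsupp.single p 1

/-- The linear map prescribed on words. -/
noncomputable def lin (f : Word A I → Word A I →₀ ℂ) : (Word A I →₀ ℂ) →ₗ[ℂ] (Word A I →₀ ℂ) :=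
  Finsupp.linearCombination ℂ f

@[simp] lemma lin_wd (f : Word A I → Word A I →₀ ℂ) (p : Word A I) : lin f (wd p) = f p := by
  simp [lin, wd]

lemma wd_induction {P : (Word A I →₀ ℂ) → Prop} (zero : P 0)
    (add : ∀ v w, P v → P w → P (v + w)) (smul : ∀ (r : ℂ) p, P (r • wd p)) (v : Word A I →₀ ℂ) :
    P v := by
  induction v using Finsupp.induction_linear with
  | zero => exact zero
  | add v w hv hw => exact add v w hv hw
  | single p r =>
    have := smul r p
    rwa [wd, Finsupp.smul_single, smul_eq_mul, mul_one] at this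

lemma hom_ext {W : Type*} [AddCommMonoid W] [Module ℂ W] {S T : (Word A I →₀ ℂ) →ₗ[ℂ] W}
    (hST : ∀ p, S (wd p) = T (wd p)) : S = T := by
  refine LinearMap.ext fun v => ?_
  refine wd_induction (P := fun v => S v = T v) (by simp) (fun v w hv hw => by simp [hv, hw])
    (fun r p => by simp [hST]) v

/-- Multiplication of the first letter of a word. -/
def headMul (x : A) : Word A I → Word A I
  | ([], y) => ([], x * y)
  | ((b, k) :: w, y) => ((x * b, k) :: w, y)

@[simp] lemma headMul_nil (x y : A) : headMul x (([], y) : Word A I) = ([], x * y) := rfl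
@[simp] lemma headMul_cons (x y b : A) (k : I) (w : List (A × I)) :
    headMul x (((b, k) :: w, y) : Word A I) = ((x * b, k) :: w, y) := rfl

/-- Left multiplication by `x`. -/
noncomputable def lop (x : A) : (Word A I →₀ ℂ) →ₗ[ℂ] (Word A I →₀ ℂ) :=
  lin fun p => wd (headMul x p)

/-- Right multiplication by `x`. -/
noncomputable def rop (x : A) : (Word A I →₀ ℂ) →ₗ[ℂ] (Word A I →₀ ℂ) :=
  lin fun p => wd (p.1, p.2 * x)

/-- Left creation. -/
noncomputable def cop (i : I) : (Word A I →₀ ℂ) →ₗ[ℂ] (Word A I →₀ ℂ) :=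
  lin fun p => wd ((1, i) :: p.1, p.2)

/-- Right creation. -/
noncomputable def rcop (i : I) : (Word A I →₀ ℂ) →ₗ[ℂ] (Word A I →₀ ℂ) :=
  lin fun p => wd (p.1 ++ [(p.2, i)], 1)

/-- Left annihilation. -/
noncomputable def aop (i : I) : (Word A I →₀ ℂ) →ₗ[ℂ] (Word A I →₀ ℂ) :=
  lin fun p => match p with
    | ([], _) => 0
    | ((a, j) :: w, x) => if i = j then wd (headMul (D.φ i a) (w, x)) else 0

/-- Right annihilation. -/
noncomputable def raop (i : I) : (Word A I →₀ ℂ) →ₗ[ℂ] (Word A I →₀ ℂ) :=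
  lin fun p => match p.1.getLast? with
    | none => 0
    | some (a, j) => if i = j then wd (p.1.dropLast, a * D.φ (D.bar i) p.2) else 0

@[simp] lemma lop_wd (x : A) (p : Word A I) : lop x (wd p) = wd (headMul x p) := lin_wd _ _
@[simp] lemma rop_wd (x y : A) (w : List (A × I)) : rop x (wd (w, y)) = wd (w, y * x) :=
  lin_wd _ _
@[simp] lemma cop_wd (i : I) (x : A) (w : List (A × I)) :
    cop i (wd (w, x)) = wd ((1, i) :: w, x) := lin_wd _ _
@[simp] lemma rcop_wd (i : I) (x : A) (w : List (A × I)) :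
    rcop i (wd (w, x)) = wd (w ++ [(x, i)], 1) := lin_wd _ _
@[simp] lemma aop_nil (i : I) (x : A) : D.aop i (wd ([], x)) = 0 := lin_wd _ _
@[simp] lemma aop_cons (i j : I) (a x : A) (w : List (A × I)) :
    D.aop i (wd ((a, j) :: w, x)) = if i = j then wd (headMul (D.φ i a) (w, x)) else 0 :=
  lin_wd _ _
@[simp] lemma raop_nil (i : I) (x : A) : D.raop i (wd ([], x)) = 0 := lin_wd _ _
@[simp] lemma raop_snoc (i j : I) (a x : A) (w : List (A × I)) :
    D.raop i (wd (w ++ [(a, j)], x)) =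
      if i = j then wd (w, a * D.φ (D.bar i) x) else 0 := by
  rw [raop, lin_wd]
  simp
@[simp] lemma raop_singleton (i j : I) (a x : A) :
    D.raop i (wd ([(a, j)], x)) = if i = j then wd ([], a * D.φ (D.bar i) x) else 0 :=
  D.raop_snoc i j a x []
@[simp] lemma raop_cons_snoc (i j : I) (a x : A) (p : A × I) (w : List (A × I)) :
    D.raop i (wd (p :: (w ++ [(a, j)]), x)) =
      if i = j then wd (p :: w, a * D.φ (D.bar i) x) else 0 :=
  D.raop_snoc i j a x (p :: w)

lemma word_cases {P : Word A I → Prop} (nil : ∀ x, P ([], x))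
    (snoc : ∀ w a i x, P (w ++ [(a, i)], x)) (p : Word A I) : P p := by
  obtain ⟨w, x⟩ := p
  rcases List.eq_nil_or_concat' w with rfl | ⟨w, ⟨a, i⟩, rfl⟩
  · exact nil x
  · exact snoc w a i x

lemma headMul_headMul (x y : A) (p : Word A I) : headMul x (headMul y p) = headMul (x * y) p := by
  obtain ⟨_ | ⟨⟨a, i⟩, w⟩, z⟩ := p <;> simp [mul_assoc]

lemma rop_headMul (x y : A) (p : Word A I) : rop y (wd (headMul x p)) = lop x (rop y (wd p)) := by
  obtain ⟨_ | ⟨⟨a, i⟩, w⟩, z⟩ := p <;> simp [mul_assoc]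

lemma rcop_headMul (x : A) (i : I) (p : Word A I) :
    rcop i (wd (headMul x p)) = lop x (rcop i (wd p)) := by
  obtain ⟨_ | ⟨⟨a, i⟩, w⟩, z⟩ := p <;> simp

/-- The two operators touch the first and the last letter. On a one-letter word these coincide, and
the letter is multiplied from the left by one and from the right by the other. -/
lemma raop_headMul (x : A) (i : I) (p : Word A I) :
    D.raop i (wd (headMul x p)) = lop x (D.raop i (wd p)) := by
  refine word_cases (P := fun p => D.raop i (wd (headMul x p)) = lop x (D.raop i (wd p)))
    (fun z => by simp) (fun w a j z => ?_) p
  rcases w with _ | ⟨⟨b, k⟩, w⟩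
  · simp only [List.nil_append, headMul_cons, raop_singleton]
    split_ifs <;> simp [mul_assoc]
  · simp only [List.cons_append, headMul_cons, raop_cons_snoc]
    split_ifs <;> simp

/-- The left field operator. -/
noncomputable def xop (i : I) : (Word A I →₀ ℂ) →ₗ[ℂ] (Word A I →₀ ℂ) :=
  cop i + D.aop (D.bar i)

/-- The right field operator. -/
noncomputable def yop (i : I) : (Word A I →₀ ℂ) →ₗ[ℂ] (Word A I →₀ ℂ) :=
  rcop i + D.raop (D.bar i)

lemma lop_rop (x y : A) (v : Word A I →₀ ℂ) : lop x (rop y v) = rop y (lop x v) := by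
  refine LinearMap.congr_fun (f := lop x ∘ₗ rop y) (g := rop y ∘ₗ lop x) (hom_ext fun p => ?_) v
  simp only [LinearMap.comp_apply, lop_wd, rop_headMul]

lemma lop_yop (x : A) (i : I) (v : Word A I →₀ ℂ) : lop x (D.yop i v) = D.yop i (lop x v) := by
  refine LinearMap.congr_fun (f := lop x ∘ₗ D.yop i) (g := D.yop i ∘ₗ lop x)
    (hom_ext fun p => ?_) v
  simp only [LinearMap.comp_apply, lop_wd, yop, LinearMap.add_apply, map_add, rcop_headMul,
    raop_headMul]

lemma xop_rop (i : I) (x : A) (v : Word A I →₀ ℂ) : D.xop i (rop x v) = rop x (D.xop i v) := by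
  refine LinearMap.congr_fun (f := D.xop i ∘ₗ rop x) (g := rop x ∘ₗ D.xop i)
    (hom_ext fun p => ?_) v
  obtain ⟨_ | ⟨⟨a, j⟩, w⟩, z⟩ := p
  · simp [xop]
  · simp only [LinearMap.comp_apply, xop, rop_wd, LinearMap.add_apply, map_add, cop_wd, aop_cons]
    split_ifs
    · rw [rop_headMul]; simp
    · simp

/-- On words with at least one letter, the creation and annihilation parts commute pairwise. On a
word `z` without letters, left annihilation after right creation compensates right annihilation
after left creation: both vanish unless `bar i = j`, and then both give `φ_j(z)`. This is why a
field operator of index `i` annihilates with index `bar i`, and why `raop` involves the adjoint map.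
-/
lemma xop_yop (i j : I) (v : Word A I →₀ ℂ) : D.xop i (D.yop j v) = D.yop j (D.xop i v) := by
  refine LinearMap.congr_fun (f := D.xop i ∘ₗ D.yop j) (g := D.yop j ∘ₗ D.xop i)
    (hom_ext fun p => ?_) v
  obtain ⟨_ | ⟨⟨a, k⟩, w⟩, z⟩ := p
  · simp only [LinearMap.comp_apply, xop, yop, LinearMap.add_apply, rcop_wd, raop_nil,
      cop_wd, aop_nil, aop_cons, List.nil_append, add_zero, raop_singleton,
      List.cons_append, headMul_nil, D.bar_bar]
    congr 1
    by_cases hij : D.bar i = j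
    · subst hij
      simp [D.bar_bar]
    · have hij' : ¬ D.bar j = i := fun h => hij (by rw [← h, D.bar_bar])
      simp [hij, hij']
  · rcases List.eq_nil_or_concat' w with rfl | ⟨w, ⟨b, l⟩, rfl⟩
    · simp only [LinearMap.comp_apply, xop, yop, LinearMap.add_apply, map_add, rcop_wd, cop_wd,
        aop_cons, List.nil_append, raop_singleton, List.cons_append]
      have e1 : D.raop (D.bar j) (wd ([(1, i), (a, k)], z)) =
          if D.bar j = k then wd ([(1, i)], a * D.φ (D.bar (D.bar j)) z) else 0 :=
        D.raop_snoc (D.bar j) k a z [(1, i)]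
      rw [e1]
      split_ifs <;> simp_all
      · abel
    · simp only [LinearMap.comp_apply, xop, yop, LinearMap.add_apply, map_add, rcop_wd, cop_wd,
        aop_cons, raop_cons_snoc, List.cons_append]
      have e1 : D.raop (D.bar j) (wd ((1, i) :: (a, k) :: (w ++ [(b, l)]), z)) =
          if D.bar j = l then wd ((1, i) :: (a, k) :: w, b * D.φ (D.bar (D.bar j)) z) else 0 :=
        D.raop_snoc (D.bar j) l b z ((1, i) :: (a, k) :: w)
      rw [e1]
      have e2 := D.raop_headMul (D.φ (D.bar i) a) (D.bar j) (w ++ [(b, l)], z)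
      have e3 := rcop_headMul (D.φ (D.bar i) a) j ((w ++ [(b, l)], z) : Word A I)
      rw [raop_snoc] at e2
      rw [rcop_wd (w := w ++ [(b, l)]), lop_wd] at e3
      split_ifs at e2 ⊢
      · simp only [aop_cons, rcop_headMul, raop_headMul, raop_snoc, rcop_wd, lop_wd, cop_wd, *,
          if_true]
        abel
      · simp only [map_zero, add_zero, e2, e3]
      · simp only [map_zero, add_zero, cop_wd, aop_cons, *, if_false]
      · simp only [map_zero, add_zero]

/-! ### Bounded operators on the Fock space -/

section Hilbert

variable (h : IsCompleteTrace τ)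

/-- The full Fock space. -/
abbrev Fock : Type u := Hilb (D.core h)

/-- The vector of a word. -/
noncomputable def vec (p : Word A I) : D.Fock h := of (D.core h) (wd p)

lemma inner_vec (p q : Word A I) : inner ℂ (D.vec h p) (D.vec h q) = D.kernel p q := by
  rw [vec, vec, inner_of]
  change (Finsupp.single p (1 : ℂ)).sum _ = _
  rw [Finsupp.sum_single_index (by simp), wd,
    Finsupp.sum_single_index (by simp)]
  simp

lemma inner_ext {S T S' T' : (Word A I →₀ ℂ) →ₗ[ℂ] (Word A I →₀ ℂ)}
    (hST : ∀ p q, (D.core h).inner (S (wd p)) (T (wd q)) = (D.core h).inner (S' (wd p)) (T' (wd q)))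
    (v w : Word A I →₀ ℂ) :
    (D.core h).inner (S v) (T w) = (D.core h).inner (S' v) (T' w) := by
  simp only [← inner_of] at hST ⊢
  refine wd_induction (P := fun v => inner ℂ (of (D.core h) (S v)) (of (D.core h) (T w)) =
    inner ℂ (of (D.core h) (S' v)) (of (D.core h) (T' w))) (by simp) (fun v v' hv hv' => ?_)
    (fun r p => ?_) v
  · simp only [map_add, inner_add_left, hv, hv']
  · simp only [map_smul, inner_smul_left]
    congr 1
    refine wd_induction (P := fun w => inner ℂ (of (D.core h) (S (wd p))) (of (D.core h) (T w)) =
      inner ℂ (of (D.core h) (S' (wd p))) (of (D.core h) (T' w))) (by simp) (fun v v' hv hv' => ?_)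
      (fun r q => ?_) w
    · simp only [map_add, inner_add_right, hv, hv']
    · simp only [map_smul, inner_smul_right, hST]

lemma core_inner_wd (p q : Word A I) : (D.core h).inner (wd p) (wd q) = D.kernel p q := by
  rw [← inner_vec D h, vec, vec, inner_of]

lemma core_inner_zero_right (v : Word A I →₀ ℂ) : (D.core h).inner v 0 = 0 := by
  rw [← inner_of, map_zero, inner_zero_right]

lemma form_headMul_right (x c : A) (p q : Word A I) :
    D.form p.1 p.2 (headMul x q).1 (headMul x q).2 c = D.form p.1 p.2 q.1 q.2 (c * x) := by
  obtain ⟨_ | ⟨⟨a, i⟩, w⟩, z⟩ := p <;> obtain ⟨_ | ⟨⟨b, j⟩, w'⟩, z'⟩ := q <;> simp [mul_assoc]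

lemma form_headMul_left (x c : A) (p q : Word A I) :
    D.form (headMul x p).1 (headMul x p).2 q.1 q.2 c = D.form p.1 p.2 q.1 q.2 (star x * c) := by
  obtain ⟨_ | ⟨⟨a, i⟩, w⟩, z⟩ := p <;> obtain ⟨_ | ⟨⟨b, j⟩, w'⟩, z'⟩ := q <;> simp [mul_assoc]

lemma lop_action : StarAction (D.core h) (fun x : A => lop (I := I) x) where
  adjoint x := D.inner_ext h (S := lop x) (T := LinearMap.id) (S' := LinearMap.id)
    (T' := lop (star x)) fun p q => by
      simp only [lop_wd, LinearMap.id_apply, core_inner_wd, kernel, form_headMul_left,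
        form_headMul_right, mul_one, one_mul]
  mul x y := D.inner_ext h (S := LinearMap.id) (T := lop (x * y)) (S' := LinearMap.id)
    (T' := lop x ∘ₗ lop y) fun p q => by
      simp only [lop_wd, LinearMap.id_apply, LinearMap.comp_apply, headMul_headMul]
  add x y v w := by
    have := D.inner_ext h (S := LinearMap.id) (T := lop (x + y)) (S' := LinearMap.id)
      (T' := lop x + lop y) (fun p q => by
        rw [LinearMap.add_apply, ← inner_of (D.core h) _ (lop x (wd q) + lop y (wd q)), map_add,
          inner_add_right, inner_of, inner_of]
        simp only [lop_wd, LinearMap.id_apply, core_inner_wd, kernel, form_headMul_right, one_mul,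
          form_add, map_add]) v w
    rw [LinearMap.id_apply] at this
    rw [this, LinearMap.add_apply, ← inner_of (D.core h) _ (lop x w + lop y w), map_add,
      inner_add_right, inner_of, inner_of]
  smul r x v w := by
    have := D.inner_ext h (S := LinearMap.id) (T := lop (r • x)) (S' := LinearMap.id)
      (T' := r • lop x) (fun p q => by
        rw [LinearMap.smul_apply, ← inner_of (D.core h) _ (r • lop x (wd q)), map_smul,
          inner_smul_right, inner_of]
        simp only [lop_wd, LinearMap.id_apply, core_inner_wd, kernel, form_headMul_right, one_mul,
          form_smul, map_smul, smul_eq_mul]) v w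
    rw [LinearMap.id_apply] at this
    rw [this, LinearMap.smul_apply, ← inner_of (D.core h) _ (r • lop x w), map_smul,
      inner_smul_right, inner_of]
  one := D.inner_ext h (S := LinearMap.id) (T := lop 1) (S' := LinearMap.id)
    (T' := LinearMap.id) fun p q => by
      simp only [lop_wd, LinearMap.id_apply, core_inner_wd, kernel, form_headMul_right, mul_one]

lemma rop_action : StarAction (D.core h) (fun x : Aᵐᵒᵖ => rop (I := I) x.unop) where
  adjoint x := D.inner_ext h (S := rop x.unop) (T := LinearMap.id) (S' := LinearMap.id)
    (T' := rop (star x).unop) fun p q => by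
      obtain ⟨w, y⟩ := p
      obtain ⟨w', z⟩ := q
      simp only [rop_wd, LinearMap.id_apply, core_inner_wd, kernel, form_mul_left,
        form_mul_right]
      rw [h.mul_comm]
      rfl
  mul x y := D.inner_ext h (S := LinearMap.id) (T := rop (x * y).unop) (S' := LinearMap.id)
    (T' := rop x.unop ∘ₗ rop y.unop) fun p q => by
      obtain ⟨w', z⟩ := q
      simp only [rop_wd, LinearMap.id_apply, LinearMap.comp_apply, MulOpposite.unop_mul, mul_assoc]
  add x y v w := by
    have := D.inner_ext h (S := LinearMap.id) (T := rop (x + y).unop) (S' := LinearMap.id)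
      (T' := rop x.unop + rop y.unop) (fun p q => by
        obtain ⟨w', z⟩ := q
        rw [LinearMap.add_apply, ← inner_of (D.core h) _ (rop x.unop (wd (w', z)) + _), map_add,
          inner_add_right, inner_of, inner_of]
        simp only [rop_wd, LinearMap.id_apply, core_inner_wd, kernel, form_mul_right,
          MulOpposite.unop_add]
        rw [mul_add, map_add]) v w
    rw [LinearMap.add_apply, ← inner_of (D.core h) _ (rop x.unop w + rop y.unop w), map_add,
      inner_add_right, inner_of, inner_of] at this
    exact this
  smul r x v w := by
    have := D.inner_ext h (S := LinearMap.id) (T := rop (r • x).unop) (S' := LinearMap.id)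
      (T' := r • rop x.unop) (fun p q => by
        obtain ⟨w', z⟩ := q
        rw [LinearMap.smul_apply, ← inner_of (D.core h) _ (r • rop x.unop (wd (w', z))), map_smul,
          inner_smul_right, inner_of]
        simp only [rop_wd, LinearMap.id_apply, core_inner_wd, kernel, form_mul_right,
          MulOpposite.unop_smul]
        rw [mul_smul_comm, map_smul, smul_eq_mul]) v w
    rw [LinearMap.smul_apply, ← inner_of (D.core h) _ (r • rop x.unop w), map_smul,
      inner_smul_right, inner_of] at this
    exact this
  one := D.inner_ext h (S := LinearMap.id) (T := rop (1 : Aᵐᵒᵖ).unop) (S' := LinearMap.id)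
    (T' := LinearMap.id) fun p q => by
      obtain ⟨w', z⟩ := q
      simp only [rop_wd, LinearMap.id_apply, MulOpposite.unop_one, mul_one]

lemma cop_adjoint (i : I) (v w : Word A I →₀ ℂ) :
    (D.core h).inner (cop i v) w = (D.core h).inner v (D.aop i w) :=
  D.inner_ext h (S := cop i) (T := LinearMap.id) (S' := LinearMap.id) (T' := D.aop i) (fun p q => by
    obtain ⟨w, y⟩ := p
    obtain ⟨_ | ⟨⟨b, j⟩, w'⟩, z⟩ := q
    · simp [core_inner_wd, kernel, core_inner_zero_right]
    · simp only [cop_wd, LinearMap.id_apply, aop_cons, core_inner_wd]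
      split_ifs with hij
      · rw [core_inner_wd, kernel, kernel, form_headMul_right]
        simp [hij]
      · simp [core_inner_zero_right, kernel, hij]) v w

/-- This is the unitality of `φ i`. -/
lemma cop_isometry (i : I) (v w : Word A I →₀ ℂ) :
    (D.core h).inner (cop i v) (cop i w) = (D.core h).inner v w :=
  D.inner_ext h (S := cop i) (T := cop i) (S' := LinearMap.id) (T' := LinearMap.id) (fun p q => by
    obtain ⟨w, y⟩ := p
    obtain ⟨w', z⟩ := q
    simp [core_inner_wd, kernel, D.φ_one]) v w

-- The symmetry `τ(φ_i(a) b) = τ(a φ_{bar i}(b))` moves `φ_i` onto the last coefficient of the other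
-- word, which dictates the formula for `raop`.
include h in
lemma rcop_adjoint (i : I) (v w : Word A I →₀ ℂ) :
    (D.core h).inner (rcop i v) w = (D.core h).inner v (D.raop i w) :=
  D.inner_ext h (S := rcop i) (T := LinearMap.id) (S' := LinearMap.id) (T' := D.raop i) (fun p q => by
    obtain ⟨w, y⟩ := p
    refine word_cases (P := fun q => (D.core h).inner (rcop i (wd (w, y))) (LinearMap.id (wd q)) =
      (D.core h).inner (LinearMap.id (wd (w, y))) (D.raop i (wd q)))
      (fun z => ?_) (fun w' a j z => ?_) q
    · simp [core_inner_wd, kernel, core_inner_zero_right, form_snoc_nil]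
    · simp only [rcop_wd, LinearMap.id_apply, raop_snoc, core_inner_wd]
      split_ifs with hij
      · subst hij
        rw [core_inner_wd, kernel, kernel, form_snoc_snoc]
        simp only [if_true, star_one, one_mul]
        rw [D.symm, form_mul_right]
      · simp [core_inner_zero_right, kernel, hij, form_snoc_snoc]) v w

/-- On the right, the isometry property comes from `φ i` preserving the trace rather than from
unitality. -/
lemma rcop_isometry (i : I) (v w : Word A I →₀ ℂ) :
    (D.core h).inner (rcop i v) (rcop i w) = (D.core h).inner v w :=
  D.inner_ext h (S := rcop i) (T := rcop i) (S' := LinearMap.id) (T' := LinearMap.id) (fun p q => by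
    obtain ⟨w, y⟩ := p
    obtain ⟨w', z⟩ := q
    simp [core_inner_wd, kernel, form_snoc_snoc, D.trace_φ]) v w

lemma boundedBy_of_isometry {T : (Word A I →₀ ℂ) →ₗ[ℂ] (Word A I →₀ ℂ)}
    (hT : ∀ v w, (D.core h).inner (T v) (T w) = (D.core h).inner v w) :
    BoundedBy (D.core h) T 1 := fun v => by
  rw [one_mul, ← sq_le_sq₀ (norm_nonneg _) (norm_nonneg _), norm_sq_of, norm_sq_of, hT]

lemma boundedBy_add {S T : (Word A I →₀ ℂ) →ₗ[ℂ] (Word A I →₀ ℂ)} (hS : BoundedBy (D.core h) S 1)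
    (hT : BoundedBy (D.core h) T 1) : BoundedBy (D.core h) (S + T) 2 := fun v => by
  rw [LinearMap.add_apply, map_add]
  refine (norm_add_le _ _).trans ?_
  linarith [hS v, hT v]

/-- An isometry plus the adjoint of another one. The bound does not depend on the index, so the
field operators form bounded sequences. -/
lemma xop_boundedBy (i : I) : BoundedBy (D.core h) (D.xop i) 2 :=
  D.boundedBy_add h (D.boundedBy_of_isometry h (D.cop_isometry h i))
    ((D.boundedBy_of_isometry h (D.cop_isometry h _)).adjoint (D.cop_adjoint h _))

lemma yop_boundedBy (i : I) : BoundedBy (D.core h) (D.yop i) 2 :=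
  D.boundedBy_add h (D.boundedBy_of_isometry h (D.rcop_isometry h i))
    ((D.boundedBy_of_isometry h (D.rcop_isometry h _)).adjoint (D.rcop_adjoint h _))

lemma adjoint_add {S T S' T' : (Word A I →₀ ℂ) →ₗ[ℂ] (Word A I →₀ ℂ)}
    (hS : ∀ v w, (D.core h).inner (S v) w = (D.core h).inner v (S' w))
    (hT : ∀ v w, (D.core h).inner (T v) w = (D.core h).inner v (T' w)) (v w : Word A I →₀ ℂ) :
    (D.core h).inner (S v + T' v) w = (D.core h).inner v (T w + S' w) := by
  have hT' : ∀ v w, (D.core h).inner (T' v) w = (D.core h).inner v (T w) := fun v w => by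
    rw [← inner_of, ← inner_conj_symm, inner_of, ← hT, ← inner_of, inner_conj_symm, inner_of]
  rw [← inner_of, map_add, inner_add_left, inner_of, inner_of, hS, hT', ← inner_of, ← inner_of,
    ← inner_of, map_add, inner_add_right, add_comm]

/-- The left representation of `A` on the Fock space. -/
noncomputable def L : A →⋆ₐ[ℂ] (D.Fock h →L[ℂ] D.Fock h) := (D.lop_action h).rep

/-- The right representation of `A` on the Fock space. -/
noncomputable def R : Aᵐᵒᵖ →⋆ₐ[ℂ] (D.Fock h →L[ℂ] D.Fock h) := (D.rop_action h).rep

/-- The left field operators. -/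
noncomputable def X (i : I) : D.Fock h →L[ℂ] D.Fock h := op (D.xop i) (D.xop_boundedBy h i)

/-- The right field operators. -/
noncomputable def Y (i : I) : D.Fock h →L[ℂ] D.Fock h := op (D.yop i) (D.yop_boundedBy h i)

/-- The vacuum vector. -/
noncomputable def Ω : D.Fock h := D.vec h ([], 1)

lemma norm_X_le (i : I) : ‖D.X h i‖ ≤ 2 := norm_op_le _ (by norm_num) _

lemma star_X (i : I) : star (D.X h i) = D.X h (D.bar i) :=
  adjoint_op _ _ fun v w => by
    have := D.adjoint_add h (D.cop_adjoint h i) (D.cop_adjoint h (D.bar i)) v w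
    rw [xop, xop, D.bar_bar]
    exact this

lemma star_Y (i : I) : star (D.Y h i) = D.Y h (D.bar i) :=
  adjoint_op _ _ fun v w => by
    have := D.adjoint_add h (D.rcop_adjoint h i) (D.rcop_adjoint h (D.bar i)) v w
    rw [yop, yop, D.bar_bar]
    exact this

lemma L_of (x : A) (v) : D.L h x (of _ v) = of _ (lop x v) := (D.lop_action h).rep_of x v
lemma R_of (x : A) (v) : D.R h (MulOpposite.op x) (of _ v) = of _ (rop x v) :=
  (D.rop_action h).rep_of _ v
lemma X_of (i : I) (v) : D.X h i (of _ v) = of _ (D.xop i v) := op_of _ _ _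
lemma Y_of (i : I) (v) : D.Y h i (of _ v) = of _ (D.yop i v) := op_of _ _ _

lemma commute_L_R (x y : A) : Commute (D.L h x) (D.R h (MulOpposite.op y)) :=
  ext_op _ fun v => by
    change D.L h x (D.R h _ (of _ v)) = D.R h _ (D.L h x (of _ v))
    rw [R_of, L_of, L_of, R_of, lop_rop]

lemma commute_L_Y (x : A) (i : I) : Commute (D.L h x) (D.Y h i) :=
  ext_op _ fun v => by
    change D.L h x (D.Y h _ (of _ v)) = D.Y h _ (D.L h x (of _ v))
    rw [Y_of, L_of, L_of, Y_of, lop_yop]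

lemma commute_X_R (i : I) (x : A) : Commute (D.X h i) (D.R h (MulOpposite.op x)) :=
  ext_op _ fun v => by
    change D.X h i (D.R h _ (of _ v)) = D.R h _ (D.X h i (of _ v))
    rw [R_of, X_of, X_of, R_of, xop_rop]

lemma commute_X_Y (i j : I) : Commute (D.X h i) (D.Y h j) :=
  ext_op _ fun v => by
    change D.X h i (D.Y h _ (of _ v)) = D.Y h _ (D.X h i (of _ v))
    rw [Y_of, X_of, X_of, Y_of, xop_yop]

lemma L_vec (x : A) (p : Word A I) : D.L h x (D.vec h p) = D.vec h (headMul x p) := by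
  rw [vec, L_of, lop_wd]; rfl

lemma R_vec (x y : A) (w : List (A × I)) :
    D.R h (MulOpposite.op x) (D.vec h (w, y)) = D.vec h (w, y * x) := by
  rw [vec, R_of, rop_wd]; rfl

lemma X_Ω (i : I) : D.X h i (D.Ω h) = D.vec h ([(1, i)], 1) := by
  rw [Ω, vec, X_of, xop, LinearMap.add_apply, cop_wd, aop_nil, add_zero]; rfl

lemma Y_Ω (i : I) : D.Y h i (D.Ω h) = D.vec h ([(1, i)], 1) := by
  rw [Ω, vec, Y_of, yop, LinearMap.add_apply, rcop_wd, raop_nil, add_zero]; rfl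

lemma L_Ω_eq_R_Ω (x : A) : D.L h x (D.Ω h) = D.R h (MulOpposite.op x) (D.Ω h) := by
  rw [Ω, L_vec, R_vec]; simp

lemma inner_Ω_L_Ω (x : A) : inner ℂ (D.Ω h) (D.L h x (D.Ω h)) = τ x := by
  rw [Ω, L_vec, inner_vec]; simp [kernel]

/-- The bimodule generated by `X i Ω` is the one attached to `φ i`. All 2-norms of commutators and
conjugates of field operators are computed from this. -/
lemma inner_bimodule_X (a b c d : A) (i : I) :
    inner ℂ (D.L h a (D.R h (MulOpposite.op b) (D.X h i (D.Ω h))))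
      (D.L h c (D.R h (MulOpposite.op d) (D.X h i (D.Ω h)))) =
    τ (star b * D.φ i (star a * c) * d) := by
  rw [X_Ω, R_vec, R_vec, L_vec, L_vec, inner_vec]
  simp [kernel]

lemma star_R (x : A) :
    star (D.R h (MulOpposite.op x)) = D.R h (MulOpposite.op (star x)) :=
  (map_star (D.R h) (MulOpposite.op x)).symm

lemma star_L (x : A) : star (D.L h x) = D.L h (star x) := (map_star (D.L h) x).symm

lemma norm_Ω : ‖D.Ω h‖ = 1 := by
  have h1 := D.inner_Ω_L_Ω h 1
  rw [map_one, one_apply_eq_self, h.map_one] at h1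
  have h2 : ‖D.Ω h‖ ^ 2 = 1 := by
    rw [← inner_self_eq_norm_sq (𝕜 := ℂ), h1]
    rfl
  nlinarith [norm_nonneg (D.Ω h)]

lemma norm_sq_L_Ω (x : A) : ‖D.L h x (D.Ω h)‖ ^ 2 = (τ (star x * x)).re := by
  rw [← inner_Ω_L_Ω D h, map_mul, ← star_L, ← inner_self_eq_norm_sq (𝕜 := ℂ),
    ← ContinuousLinearMap.adjoint_inner_right]
  rfl

lemma L_X_L_Ω (a b : A) (i : I) : D.L h a (D.X h i (D.L h b (D.Ω h))) =
    D.L h a (D.R h (MulOpposite.op b) (D.X h i (D.Ω h))) := by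
  rw [L_Ω_eq_R_Ω]
  exact congrArg _ congr($(D.commute_X_R h i b) (D.Ω h))

lemma norm_sq_L_X_L_sub (a b c d : A) (i : I) :
    ‖D.L h a (D.X h i (D.L h b (D.Ω h))) - D.L h c (D.X h i (D.L h d (D.Ω h)))‖ ^ 2 =
    (τ (star b * D.φ i (star a * a) * b)).re + (τ (star d * D.φ i (star c * c) * d)).re -
      2 * (τ (star b * D.φ i (star a * c) * d)).re := by
  rw [L_X_L_Ω, L_X_L_Ω, norm_sub_sq (𝕜 := ℂ), ← inner_self_eq_norm_sq (𝕜 := ℂ),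
    ← inner_self_eq_norm_sq (𝕜 := ℂ), inner_bimodule_X, inner_bimodule_X, inner_bimodule_X]
  change (τ _).re - 2 * (τ _).re + (τ _).re = _
  ring

lemma norm_sq_L_X_sub_X_L (x : A) (i : I) :
    ‖D.L h x (D.X h i (D.Ω h)) - D.X h i (D.L h x (D.Ω h))‖ ^ 2 =
      2 * (τ (star x * x)).re - 2 * (τ (D.φ i (star x) * x)).re := by
  have h1 := D.norm_sq_L_X_L_sub h x 1 1 x i
  simp only [map_one, one_apply_eq_self, star_one, one_mul, mul_one, D.φ_one, D.trace_φ] at h1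
  rw [h1]
  ring

lemma norm_sq_L_X_L_star_sub (v : unitary A) (i : I) :
    ‖D.L h (v : A) (D.X h i (D.L h (star (v : A)) (D.Ω h))) - D.X h i (D.Ω h)‖ ^ 2 =
      2 - 2 * (τ (D.φ i (v : A) * star (v : A))).re := by
  have h1 := D.norm_sq_L_X_L_sub h 1 1 (v : A) (star (v : A)) i
  simp only [map_one, one_apply_eq_self, star_one, one_mul, mul_one, D.φ_one, star_star,
    Unitary.coe_star_mul_self, h.map_one, Complex.one_re] at h1
  rw [norm_sub_rev, h1, h.mul_comm (v : A), Unitary.coe_star_mul_self, h.map_one, Complex.one_re]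
  ring

/-- The vacuum is cyclic for the right operators. -/
lemma dense_of_invariant (S : Submodule ℂ (D.Fock h)) (hΩ : D.Ω h ∈ S)
    (hR : ∀ x, ∀ v ∈ S, D.R h (MulOpposite.op x) v ∈ S) (hY : ∀ i, ∀ v ∈ S, D.Y h i v ∈ S) :
    Dense (S : Set (D.Fock h)) := by
  have hword : ∀ n, ∀ w : List (A × I), w.length ≤ n → ∀ x, D.vec h (w, x) ∈ S := by
    intro n
    induction n with
    | zero =>
      intro w hw x
      rw [List.length_eq_zero_iff.1 (Nat.le_zero.1 hw)]
      have := hR x _ hΩ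
      rw [Ω, R_vec, one_mul] at this
      exact this
    | succ n ih =>
      intro w hw x
      rcases List.eq_nil_or_concat' w with rfl | ⟨w, ⟨a, i⟩, rfl⟩
      · exact ih [] (by simp) x
      · have hw' : w.length ≤ n := by simpa using hw
        have h1 := hY i _ (ih w hw' a)
        -- `Y i` appends a letter and adds at most a word with one letter fewer, which is in `S` by
        -- induction. Creation resets the last coefficient to `1`; the operator `R x` restores it.
        have h2 : D.Y h i (D.vec h (w, a)) =
            D.vec h (w ++ [(a, i)], 1) + of _ (D.raop (D.bar i) (wd (w, a))) := by
          rw [vec, Y_of, yop, LinearMap.add_apply, rcop_wd, map_add]; rfl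
        have h3 : of (D.core h) (D.raop (D.bar i) (wd (w, a))) ∈ S := by
          rcases List.eq_nil_or_concat' w with rfl | ⟨w', ⟨b, j⟩, rfl⟩
          · simp
          · rw [raop_snoc]
            split_ifs
            · refine ih w' ?_ _
              simp at hw'
              omega
            · simp
        rw [h2] at h1
        have h4 := hR x _ ((S.add_mem_iff_left h3).1 h1)
        rwa [R_vec, one_mul] at h4
  refine (denseRange_of (D.core h)).mono ?_
  rintro _ ⟨v, rfl⟩
  refine wd_induction (P := fun v => of (D.core h) v ∈ S) (by simp)
    (fun v w hv hw => by rw [map_add]; exact S.add_mem hv hw) (fun r p => ?_) v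
  rw [map_smul]
  exact S.smul_mem r (hword _ p.1 le_rfl p.2)

end Hilbert

end SymmetricCPFamily

/-! ### Normality of positive maps -/

section Normal

/-- A directed set is a monotone net indexed by itself, so normality can be checked with limits. -/
lemma scottContinuous_of_net {α : Type u} {β : Type*} [Preorder α] [Preorder β] {f : α → β}
    (h : ∀ {ι : Type u} [Preorder ι] [IsDirectedOrder ι] [Nonempty ι] (g : ι → α) (a : α),
      Monotone g → IsLUB (Set.range g) a → IsLUB (Set.range fun i => f (g i)) (f a)) :
    ScottContinuous f := by
  intro d hd hdir a ha
  have := DirectedOn.isDirectedOrder hdir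
  have := hd.to_subtype
  have h1 := h (fun i : d => (i : α)) a (fun _ _ h => h) (by rwa [Subtype.range_coe])
  rwa [show (fun i : d => f i) = f ∘ Subtype.val from rfl, Set.range_comp, Subtype.range_coe] at h1

variable {H : Type u} [NormedAddCommGroup H] [InnerProductSpace ℂ H] [CompleteSpace H]
variable {K : Type u} [NormedAddCommGroup K] [InnerProductSpace ℂ K] [CompleteSpace K]

/-- Vector functionals are normal. -/
lemma VonNeumannAlgebra.scottContinuous_inner (A : VonNeumannAlgebra H) (v : H) :
    ScottContinuous fun x : A.toStarSubalgebra => inner ℂ v ((x : H →L[ℂ] H) v) := by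
  refine scottContinuous_of_net fun g a hg ha => ?_
  refine isLUB_of_tendsto_atTop (fun i j hij => ?_)
    (tendsto_const_nhds.inner (A.tendsto_of_isLUB hg ha v))
  have := ContinuousLinearMap.le_iff_inner_nonneg.1 (hg hij) v
  rwa [sub_apply, inner_sub_right, sub_nonneg] at this

/-- A positive map all of whose vector functionals, for a dense set of vectors, are dominated by
the trace is normal. -/
theorem TracialVonNeumannAlgebra.scottContinuous_of_le_trace (M : TracialVonNeumannAlgebra H)
    (π : M →ₗ[ℂ] (K →L[ℂ] K)) (hπ : ∀ x, 0 ≤ π (star x * x)) {S : Set K} (hS : Dense S)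
    (hdom : ∀ v ∈ S, ∃ C : ℝ, ∀ x : M, (inner ℂ v (π (star x * x) v)).re ≤ C * M.normSq x) :
    ScottContinuous π := by
  have hpos : ∀ x : M, 0 ≤ x → 0 ≤ π x := fun x hx => by
    obtain ⟨s, rfl⟩ := CStarAlgebra.nonneg_iff_eq_star_mul_self.1 hx
    exact hπ s
  have hmono : Monotone π := fun x y hxy => by
    have := hpos _ (sub_nonneg.2 hxy)
    rwa [map_sub, sub_nonneg] at this
  refine scottContinuous_of_net fun g a hg ha => ?_
  have hga : ∀ i, g i ≤ a := fun i => ha.1 ⟨i, rfl⟩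
  obtain ⟨T, hT⟩ := ContinuousLinearMap.exists_strong_limit_of_monotone
    (f := fun i => π (g i)) (fun i j h => hmono (hg h)) (B := π a) (fun i => hmono (hga i))
  have htr := M.tendsto_trace hg (M.tendsto_of_isLUB hg ha)
  -- On `S`, the form of `π a - π (g i)` is at most `C τ(a - g i)`, which tends to `0`. Density then
  -- annihilates the form of `π a - T` everywhere.
  have hS0 : ∀ v ∈ S, inner ℂ v ((π a - T) v) = 0 := fun v hv => by
    obtain ⟨C, hC⟩ := hdom v hv
    have h1 : Tendsto (fun i => inner ℂ v ((π a - π (g i)) v)) atTop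
        (𝓝 (inner ℂ v ((π a - T) v))) :=
      tendsto_const_nhds.inner (tendsto_const_nhds.sub (hT v))
    have h0 : ∀ i, 0 ≤ inner ℂ v ((π a - π (g i)) v) := fun i =>
      ContinuousLinearMap.le_iff_inner_nonneg.1 (hmono (hga i)) v
    have h2 : Tendsto (fun i => (inner ℂ v ((π a - π (g i)) v)).re) atTop (𝓝 0) := by
      refine squeeze_zero (g := fun i => C * ((M.trace a).re - (M.trace (g i)).re))
        (fun i => (Complex.nonneg_iff.1 (h0 i)).1) (fun i => ?_) ?_
      · obtain ⟨s, hs⟩ := CStarAlgebra.nonneg_iff_eq_star_mul_self.1 (sub_nonneg.2 (hga i))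
        have := hC s
        rwa [← hs, map_sub, TracialVonNeumannAlgebra.normSq, ← hs, map_sub, Complex.sub_re] at this
      · simpa using ((tendsto_const_nhds (x := (M.trace a).re)).sub htr).const_mul C
    have h3 := tendsto_nhds_unique ((Complex.continuous_re.tendsto _).comp h1) h2
    have h4 : 0 ≤ inner ℂ v ((π a - T) v) := ge_of_tendsto h1 (Eventually.of_forall h0)
    exact Complex.ext h3 (Complex.nonneg_iff.1 h4).2.symm
  have hTa : T = π a := by
    have hz : ∀ v, inner ℂ v ((π a - T) v) = 0 := fun v => by
      have : IsClosed {v : K | inner ℂ v ((π a - T) v) = 0} :=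
        isClosed_eq (by fun_prop) continuous_const
      exact this.closure_subset_iff.2 hS0 (hS v)
    refine le_antisymm (ContinuousLinearMap.le_iff_inner_nonneg.2 fun v => (hz v).ge)
      (ContinuousLinearMap.le_iff_inner_nonneg.2 fun v => ?_)
    rw [← neg_sub, neg_apply, inner_neg_right, hz, neg_zero]
  constructor
  · rintro _ ⟨i, rfl⟩
    exact hmono (hga i)
  · intro B hB
    rw [← hTa]
    refine ContinuousLinearMap.le_iff_inner_nonneg.2 fun v => ?_
    exact ge_of_tendsto (tendsto_const_nhds.inner (tendsto_const_nhds.sub (hT v)))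
      (Eventually.of_forall fun i =>
        ContinuousLinearMap.le_iff_inner_nonneg.1 (hB ⟨i, rfl⟩ : π (g i) ≤ B) v)

lemma TracialVonNeumannAlgebra.coe_mul_apply (N : TracialVonNeumannAlgebra K) (x y : N) (v : K) :
    ((x * y : N) : K →L[ℂ] K) v = (x : K →L[ℂ] K) ((y : K →L[ℂ] K) v) := rfl

lemma TracialVonNeumannAlgebra.coe_sub_apply (N : TracialVonNeumannAlgebra K) (x y : N) (v : K) :
    ((x - y : N) : K →L[ℂ] K) v = (x : K →L[ℂ] K) v - (y : K →L[ℂ] K) v := rfl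

end Normal

/-! ### Tracial von Neumann algebras in standard form -/

namespace VonNeumannAlgebra

variable {K : Type u} [NormedAddCommGroup K] [InnerProductSpace ℂ K] [CompleteSpace K]

/-- The commutant of a set of operators and their adjoints. -/
noncomputable def centralizerOf (G : Set (K →L[ℂ] K)) : VonNeumannAlgebra K where
  toStarSubalgebra := StarSubalgebra.centralizer ℂ G
  centralizer_centralizer' := by
    change Set.centralizer (Set.centralizer (StarSubalgebra.centralizer ℂ G : Set (K →L[ℂ] K))) =
      (StarSubalgebra.centralizer ℂ G : Set (K →L[ℂ] K))
    rw [StarSubalgebra.coe_centralizer, Set.centralizer_centralizer_centralizer]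

lemma mem_centralizerOf {G : Set (K →L[ℂ] K)} {z : K →L[ℂ] K} :
    z ∈ centralizerOf G ↔ ∀ g ∈ G, g * z = z * g ∧ star g * z = z * star g :=
  StarSubalgebra.mem_centralizer_iff ℂ

lemma mem_commutant_centralizerOf {G : Set (K →L[ℂ] K)} {g : K →L[ℂ] K} (hg : g ∈ G) :
    g ∈ (centralizerOf G).commutant :=
  mem_commutant_iff.2 fun _ hz => ((mem_centralizerOf.1 hz g hg).1).symm

/-- `Z ∈ N` and `Z' ∈ N'` have the same action, and so have their adjoints, on the vector `Ω`. -/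
structure IsMirrorPair (N : VonNeumannAlgebra K) (Ω : K) (Z Z' : K →L[ℂ] K) : Prop where
  mem : Z ∈ N
  mem' : Z' ∈ N.commutant
  apply_eq : Z Ω = Z' Ω
  star_apply_eq : star Z Ω = star Z' Ω

variable {N : VonNeumannAlgebra K} {Ω : K}

lemma apply_comm {Z Z' : K →L[ℂ] K} (h : Z ∈ N) (h' : Z' ∈ N.commutant) (v : K) :
    Z (Z' v) = Z' (Z v) :=
  congr($(mem_commutant_iff.1 h' Z h) v)

lemma IsMirrorPair.mul {Z Z' P P' : K →L[ℂ] K} (h : IsMirrorPair N Ω Z Z')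
    (hP : IsMirrorPair N Ω P P') : IsMirrorPair N Ω (Z * P) (P' * Z') where
  mem := mul_mem h.mem hP.mem
  mem' := mul_mem hP.mem' h.mem'
  apply_eq := by
    change Z (P Ω) = P' (Z' Ω)
    rw [hP.apply_eq, apply_comm h.mem hP.mem', h.apply_eq]
  star_apply_eq := by
    rw [star_mul, star_mul]
    change star P (star Z Ω) = star Z' (star P' Ω)
    rw [h.star_apply_eq, apply_comm (star_mem hP.mem) (star_mem h.mem'), hP.star_apply_eq]

variable (N Ω) in
/-- The vectors `Z Ω` where `Z` belongs to a mirror pair. -/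
def mirrorSubmodule : Submodule ℂ K where
  carrier := {v | ∃ Z Z', IsMirrorPair N Ω Z Z' ∧ v = Z Ω}
  zero_mem' := ⟨0, 0, ⟨zero_mem _, zero_mem _, rfl, by simp⟩, rfl⟩
  add_mem' := by
    rintro _ _ ⟨Z, Z', h, rfl⟩ ⟨P, P', hP, rfl⟩
    refine ⟨Z + P, Z' + P', ⟨add_mem h.mem hP.mem, add_mem h.mem' hP.mem', ?_, ?_⟩, rfl⟩
    · rw [add_apply, add_apply, h.apply_eq, hP.apply_eq]
    · rw [star_add, star_add, add_apply, add_apply, h.star_apply_eq, hP.star_apply_eq]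
  smul_mem' := by
    rintro c _ ⟨Z, Z', h, rfl⟩
    refine ⟨c • Z, c • Z', ⟨N.toStarSubalgebra.smul_mem h.mem c,
      N.commutant.toStarSubalgebra.smul_mem h.mem' c, ?_, ?_⟩, rfl⟩
    · rw [smul_apply, smul_apply, h.apply_eq]
    · rw [star_smul, star_smul, smul_apply, smul_apply, h.star_apply_eq]

lemma self_mem_mirrorSubmodule : Ω ∈ mirrorSubmodule N Ω :=
  ⟨1, 1, ⟨one_mem _, one_mem _, rfl, by simp⟩, rfl⟩

lemma mem_mirrorSubmodule_of_pair {P P' : K →L[ℂ] K} (hP : IsMirrorPair N Ω P P') {v : K}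
    (hv : v ∈ mirrorSubmodule N Ω) : P' v ∈ mirrorSubmodule N Ω := by
  obtain ⟨Z, Z', h, rfl⟩ := hv
  refine ⟨Z * P, P' * Z', h.mul hP, ?_⟩
  rw [(h.mul hP).apply_eq, h.apply_eq]
  rfl

lemma inner_apply_star (Z : K →L[ℂ] K) (v w : K) : inner ℂ (star Z v) w = inner ℂ v (Z w) :=
  ContinuousLinearMap.adjoint_inner_left _ _ _

lemma inner_star_apply (Z : K →L[ℂ] K) (v w : K) : inner ℂ v (star Z w) = inner ℂ (Z v) w :=
  ContinuousLinearMap.adjoint_inner_right _ _ _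

lemma IsMirrorPair.inner_comm {Z Z' : K →L[ℂ] K} (h : IsMirrorPair N Ω Z Z') {Y : K →L[ℂ] K}
    (hY : Y ∈ N) : inner ℂ Ω (Z (Y Ω)) = inner ℂ Ω (Y (Z Ω)) := by
  rw [← inner_apply_star, h.star_apply_eq, inner_apply_star, ← apply_comm hY h.mem', h.apply_eq]

lemma IsMirrorPair.norm_star_apply {Z Z' : K →L[ℂ] K} (h : IsMirrorPair N Ω Z Z') :
    ‖star Z Ω‖ = ‖Z Ω‖ := by
  have h1 := h.inner_comm (star_mem h.mem)
  rw [inner_star_apply, ← inner_apply_star, inner_self_eq_norm_sq_to_K,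
    inner_self_eq_norm_sq_to_K] at h1
  have h2 : ‖star Z Ω‖ ^ 2 = ‖Z Ω‖ ^ 2 := by exact_mod_cast h1
  exact (sq_eq_sq₀ (norm_nonneg _) (norm_nonneg _)).1 h2

/-- Pair with mirror vectors: `⟨Y⋆Ω, ZΩ⟩ = ⟨Z⋆Ω, YΩ⟩` and `‖Z⋆Ω‖ = ‖ZΩ‖`, so density bounds `Y⋆Ω`.
Here `Y` itself need not belong to a mirror pair. -/
lemma norm_star_apply_le (hd : Dense (mirrorSubmodule N Ω : Set K)) {Y : K →L[ℂ] K} (hY : Y ∈ N) :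
    ‖star Y Ω‖ ≤ ‖Y Ω‖ := by
  have h1 : ∀ v, ‖inner ℂ (star Y Ω) v‖ ≤ ‖Y Ω‖ * ‖v‖ := fun v => by
    have hc : IsClosed {v : K | ‖inner ℂ (star Y Ω) v‖ ≤ ‖Y Ω‖ * ‖v‖} :=
      isClosed_le (by fun_prop) (by fun_prop)
    refine hc.closure_subset_iff.2 ?_ (hd v)
    rintro _ ⟨Z, Z', h, rfl⟩
    rw [Set.mem_ofPred_eq, inner_apply_star, ← h.inner_comm hY, ← inner_apply_star,
      ← h.norm_star_apply, mul_comm]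
    exact norm_inner_le_norm _ _
  have h2 := h1 (star Y Ω)
  rw [inner_self_eq_norm_sq_to_K] at h2
  have h3 : ‖star Y Ω‖ * ‖star Y Ω‖ ≤ ‖Y Ω‖ * ‖star Y Ω‖ := by
    rw [← sq]
    simpa using h2
  rcases (norm_nonneg (star Y Ω)).eq_or_lt with h0 | h0
  · rw [← h0]
    exact norm_nonneg _
  · exact le_of_mul_le_mul_right h3 h0

/-- For the first member `Z` of a mirror pair in place of `Y`, this is `IsMirrorPair.inner_comm`. In
general choose `Z` with `ZΩ` close to `YΩ`; by `norm_star_apply_le`, `(Y - Z)⋆Ω` is then small as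
well. -/
lemma inner_mul_comm (hd : Dense (mirrorSubmodule N Ω : Set K)) {X Y : K →L[ℂ] K} (hX : X ∈ N)
    (hY : Y ∈ N) : inner ℂ Ω (X (Y Ω)) = inner ℂ Ω (Y (X Ω)) := by
  refine sub_eq_zero.1 (norm_eq_zero.1 (le_antisymm (le_of_forall_pos_le_add fun ε hε => ?_)
    (norm_nonneg _)))
  set δ := ε / (‖star X Ω‖ + ‖X Ω‖ + 1)
  have hδ : 0 < δ := by positivity
  obtain ⟨_, ⟨Z, Z', h, rfl⟩, hv⟩ := Metric.mem_closure_iff.1 (hd (Y Ω)) δ hδ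
  rw [dist_eq_norm] at hv
  have h1 : ‖(Y - Z) Ω‖ ≤ δ := by
    rw [sub_apply]
    exact hv.le
  have hYZ : Y - Z ∈ N := sub_mem hY h.mem
  have h2 : ‖star (Y - Z) Ω‖ ≤ δ := (norm_star_apply_le hd hYZ).trans h1
  have h3 : inner ℂ Ω (X (Y Ω)) - inner ℂ Ω (Y (X Ω)) =
      inner ℂ (star X Ω) ((Y - Z) Ω) - inner ℂ (star (Y - Z) Ω) (X Ω) := by
    rw [inner_apply_star, inner_apply_star, sub_apply, sub_apply, map_sub, inner_sub_right,
      inner_sub_right, h.inner_comm hX]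
    ring
  rw [h3, zero_add]
  calc _ ≤ ‖star X Ω‖ * δ + δ * ‖X Ω‖ := (norm_sub_le _ _).trans
        (add_le_add ((norm_inner_le_norm _ _).trans (by gcongr))
          ((norm_inner_le_norm _ _).trans (by gcongr)))
    _ ≤ (‖star X Ω‖ + ‖X Ω‖ + 1) * δ := by nlinarith
    _ = ε := by
      simp only [δ]
      field_simp

/-- A von Neumann algebra with a unit vector generating a dense subspace of mirror pairs is
tracial. -/
noncomputable def tracialOfMirror (N : VonNeumannAlgebra K) (Ω : K) (hΩ : ‖Ω‖ = 1)
    (hd : Dense (mirrorSubmodule N Ω : Set K)) : TracialVonNeumannAlgebra K where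
  toVonNeumannAlgebra := N
  trace :=
    { toFun x := inner ℂ Ω ((x : K →L[ℂ] K) Ω)
      map_add' x y := inner_add_right _ _ _
      map_smul' c x := inner_smul_right _ _ _ }
  trace_one := by
    change inner ℂ Ω Ω = 1
    rw [inner_self_eq_norm_sq_to_K, hΩ]
    simp
  trace_mul_comm x y := inner_mul_comm hd x.2 y.2
  trace_nonneg x := by
    change 0 ≤ inner ℂ Ω (star (x : K →L[ℂ] K) ((x : K →L[ℂ] K) Ω))
    rw [inner_star_apply]
    exact Complex.nonneg_iff.2 ⟨inner_self_nonneg (𝕜 := ℂ), (inner_self_im (𝕜 := ℂ) _).symm⟩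
  trace_faithful x hx := by
    change inner ℂ Ω (star (x : K →L[ℂ] K) ((x : K →L[ℂ] K) Ω)) = 0 at hx
    rw [inner_star_apply, inner_self_eq_zero] at hx
    -- `Ω` is separating: `xΩ = 0` gives `xZ'Ω = Z'xΩ = 0`, and the vectors `Z'Ω` are dense.
    refine Subtype.ext (ContinuousLinearMap.coeFn_injective
      (Continuous.ext_on hd (x : K →L[ℂ] K).continuous (0 : K →L[ℂ] K).continuous ?_))
    rintro _ ⟨Z, Z', h, rfl⟩
    rw [h.apply_eq, apply_comm x.2 h.mem', hx, map_zero]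
    rfl
  trace_normal := N.scottContinuous_inner Ω

lemma normSq_tracialOfMirror (hΩ : ‖Ω‖ = 1) (hd : Dense (mirrorSubmodule N Ω : Set K))
    (x : tracialOfMirror N Ω hΩ hd) :
    (tracialOfMirror N Ω hΩ hd).normSq x = ‖(x : K →L[ℂ] K) Ω‖ ^ 2 := by
  change (inner ℂ Ω (star (x : K →L[ℂ] K) ((x : K →L[ℂ] K) Ω))).re = _
  rw [inner_star_apply]
  exact inner_self_eq_norm_sq (𝕜 := ℂ) _

/-- A trace preserving homomorphism into a tracial von Neumann algebra in standard form is
normal. -/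
theorem scottContinuous_tracialOfMirror {H : Type u} [NormedAddCommGroup H] [InnerProductSpace ℂ H]
    [CompleteSpace H] (M : TracialVonNeumannAlgebra H) (hΩ : ‖Ω‖ = 1)
    (hd : Dense (mirrorSubmodule N Ω : Set K)) (π : M →⋆ₐ[ℂ] tracialOfMirror N Ω hΩ hd)
    (hπ : ∀ x, (tracialOfMirror N Ω hΩ hd).normSq (π x) = M.normSq x) : ScottContinuous π := by
  have h1 := M.scottContinuous_of_le_trace (K := K)
    (π := { toFun x := (π x : K →L[ℂ] K), map_add' x y := by rw [map_add]; rfl,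
            map_smul' c x := by rw [map_smul]; rfl }) (fun x => by
      change 0 ≤ (π (star x * x) : K →L[ℂ] K)
      rw [map_mul, map_star]
      exact star_mul_self_nonneg (π x : K →L[ℂ] K)) hd (by
      rintro _ ⟨Z, Z', h, rfl⟩
      -- `π(x)ZΩ = Z'π(x)Ω`, and `‖π(x)Ω‖² = τ(x⋆x)`.
      refine ⟨‖Z'‖ ^ 2, fun x => ?_⟩
      change (inner ℂ (Z Ω) ((π (star x * x) : K →L[ℂ] K) (Z Ω))).re ≤ _
      rw [map_mul, map_star]
      change (inner ℂ (Z Ω) (star (π x : K →L[ℂ] K) ((π x : K →L[ℂ] K) (Z Ω)))).re ≤ _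
      rw [inner_star_apply]
      change RCLike.re (inner ℂ ((π x : K →L[ℂ] K) (Z Ω)) ((π x : K →L[ℂ] K) (Z Ω))) ≤ _
      rw [inner_self_eq_norm_sq, h.apply_eq, apply_comm (π x).2 h.mem', ← hπ,
        normSq_tracialOfMirror, ← mul_pow]
      gcongr
      exact Z'.le_opNorm _)
  intro d hne hdir a ha
  have h2 := h1 hne hdir ha
  refine ⟨?_, fun B hB => ?_⟩
  · rintro _ ⟨x, hx, rfl⟩
    exact h2.1 ⟨x, hx, rfl⟩
  · exact h2.2 (show (B : K →L[ℂ] K) ∈ upperBounds _ by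
      rintro _ ⟨x, hx, rfl⟩
      exact hB ⟨x, hx, rfl⟩)

end VonNeumannAlgebra

/-! ### The tracial von Neumann algebra of a family of completely positive maps -/

namespace SymmetricCPFamily

open PreHilbert VonNeumannAlgebra

variable {H : Type u} [NormedAddCommGroup H] [InnerProductSpace ℂ H] [CompleteSpace H]
variable {M : TracialVonNeumannAlgebra H} {I : Type} [DecidableEq I]
variable (D : SymmetricCPFamily (A := M.toStarSubalgebra) M.trace I)

/-- The Fock space of the family. -/
abbrev Space : Type u := D.Fock M.isCompleteTrace

/-- The von Neumann algebra of operators commuting with the right operators. -/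
noncomputable def algebra : VonNeumannAlgebra D.Space :=
  centralizerOf (Set.range (fun x => D.R M.isCompleteTrace (MulOpposite.op x)) ∪
    Set.range (D.Y M.isCompleteTrace))

lemma mem_algebra {Z : D.Space →L[ℂ] D.Space}
    (hR : ∀ x, Commute Z (D.R M.isCompleteTrace (MulOpposite.op x)))
    (hY : ∀ i, Commute Z (D.Y M.isCompleteTrace i)) : Z ∈ D.algebra := by
  refine mem_centralizerOf.2 ?_
  rintro _ (⟨x, rfl⟩ | ⟨i, rfl⟩)
  · refine ⟨(hR x).symm.eq, ?_⟩
    rw [star_R]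
    exact (hR _).symm.eq
  · refine ⟨(hY i).symm.eq, ?_⟩
    rw [star_Y]
    exact (hY _).symm.eq

lemma R_mem_commutant (x : M) : D.R M.isCompleteTrace (MulOpposite.op x) ∈ D.algebra.commutant :=
  mem_commutant_centralizerOf (Or.inl ⟨x, rfl⟩)

lemma Y_mem_commutant (i : I) : D.Y M.isCompleteTrace i ∈ D.algebra.commutant :=
  mem_commutant_centralizerOf (Or.inr ⟨i, rfl⟩)

lemma L_mem_algebra (x : M) : D.L M.isCompleteTrace x ∈ D.algebra :=
  D.mem_algebra (fun y => D.commute_L_R _ x y) fun i => D.commute_L_Y _ x i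

lemma X_mem_algebra (i : I) : D.X M.isCompleteTrace i ∈ D.algebra :=
  D.mem_algebra (fun y => D.commute_X_R _ i y) fun j => D.commute_X_Y _ i j

lemma isMirrorPair_L (x : M) : IsMirrorPair D.algebra (D.Ω M.isCompleteTrace)
    (D.L M.isCompleteTrace x) (D.R M.isCompleteTrace (MulOpposite.op x)) where
  mem := D.L_mem_algebra x
  mem' := D.R_mem_commutant x
  apply_eq := D.L_Ω_eq_R_Ω _ x
  star_apply_eq := by
    rw [star_R, star_L]
    exact D.L_Ω_eq_R_Ω _ (star x)

lemma isMirrorPair_X (i : I) : IsMirrorPair D.algebra (D.Ω M.isCompleteTrace)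
    (D.X M.isCompleteTrace i) (D.Y M.isCompleteTrace i) where
  mem := D.X_mem_algebra i
  mem' := D.Y_mem_commutant i
  apply_eq := by rw [X_Ω, Y_Ω]
  star_apply_eq := by rw [star_X, star_Y, X_Ω, Y_Ω]

lemma dense_mirrorSubmodule :
    Dense (mirrorSubmodule D.algebra (D.Ω M.isCompleteTrace) : Set D.Space) :=
  D.dense_of_invariant _ _ self_mem_mirrorSubmodule
    (fun x _ hv => mem_mirrorSubmodule_of_pair (D.isMirrorPair_L x) hv)
    (fun i _ hv => mem_mirrorSubmodule_of_pair (D.isMirrorPair_X i) hv)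

/-- The tracial von Neumann algebra generated by `M` and the field operators. -/
noncomputable def tracialAlgebra : TracialVonNeumannAlgebra D.Space :=
  tracialOfMirror D.algebra (D.Ω M.isCompleteTrace) (D.norm_Ω _) D.dense_mirrorSubmodule

lemma normSq_tracialAlgebra (x : D.tracialAlgebra) :
    D.tracialAlgebra.normSq x = ‖(x : D.Space →L[ℂ] D.Space) (D.Ω M.isCompleteTrace)‖ ^ 2 :=
  normSq_tracialOfMirror _ _ x

/-- The inclusion of `M`. -/
noncomputable def inclusion : M →⋆ₐ[ℂ] D.tracialAlgebra :=
  (D.L M.isCompleteTrace).codRestrict D.algebra.toStarSubalgebra D.L_mem_algebra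

/-- The field operators. -/
noncomputable def field (i : I) : D.tracialAlgebra := ⟨D.X M.isCompleteTrace i, D.X_mem_algebra i⟩

lemma coe_inclusion (x : M) :
    (D.inclusion x : D.Space →L[ℂ] D.Space) = D.L M.isCompleteTrace x := rfl

lemma coe_field (i : I) : (D.field i : D.Space →L[ℂ] D.Space) = D.X M.isCompleteTrace i := rfl

lemma normSq_inclusion (x : M) : D.tracialAlgebra.normSq (D.inclusion x) = M.normSq x := by
  rw [normSq_tracialAlgebra, coe_inclusion, norm_sq_L_Ω, TracialVonNeumannAlgebra.normSq]

lemma inclusion_injective : Function.Injective D.inclusion := by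
  refine (injective_iff_map_eq_zero D.inclusion).2 fun x hx => ?_
  have h := D.normSq_inclusion x
  rw [hx, TracialVonNeumannAlgebra.normSq_zero] at h
  refine M.trace_faithful x (Complex.ext h.symm ?_)
  exact (Complex.nonneg_iff.1 (M.trace_nonneg x)).2.symm

lemma scottContinuous_inclusion : ScottContinuous D.inclusion :=
  scottContinuous_tracialOfMirror M _ _ D.inclusion D.normSq_inclusion

lemma normSq_field_commutator (i : I) (x : M) :
    D.tracialAlgebra.normSq (D.inclusion x * D.field i - D.field i * D.inclusion x) =
      2 * M.normSq x - 2 * (M.trace (D.φ i (star x) * x)).re := by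
  rw [normSq_tracialAlgebra, TracialVonNeumannAlgebra.coe_sub_apply]
  simp only [TracialVonNeumannAlgebra.coe_mul_apply, coe_inclusion, coe_field]
  exact D.norm_sq_L_X_sub_X_L M.isCompleteTrace x i

lemma normSq_field_conj (i : I) (v : unitary (M : Type u)) :
    D.tracialAlgebra.normSq
      (D.inclusion (v : M) * D.field i * D.inclusion (star (v : M)) - D.field i) =
      2 - 2 * (M.trace (D.φ i (v : M) * star (v : M))).re := by
  rw [normSq_tracialAlgebra, TracialVonNeumannAlgebra.coe_sub_apply]
  simp only [TracialVonNeumannAlgebra.coe_mul_apply, coe_inclusion, coe_field]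
  exact D.norm_sq_L_X_L_star_sub M.isCompleteTrace v i

lemma norm_field_le (i : I) : ‖(D.field i : D.Space →L[ℂ] D.Space)‖ ≤ 2 := D.norm_X_le _ i

end SymmetricCPFamily

/-! ### Ultrapowers -/

namespace TracialVonNeumannAlgebra

variable {H : Type u} [NormedAddCommGroup H] [InnerProductSpace ℂ H] [CompleteSpace H]

lemma toUltrapower_eq_iff (M : TracialVonNeumannAlgebra H) (ω : Ultrafilter ℕ)
    (x y : M.boundedSeq) : M.toUltrapower ω x = M.toUltrapower ω y ↔
      Tendsto (fun n => M.normSq (x.1 n - y.1 n)) ω (𝓝 0) := by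
  change ((x : M.Ultrapower ω) = (y : M.Ultrapower ω)) ↔ _
  rw [RingCon.eq]
  change (M.ultraIdeal ω).ringCon x y ↔ _
  rw [TwoSidedIdeal.rel_iff, ultraIdeal, TwoSidedIdeal.mem_mk']
  rfl

lemma mem_centralizer_iff {K : Type u} [NormedAddCommGroup K] [InnerProductSpace ℂ K]
    [CompleteSpace K] {M : TracialVonNeumannAlgebra H} (N : TracialVonNeumannAlgebra K)
    (ω : Ultrafilter ℕ) (ι : M → N) (x : N.boundedSeq) :
    N.toUltrapower ω x ∈ Set.centralizer (Set.range fun m : M => N.diagonal ω (ι m)) ↔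
      ∀ m, Tendsto (fun n => N.normSq (ι m * x.1 n - x.1 n * ι m)) ω (𝓝 0) := by
  rw [Set.mem_centralizer_iff]
  simp only [Set.forall_mem_range, diagonal, ← map_mul]
  refine forall_congr' fun m => ?_
  rw [toUltrapower_eq_iff]
  rfl

/-- The unitaries of `M` that belong to `A`. -/
def unitaryIn (M : TracialVonNeumannAlgebra H) (A : VonNeumannAlgebra H) :
    Submonoid (unitary (M : Type u)) where
  carrier := {u | ((u : M) : H →L[ℂ] H) ∈ A}
  one_mem' := one_mem A
  mul_mem' hu hv := mul_mem (S := VonNeumannAlgebra H) hu hv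

/-- Every element of `A` is a linear combination of unitaries of `A`. -/
lemma mem_induction_unitary {M : TracialVonNeumannAlgebra H} {A : VonNeumannAlgebra H}
    (hA : A ≤ M.toVonNeumannAlgebra) (P : M → Prop) (hu : ∀ u ∈ M.unitaryIn A, P (u : M))
    (h0 : P 0) (hadd : ∀ x y, P x → P y → P (x + y)) (hsmul : ∀ (c : ℂ) x, P x → P (c • x))
    (x : M) (hx : (x : H →L[ℂ] H) ∈ A) : P x := by
  have h1 : (⟨x, hx⟩ : A.toStarSubalgebra) ∈
      Submodule.span ℂ (unitary A.toStarSubalgebra : Set A.toStarSubalgebra) := by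
    rw [CStarAlgebra.span_unitary]
    trivial
  have h2 : ∀ y ∈ Submodule.span ℂ (unitary A.toStarSubalgebra : Set A.toStarSubalgebra),
      P ⟨y.1, hA y.2⟩ := by
    intro y hy
    induction hy using Submodule.span_induction with
    | mem y hy =>
      have hy' := Unitary.mem_iff.1 hy
      exact hu ⟨⟨y.1, hA y.2⟩, Unitary.mem_iff.2
        ⟨Subtype.ext congr(($(hy'.1)).1), Subtype.ext congr(($(hy'.2)).1)⟩⟩ y.2
    | zero => exact h0
    | add y z _ _ h1 h2 => exact hadd _ _ h1 h2
    | smul c y _ h => exact hsmul c _ h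
  exact h2 _ h1

end TracialVonNeumannAlgebra

/-! ### Coefficients of bimodules -/

lemma IsCompleteTrace.eq_of_trace_mul {A : Type*} [CStarAlgebra A] {τ : A →ₗ[ℂ] ℂ}
    (h : IsCompleteTrace τ) {x y : A} (hxy : ∀ b, τ (x * b) = τ (y * b)) : x = y := by
  refine sub_eq_zero.1 (h.faithful _ ?_)
  rw [h.mul_comm, sub_mul, map_sub, hxy, sub_self]

/-- The properties of the coefficient `β(a, b) = ⟨ξ, a ξ b⟩` of a tracial vector in a bimodule. -/
structure IsTracialCoefficient {A : Type u} [CStarAlgebra A] (τ : A →ₗ[ℂ] ℂ)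
    (β : A →ₗ[ℂ] A →ₗ[ℂ] ℂ) : Prop where
  one_left : ∀ b, β 1 b = τ b
  one_right : ∀ a, β a 1 = τ a
  map_star : ∀ a b, β (star a) (star b) = star (β a b)
  bound_right : ∀ a x y, ‖β a (x * star y)‖ ≤ ‖a‖ * √(τ (star x * x)).re * √(τ (star y * y)).re
  bound_left : ∀ b x y, ‖β (x * star y) b‖ ≤ ‖b‖ * √(τ (star x * x)).re * √(τ (star y * y)).re
  pos : ∀ {ι : Type u} [Fintype ι] (a b : ι → A),
    0 ≤ (∑ p, ∑ q, β (star (a p) * a q) (b q * star (b p))).re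

namespace IsTracialCoefficient

variable {A : Type u} [CStarAlgebra A] {τ : A →ₗ[ℂ] ℂ} {β : A →ₗ[ℂ] A →ₗ[ℂ] ℂ}

/-- The maps attached by `exists_density` to a coefficient and to its flip are adjoint to each other
for the trace. -/
lemma flip (hβ : IsTracialCoefficient τ β) : IsTracialCoefficient τ β.flip where
  one_left b := hβ.one_right b
  one_right a := hβ.one_left a
  map_star a b := hβ.map_star b a
  bound_right a x y := hβ.bound_left a x y
  bound_left b x y := hβ.bound_right b x y
  pos a b := by
    have := hβ.pos (fun p => star (b p)) (fun p => star (a p))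
    simp only [star_star] at this
    rw [Finset.sum_comm] at this
    exact this

/-- Each functional `β a` is dominated by the trace with constant `‖a‖`, so Radon-Nikodym applies.
Densities are unique, which makes them linear in `a`. -/
lemma exists_density (hβ : IsTracialCoefficient τ β) (h : IsCompleteTrace τ) :
    ∃ φ : A →ₗ[ℂ] A, ∀ a b, τ (φ a * b) = β a b := by
  have h1 : ∀ a, ∃ k : A, ∀ b, β a b = τ (k * b) := fun a => by
    refine h.exists_density (β a) (norm_nonneg a) fun x y => ?_
    have e : ∀ x : A, ‖PreHilbert.of h.core x‖ = √(τ (star x * x)).re := fun x => by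
      rw [← h.norm_sq_L2, Real.sqrt_sq (norm_nonneg _)]
    rw [e, e]
    exact hβ.bound_right a x y
  choose φ hφ using h1
  refine ⟨{ toFun := φ, map_add' := fun x y => ?_, map_smul' := fun c x => ?_ },
    fun a b => (hφ a b).symm⟩
  · refine h.eq_of_trace_mul fun b => ?_
    rw [add_mul, map_add, ← hφ, ← hφ, ← hφ, map_add]
    rfl
  · refine h.eq_of_trace_mul fun b => ?_
    rw [RingHom.id_apply, smul_mul_assoc, map_smul, ← hφ, ← hφ, map_smul]
    rfl

end IsTracialCoefficient

section ofCoefficients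

variable {A : Type u} [CStarAlgebra A] {τ : A →ₗ[ℂ] ℂ}

/-- A sequence of coefficients, together with their flips. -/
noncomputable def coefficientWithFlip (β : ℕ → A →ₗ[ℂ] A →ₗ[ℂ] ℂ) (i : ℕ × Bool) :
    A →ₗ[ℂ] A →ₗ[ℂ] ℂ :=
  if i.2 then β i.1 else (β i.1).flip

lemma coefficientWithFlip_not (β : ℕ → A →ₗ[ℂ] A →ₗ[ℂ] ℂ) (i : ℕ × Bool) (a b : A) :
    coefficientWithFlip β (i.1, !i.2) a b = coefficientWithFlip β i b a := by
  obtain ⟨n, _ | _⟩ := i <;> simp [coefficientWithFlip]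

lemma isTracialCoefficient_withFlip {β : ℕ → A →ₗ[ℂ] A →ₗ[ℂ] ℂ}
    (hβ : ∀ n, IsTracialCoefficient τ (β n)) (i : ℕ × Bool) :
    IsTracialCoefficient τ (coefficientWithFlip β i) := by
  obtain ⟨n, _ | _⟩ := i
  · simpa [coefficientWithFlip] using (hβ n).flip
  · simpa [coefficientWithFlip] using hβ n

/-- The family of completely positive maps defined by a sequence of coefficients. -/
lemma exists_symmetricCPFamily (h : IsCompleteTrace τ) {β : ℕ → A →ₗ[ℂ] A →ₗ[ℂ] ℂ}
    (hβ : ∀ n, IsTracialCoefficient τ (β n)) :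
    ∃ D : SymmetricCPFamily τ (ℕ × Bool), ∀ n a b, τ (D.φ (n, true) a * b) = β n a b := by
  choose φ hφ using fun i => (isTracialCoefficient_withFlip hβ i).exists_density h
  -- The index `(n, true)` carries `βₙ` and `(n, false)` its flip. As `bar` exchanges them, the
  -- symmetry of the family holds by construction.
  refine ⟨{ bar := fun i => (i.1, !i.2), bar_bar := fun i => by simp, φ := φ, φ_one := ?_,
            φ_star := ?_, symm := ?_, cp := ?_ }, fun n a b => ?_⟩
  · intro i
    refine h.eq_of_trace_mul fun b => ?_
    rw [hφ, (isTracialCoefficient_withFlip hβ i).one_left, one_mul]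
  · intro i a
    refine h.eq_of_trace_mul fun b => ?_
    have e : star (φ i a) * b = star (star b * φ i a) := by rw [star_mul, star_star]
    rw [hφ, e, h.map_star, h.mul_comm, hφ, ← (isTracialCoefficient_withFlip hβ i).map_star,
      star_star]
  · intro i a b
    rw [h.mul_comm a, hφ, hφ, coefficientWithFlip_not]
  · intro i κ _ a b
    have := (isTracialCoefficient_withFlip hβ i).pos a b
    have e : ∀ p q, τ (star (b p) * φ i (star (a p) * a q) * b q) =
        coefficientWithFlip β i (star (a p) * a q) (b q * star (b p)) := fun p q => by
      rw [← hφ, mul_assoc, h.mul_comm, mul_assoc]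
    simpa only [e] using this
  · rw [hφ]
    simp [coefficientWithFlip]

end ofCoefficients

namespace TracialVonNeumannAlgebra

variable {H : Type u} [NormedAddCommGroup H] [InnerProductSpace ℂ H] [CompleteSpace H]
variable {M : TracialVonNeumannAlgebra H}

namespace Bimodule

variable {K : Type u} [NormedAddCommGroup K] [InnerProductSpace ℂ K] [CompleteSpace K]
variable (B : Bimodule M K)

lemma inner_left (a : M) (v w : K) :
    inner ℂ (B.left a v) w = inner ℂ v (B.left (star a) w) := by
  rw [map_star]
  exact (VonNeumannAlgebra.inner_star_apply _ _ _).symm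

lemma inner_right (b : M) (v w : K) : inner ℂ (B.right (MulOpposite.op b) v) w =
    inner ℂ v (B.right (MulOpposite.op (star b)) w) := by
  rw [MulOpposite.op_star, map_star]
  exact (VonNeumannAlgebra.inner_star_apply _ _ _).symm

lemma left_left (a c : M) (v : K) : B.left a (B.left c v) = B.left (a * c) v := by
  rw [map_mul]; rfl

lemma right_right (b d : M) (v : K) : B.right (MulOpposite.op b) (B.right (MulOpposite.op d) v) =
    B.right (MulOpposite.op (d * b)) v := by
  rw [MulOpposite.op_mul, map_mul]; rfl

lemma left_right (a b : M) (v : K) : B.left a (B.right (MulOpposite.op b) v) =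
    B.right (MulOpposite.op b) (B.left a v) :=
  congr($(B.commute a (MulOpposite.op b)) v)

/-- The coefficient `⟨ξ, a ξ b⟩`. -/
noncomputable def coefficient (ξ : K) : M →ₗ[ℂ] M →ₗ[ℂ] ℂ :=
  LinearMap.mk₂ ℂ (fun a b => inner ℂ ξ (B.left a (B.right (MulOpposite.op b) ξ)))
    (fun a a' b => by rw [map_add, add_apply, inner_add_right])
    (fun c a b => by rw [map_smul, smul_apply, inner_smul_right, smul_eq_mul])
    (fun a b b' => by rw [MulOpposite.op_add, map_add, add_apply, map_add, inner_add_right])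
    (fun c a b => by
      rw [MulOpposite.op_smul, map_smul, smul_apply, map_smul, inner_smul_right, smul_eq_mul])

lemma coefficient_apply (ξ : K) (a b : M) :
    B.coefficient ξ a b = inner ℂ ξ (B.left a (B.right (MulOpposite.op b) ξ)) := rfl

lemma inner_eq_coefficient (ξ : K) (a b c d : M) :
    inner ℂ (B.left a (B.right (MulOpposite.op b) ξ)) (B.left c (B.right (MulOpposite.op d) ξ)) =
      B.coefficient ξ (star a * c) (d * star b) := by
  rw [inner_left, left_left, inner_right, coefficient_apply, ← left_right, right_right]

lemma left_one (v : K) : B.left 1 v = v := by rw [map_one]; rfl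

lemma right_one (v : K) : B.right (MulOpposite.op 1) v = v := by
  rw [MulOpposite.op_one, map_one]; rfl

variable {B} {ξ : K}

lemma norm_left (hξ : B.IsTracial ξ) (a : M) : ‖B.left a ξ‖ ^ 2 = M.normSq a := by
  rw [← inner_self_eq_norm_sq (𝕜 := ℂ), inner_left, left_left, (hξ _).1]
  rfl

lemma norm_right (hξ : B.IsTracial ξ) (b : M) :
    ‖B.right (MulOpposite.op b) ξ‖ ^ 2 = M.normSq b := by
  rw [← inner_self_eq_norm_sq (𝕜 := ℂ), inner_right, right_right, (hξ _).2, ← M.normSq_star,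
    normSq, star_star]
  rfl

lemma norm_left_eq (hξ : B.IsTracial ξ) (a : M) : ‖B.left a ξ‖ = √(M.trace (star a * a)).re := by
  rw [← Real.sqrt_sq (norm_nonneg (B.left a ξ)), norm_left hξ]
  rfl

lemma norm_right_eq (hξ : B.IsTracial ξ) (b : M) :
    ‖B.right (MulOpposite.op b) ξ‖ = √(M.trace (star b * b)).re := by
  rw [← Real.sqrt_sq (norm_nonneg (B.right _ ξ)), norm_right hξ]
  rfl

lemma norm_left_apply_le (a : M) (v : K) : ‖B.left a v‖ ≤ ‖a‖ * ‖v‖ :=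
  (ContinuousLinearMap.le_opNorm _ _).trans (by
    gcongr
    exact NonUnitalStarAlgHom.norm_apply_le B.left a)

lemma norm_right_apply_le (b : M) (v : K) : ‖B.right (MulOpposite.op b) v‖ ≤ ‖b‖ * ‖v‖ :=
  (ContinuousLinearMap.le_opNorm _ _).trans (by
    gcongr
    exact NonUnitalStarAlgHom.norm_apply_le B.right (MulOpposite.op b))

/-- The bounds are Cauchy-Schwarz after moving one of `x`, `y` to the other side of the inner
product: traciality turns the norms into 2-norms, and both actions are contractive. Positivity is
`‖∑ a_q ξ b_q‖² ≥ 0`. -/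
theorem isTracialCoefficient (hξ : B.IsTracial ξ) :
    IsTracialCoefficient (A := M.toStarSubalgebra) M.trace (B.coefficient ξ) where
  one_left b := by
    rw [coefficient_apply, left_one]
    exact (hξ b).2
  one_right a := by
    rw [coefficient_apply, right_one]
    exact (hξ a).1
  map_star a b := by
    rw [coefficient_apply, coefficient_apply, left_right, ← inner_right, ← inner_left,
      ← inner_conj_symm]
    rfl
  bound_right a x y := by
    have e : B.coefficient ξ a (x * star y) = inner ℂ (B.right (MulOpposite.op y) ξ)
        (B.left a (B.right (MulOpposite.op x) ξ)) := by
      rw [inner_right, ← left_right, right_right]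
      rfl
    rw [e, ← norm_right_eq hξ, ← norm_right_eq hξ]
    refine (norm_inner_le_norm _ _).trans ?_
    rw [mul_comm]
    gcongr
    exact norm_left_apply_le _ _
  bound_left b x y := by
    have e : B.coefficient ξ (x * star y) b = inner ℂ (B.left (star x) ξ)
        (B.right (MulOpposite.op b) (B.left (star y) ξ)) := by
      rw [inner_left, star_star, ← left_right, left_left]
      rfl
    have e2 : ∀ z : M, √(M.trace (star z * z)).re = ‖B.left (star z) ξ‖ := fun z => by
      rw [norm_left_eq hξ, star_star, M.trace_mul_comm]
    rw [e, e2, e2]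
    refine (norm_inner_le_norm _ _).trans ?_
    rw [mul_comm ‖b‖, mul_assoc]
    gcongr
    exact norm_right_apply_le _ _
  pos a b := by
    have h := inner_self_nonneg (𝕜 := ℂ)
      (x := ∑ q, B.left (a q) (B.right (MulOpposite.op (b q)) ξ))
    rw [sum_inner] at h
    simp only [inner_sum, inner_eq_coefficient] at h
    exact h

lemma norm_sq_commutator (hξ : B.IsTracial ξ) (x : M) : ‖B.commutator x ξ‖ ^ 2 =
    2 * M.normSq x - 2 * (B.coefficient ξ (star x) x).re := by
  have h := norm_sub_sq (𝕜 := ℂ) (B.left x ξ) (B.right (MulOpposite.op x) ξ)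
  rw [inner_left, norm_left hξ, norm_right hξ] at h
  rw [commutator, h, coefficient_apply]
  change _ - 2 * (inner ℂ ξ _).re + _ = _
  ring

lemma norm_left_unitary {u : M} (hu : u ∈ unitary (M : Type u)) (v : K) : ‖B.left u v‖ = ‖v‖ := by
  rw [← sq_eq_sq₀ (norm_nonneg _) (norm_nonneg _), ← inner_self_eq_norm_sq (𝕜 := ℂ), inner_left,
    left_left, (Unitary.mem_iff.1 hu).1, left_one, inner_self_eq_norm_sq]

lemma norm_right_unitary {u : M} (hu : u ∈ unitary (M : Type u)) (v : K) :
    ‖B.right (MulOpposite.op u) v‖ = ‖v‖ := by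
  rw [← sq_eq_sq₀ (norm_nonneg _) (norm_nonneg _), ← inner_self_eq_norm_sq (𝕜 := ℂ), inner_right,
    right_right, (Unitary.mem_iff.1 hu).2, right_one, inner_self_eq_norm_sq]

lemma norm_sq_conj_sub (hξ1 : ‖ξ‖ = 1) (u : unitary (M : Type u)) :
    ‖B.left (u : M) (B.right (MulOpposite.op (star (u : M))) ξ) - ξ‖ ^ 2 =
      2 - 2 * (B.coefficient ξ u (star (u : M))).re := by
  have hu : star (u : M) ∈ unitary (M : Type u) := Unitary.star_mem u.2
  rw [norm_sub_rev, norm_sub_sq (𝕜 := ℂ), norm_left_unitary u.2, norm_right_unitary hu, hξ1,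
    coefficient_apply]
  change 1 ^ 2 - 2 * (inner ℂ ξ _).re + _ = _
  ring

/-- If the orbit of `ξ` under conjugation by unitaries of `A` is close to `ξ`, then there is an
`A`-central vector close to `ξ`. -/
theorem exists_isCentral {A : VonNeumannAlgebra H} (hA : A ≤ M.toVonNeumannAlgebra) {ε : ℝ}
    (h : ∀ u ∈ M.unitaryIn A,
      ‖B.left (u : M) (B.right (MulOpposite.op (star (u : M))) ξ) - ξ‖ ≤ ε) :
    ∃ η, B.IsCentral A η ∧ ‖η - ξ‖ ≤ ε := by
  let c : unitary (M : Type u) → K →L[ℂ] K := fun u =>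
    B.left (u : M) * B.right (MulOpposite.op (star (u : M)))
  obtain ⟨ζ, hζ, hfix⟩ := exists_fixed_point_closure_convexHull
    (O := (fun u => c u ξ) '' (M.unitaryIn A : Set (unitary (M : Type u)))) ⟨_, 1, one_mem _, rfl⟩
    (c '' (M.unitaryIn A : Set (unitary (M : Type u)))) (by
      rintro _ ⟨u, hu, rfl⟩ v
      have hu' : star (u : M) ∈ unitary (M : Type u) := Unitary.star_mem u.2
      exact (norm_left_unitary u.2 _).trans (norm_right_unitary hu' _)) (by
      rintro _ ⟨u, hu, rfl⟩ _ ⟨w, hw, rfl⟩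
      refine ⟨u * w, mul_mem hu hw, ?_⟩
      change B.left ((u : M) * w) (B.right (MulOpposite.op (star ((u : M) * w))) ξ) =
        B.left (u : M) (B.right (MulOpposite.op (star (u : M))) (B.left (w : M)
          (B.right (MulOpposite.op (star (w : M))) ξ)))
      rw [← left_right, left_left, right_right, star_mul])
  refine ⟨ζ, fun x hx => ?_, ?_⟩
  · refine mem_induction_unitary hA (fun x => B.commutator x ζ = 0) (fun u hu => ?_) ?_ ?_ ?_ x hx
    · have h1 : B.left (u : M) (B.right (MulOpposite.op (star (u : M))) ζ) = ζ :=
        hfix _ ⟨u, hu, rfl⟩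
      have h2 := congrArg (B.right (MulOpposite.op (u : M))) h1
      rw [← left_right, right_right, (Unitary.mem_iff.1 u.2).1, right_one] at h2
      exact sub_eq_zero.2 h2
    · simp [commutator]
    · intro x y hx hy
      rw [commutator, MulOpposite.op_add, map_add, map_add, add_apply, add_apply, add_sub_add_comm]
      change B.commutator x ζ + B.commutator y ζ = 0
      rw [hx, hy, add_zero]
    · intro r x hx
      rw [commutator, MulOpposite.op_smul, map_smul, map_smul, smul_apply, smul_apply, ← smul_sub]
      change r • B.commutator x ζ = 0
      rw [hx, smul_zero]
  · have h1 : closure (convexHull ℝ ((fun u => c u ξ) ''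
        (M.unitaryIn A : Set (unitary (M : Type u))))) ⊆ Metric.closedBall ξ ε := by
      refine closure_minimal (convexHull_min ?_ (convex_closedBall ξ ε)) Metric.isClosed_closedBall
      rintro _ ⟨u, hu, rfl⟩
      rw [Metric.mem_closedBall, dist_eq_norm]
      exact h u hu
    have := h1 hζ
    rwa [Metric.mem_closedBall, dist_eq_norm] at this

end Bimodule

/-- Failure of relative property (T) in terms of coefficients. -/
theorem exists_coefficient_of_not_relativePropertyT {A : VonNeumannAlgebra H}
    (hA : A ≤ M.toVonNeumannAlgebra) (hT : ¬ M.RelativePropertyT A) :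
    ∃ ε' : ℝ, 0 < ε' ∧ ∀ (F : Finset M) (ε : ℝ), 0 < ε → ∃ β : M →ₗ[ℂ] M →ₗ[ℂ] ℂ,
      IsTracialCoefficient (A := M.toStarSubalgebra) M.trace β ∧
      (∀ x ∈ F, 2 * M.normSq x - 2 * (β (star x) x).re ≤ ε ^ 2) ∧
      ∃ u ∈ M.unitaryIn A, ε' ^ 2 < 2 - 2 * (β (u : M) (star (u : M))).re := by
  unfold RelativePropertyT at hT
  push Not at hT
  obtain ⟨ε', hε', hT⟩ := hT
  refine ⟨ε', hε', fun F ε hε => ?_⟩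
  obtain ⟨K, i1, i2, i3, B, ξ, hξ1, hξ, hF, hno⟩ := hT F ε hε
  refine ⟨B.coefficient ξ, Bimodule.isTracialCoefficient hξ, fun x hx => ?_, ?_⟩
  · rw [← Bimodule.norm_sq_commutator hξ]
    have := hF x hx
    gcongr
  -- If conjugation by every unitary of `A` moved `ξ` by at most `ε'`, averaging would give an
  -- `A`-central vector within `ε'`.
  · by_contra hneg
    push Not at hneg
    obtain ⟨η, hη, hle⟩ := Bimodule.exists_isCentral (B := B) (ξ := ξ) hA (ε := ε') fun u hu => by
      have := hneg u hu
      rw [← Bimodule.norm_sq_conj_sub hξ1] at this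
      exact (sq_le_sq₀ (norm_nonneg _) hε'.le).1 this
    exact absurd hle (not_le.2 (hno η hη))

end TracialVonNeumannAlgebra

/-! ### Central sequences in extensions force relative property (T) -/

namespace TracialVonNeumannAlgebra

variable {H : Type u} [NormedAddCommGroup H] [InnerProductSpace ℂ H] [CompleteSpace H]

lemma normSq_sub_le (M : TracialVonNeumannAlgebra H) (x y : M) :
    M.normSq (x - y) ≤ 2 * (M.normSq x + M.normSq y) := by
  have := M.normSq_add_le x (-y)
  rwa [← sub_eq_add_neg, M.normSq_neg] at this

variable {M : TracialVonNeumannAlgebra H}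

/-- Asymptotic commutation with a dense set of `M`, along a bounded sequence, implies asymptotic
commutation with `M`. -/
lemma tendsto_normSq_commutator_of_dense {K : Type u} [NormedAddCommGroup K]
    [InnerProductSpace ℂ K] [CompleteSpace K] {N : TracialVonNeumannAlgebra K} (ι : M →⋆ₐ[ℂ] N)
    (hι : ∀ x, N.normSq (ι x) = M.normSq x) {s : Set M}
    (hs : ∀ x : M, ∀ ε : ℝ, 0 < ε → ∃ y ∈ s, M.normSq (x - y) < ε) {X : ℕ → N} {C : ℝ}
    (hC : ∀ n, ‖(X n : K →L[ℂ] K)‖ ≤ C) {l : Filter ℕ}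
    (h : ∀ y ∈ s, Tendsto (fun n => N.normSq (ι y * X n - X n * ι y)) l (𝓝 0)) (x : M) :
    Tendsto (fun n => N.normSq (ι x * X n - X n * ι x)) l (𝓝 0) := by
  refine tendsto_order.2 ⟨fun a ha => Eventually.of_forall fun n => ha.trans_le (N.normSq_nonneg _),
    fun a ha => ?_⟩
  -- Replacing `x` by `y` costs at most `8C²‖x - y‖₂²`; the `+ 1` covers `C = 0`.
  obtain ⟨y, hy, hxy⟩ := hs x (a / 2 / (8 * C ^ 2 + 1)) (by positivity)
  rw [lt_div_iff₀ (by positivity)] at hxy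
  filter_upwards [(tendsto_order.1 (h y hy)).2 (a / 4) (by positivity)] with n hn
  have e : ι x * X n - X n * ι x = (ι y * X n - X n * ι y) +
      (ι (x - y) * X n - X n * ι (x - y)) := by
    rw [map_sub]
    noncomm_ring
  have h1 := N.normSq_mul_le_right (ι (x - y)) (X n)
  have h2 := N.normSq_mul_le_left (X n) (ι (x - y))
  rw [hι] at h1 h2
  have h3 : ‖(X n : K →L[ℂ] K)‖ ^ 2 ≤ C ^ 2 := by
    gcongr
    exact hC n
  have h4 := M.normSq_nonneg (x - y)
  have h5 := mul_le_mul_of_nonneg_right h3 h4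
  rw [e]
  calc _ ≤ _ := N.normSq_add_le _ _
    _ ≤ 2 * (N.normSq (ι y * X n - X n * ι y) + 2 * (N.normSq (ι (x - y) * X n) +
        N.normSq (X n * ι (x - y)))) := by
      gcongr
      exact N.normSq_sub_le _ _
    _ < a := by nlinarith

lemma commute_of_mem_centralizer {K : Type u} [NormedAddCommGroup K]
    [InnerProductSpace ℂ K] [CompleteSpace K] {N : TracialVonNeumannAlgebra K} {ι : M →⋆ₐ[ℂ] N}
    {A : VonNeumannAlgebra H} {y : N}
    (hy : y ∈ Set.centralizer (ι '' {a : M | (a : H →L[ℂ] H) ∈ A})) {u : unitary (M : Type u)}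
    (hu : u ∈ M.unitaryIn A) : ι (u : M) * y * ι (star (u : M)) = y := by
  rw [hy _ ⟨(u : M), hu, rfl⟩, mul_assoc, ← map_mul, (Unitary.mem_iff.1 u.2).2, map_one, mul_one]

lemma norm_sq_embedding_unitary_le {K : Type u} [NormedAddCommGroup K]
    [InnerProductSpace ℂ K] [CompleteSpace K] {N : TracialVonNeumannAlgebra K} (ι : M →⋆ₐ[ℂ] N)
    {u : M} (hu : u ∈ unitary (M : Type u)) : ‖(ι u : K →L[ℂ] K)‖ ^ 2 ≤ 1 := by
  have h1 : ‖ι u‖ ≤ ‖u‖ := NonUnitalStarAlgHom.norm_apply_le ι u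
  have h2 : ‖u‖ ≤ 1 := by
    rw [← sq_le_one_iff₀ (norm_nonneg _), sq, ← CStarRing.norm_star_mul_self,
      (Unitary.mem_iff.1 hu).1]
    exact (ContinuousLinearMap.norm_id_le : ‖(1 : H →L[ℂ] H)‖ ≤ 1)
  have h3 : ‖(ι u : K →L[ℂ] K)‖ ≤ 1 := h1.trans h2
  exact pow_le_one₀ (norm_nonneg _) h3

/-- An element close to the relative commutant of `A` is almost fixed under conjugation by unitaries
of `A`. -/
lemma normSq_conj_sub_le {K : Type u} [NormedAddCommGroup K]
    [InnerProductSpace ℂ K] [CompleteSpace K] {N : TracialVonNeumannAlgebra K} {ι : M →⋆ₐ[ℂ] N}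
    {A : VonNeumannAlgebra H} {y : N}
    (hy : y ∈ Set.centralizer (ι '' {a : M | (a : H →L[ℂ] H) ∈ A})) {u : unitary (M : Type u)}
    (hu : u ∈ M.unitaryIn A) (X : N) :
    N.normSq (ι (u : M) * X * ι (star (u : M)) - X) ≤ 4 * N.normSq (X - y) := by
  have e : ι (u : M) * X * ι (star (u : M)) - X =
      ι (u : M) * (X - y) * ι (star (u : M)) - (X - y) := by
    rw [mul_sub, sub_mul, commute_of_mem_centralizer hy hu]
    abel
  have h1 : N.normSq (ι (u : M) * (X - y) * ι (star (u : M))) ≤ N.normSq (X - y) :=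
    calc _ ≤ _ := N.normSq_mul_le_right _ _
      _ ≤ 1 * N.normSq (ι (u : M) * (X - y)) := by
        gcongr
        · exact N.normSq_nonneg _
        · exact norm_sq_embedding_unitary_le ι (Unitary.star_mem u.2)
      _ = N.normSq (ι (u : M) * (X - y)) := one_mul _
      _ ≤ _ := N.normSq_mul_le_left _ _
      _ ≤ 1 * N.normSq (X - y) := by
        gcongr
        · exact N.normSq_nonneg _
        · exact norm_sq_embedding_unitary_le ι u.2
      _ = _ := one_mul _
  rw [e]
  refine (N.normSq_sub_le _ _).trans ?_
  linarith

/-- Every sequence of coefficients of tracial vectors is realised by a bounded sequence in an extension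
of `M`. -/
theorem exists_extension_of_coefficients {β : ℕ → M →ₗ[ℂ] M →ₗ[ℂ] ℂ}
    (hβ : ∀ n, IsTracialCoefficient (A := M.toStarSubalgebra) M.trace (β n)) :
    ∃ (K : Type u) (_ : NormedAddCommGroup K) (_ : InnerProductSpace ℂ K) (_ : CompleteSpace K)
      (N : TracialVonNeumannAlgebra K) (ι : M →⋆ₐ[ℂ] N) (X : ℕ → N),
      Function.Injective ι ∧ ScottContinuous ι ∧ (∀ x, N.normSq (ι x) = M.normSq x) ∧
      (∀ n, ‖(X n : K →L[ℂ] K)‖ ≤ 2) ∧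
      (∀ n x, N.normSq (ι x * X n - X n * ι x) = 2 * M.normSq x - 2 * (β n (star x) x).re) ∧
      ∀ n (v : unitary (M : Type u)), N.normSq (ι (v : M) * X n * ι (star (v : M)) - X n) =
        2 - 2 * (β n (v : M) (star (v : M))).re := by
  obtain ⟨D, hD⟩ := exists_symmetricCPFamily M.isCompleteTrace hβ
  refine ⟨D.Space, inferInstance, inferInstance, inferInstance, D.tracialAlgebra, D.inclusion,
    fun n => D.field (n, true), D.inclusion_injective, D.scottContinuous_inclusion,
    D.normSq_inclusion, fun n => D.norm_field_le _, fun n x => ?_, fun n v => ?_⟩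
  · rw [D.normSq_field_commutator, hD]
  · rw [D.normSq_field_conj, hD]

/-- If central sequences of every extension of `M` come from the relative commutant of `A`, then
`A ⊂ M` has relative property (T). -/
theorem relativePropertyT_of_forall_centralizer_subset (hsep : M.IsSeparable)
    {A : VonNeumannAlgebra H} (hA : A ≤ M.toVonNeumannAlgebra) {ω : Ultrafilter ℕ}
    (hω : (ω : Filter ℕ) ≤ Filter.cofinite)
    (h : ∀ (K : Type u) [NormedAddCommGroup K] [InnerProductSpace ℂ K] [CompleteSpace K]
        (N : TracialVonNeumannAlgebra K) (ι : M →⋆ₐ[ℂ] N),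
        Function.Injective ι → ScottContinuous ι →
        Set.centralizer (Set.range fun x : M => N.diagonal ω (ι x)) ⊆
          N.subUltrapower ω (Set.centralizer (ι '' {a : M | (a : H →L[ℂ] H) ∈ A}))) :
    M.RelativePropertyT A := by
  classical
  by_contra hT
  obtain ⟨ε', hε', hT⟩ := exists_coefficient_of_not_relativePropertyT hA hT
  obtain ⟨s, hsc, hs⟩ := hsep
  have hsne : s.Nonempty := by
    obtain ⟨y, hy, -⟩ := hs 0 1 one_pos
    exact ⟨y, hy⟩
  obtain ⟨f, rfl⟩ := hsc.exists_eq_range hsne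
  -- The finite sets exhaust a dense sequence while the tolerance `1/(n + 1)` tends to `0`; the
  -- displacement under `uₙ` stays above `ε'`.
  choose β hβ hβc u hu hβu using fun n : ℕ =>
    hT ((Finset.range (n + 1)).image f) (1 / ((n : ℝ) + 1)) (by positivity)
  obtain ⟨K, i1, i2, i3, N, ι, X, hinj, hscott, hnormSq, hX, hcomm, hconj⟩ :=
    exists_extension_of_coefficients hβ
  -- Non-principality: limits as `n → ∞` are limits along `ω`.
  have hωtop : (ω : Filter ℕ) ≤ atTop := by rwa [← Nat.cofinite_eq_atTop]
  have hcentral : ∀ x, Tendsto (fun n => N.normSq (ι x * X n - X n * ι x)) ω (𝓝 0) := by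
    refine tendsto_normSq_commutator_of_dense ι hnormSq hs hX ?_
    rintro _ ⟨k, rfl⟩
    refine Tendsto.mono_left ?_ hωtop
    have hlim : Tendsto (fun n : ℕ => (1 / ((n : ℝ) + 1)) ^ 2) atTop (𝓝 0) := by
      simpa using (tendsto_one_div_add_atTop_nhds_zero_nat (𝕜 := ℝ)).pow 2
    refine tendsto_of_tendsto_of_tendsto_of_le_of_le' tendsto_const_nhds hlim
      (Eventually.of_forall fun n => N.normSq_nonneg _) ?_
    filter_upwards [eventually_ge_atTop k] with n hn
    rw [hcomm]
    exact hβc n (f k) (Finset.mem_image_of_mem f (Finset.mem_range.2 (by omega)))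
  let Xb : N.boundedSeq := ⟨X, 2, hX⟩
  obtain ⟨y, hy, hyX⟩ := h K N ι hinj hscott
    ((mem_centralizer_iff N ω ι Xb).2 hcentral)
  rw [toUltrapower_eq_iff] at hyX
  -- The factor `4` of `normSq_conj_sub_le` turns this bound into `ε' ^ 2`, against `hβu`.
  obtain ⟨n, hn⟩ := ((tendsto_order.1 hyX).2 (ε' ^ 2 / 4) (by positivity)).exists
  have h1 := normSq_conj_sub_le (hy n) (hu n) (X n)
  rw [hconj, ← N.normSq_neg (X n - _), neg_sub] at h1
  have h2 := hβu n
  have h3 : N.normSq (y.1 n - X n) < ε' ^ 2 / 4 := hn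
  linarith

end TracialVonNeumannAlgebra

/-! ### Cayley transforms -/

/-- The Cayley transform of a self-adjoint element, with its commutation properties. -/
lemma exists_cayley {A : Type*} [CStarAlgebra A] {h : A} (hh : IsSelfAdjoint h) :
    ∃ u ∈ unitary A, ∃ r, (h + Complex.I • 1) * r = 1 ∧ r * (h + Complex.I • 1) = 1 ∧
      u = 1 - (2 * Complex.I) • r ∧ ‖(2 * Complex.I) • r‖ ≤ 2 := by
  have hunit : IsUnit (h + Complex.I • 1) := by
    have h1 : -Complex.I ∉ spectrum ℂ h := fun hmem => by
      have := hh.im_eq_zero_of_mem_spectrum hmem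
      simp at this
    rw [spectrum.notMem_iff] at h1
    convert h1.neg using 1
    rw [neg_sub, Algebra.algebraMap_eq_smul_one, neg_smul, sub_neg_eq_add]
  obtain ⟨w, hw⟩ := hunit
  set r : A := ↑w⁻¹
  have h1 : (h + Complex.I • 1) * r = 1 := by rw [← hw]; exact w.mul_inv
  have h2 : r * (h + Complex.I • 1) = 1 := by rw [← hw]; exact w.inv_mul
  set k : A := h - Complex.I • 1
  have hstar : star (h + Complex.I • (1 : A)) = k := by
    rw [star_add, hh.star_eq, star_smul, star_one, Complex.star_def, Complex.conj_I, neg_smul,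
      ← sub_eq_add_neg]
  have hcomm : k * (h + Complex.I • 1) = (h + Complex.I • 1) * k := by
    have h3 : Commute h (Complex.I • 1) := (Commute.one_right h).smul_right _
    exact ((Commute.refl h).add_right h3).sub_left (h3.symm.add_right (Commute.refl _))
  have hu : 1 - (2 * Complex.I) • r = k * r := by
    have : k = (h + Complex.I • 1) - (2 * Complex.I) • 1 := by
      rw [two_mul, add_smul]
      simp only [k]
      abel
    rw [this, sub_mul, h1, smul_mul_assoc, one_mul]
  have h3 : star r * k = 1 := by rw [← hstar, ← star_mul, h1, star_one]
  have h4 : k * star r = 1 := by rw [← hstar, ← star_mul, h2, star_one]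
  have hrk : r * k = k * r := by
    calc r * k = r * (k * (h + Complex.I • 1)) * r := by rw [mul_assoc, mul_assoc, h1, mul_one]
      _ = k * r := by rw [hcomm, ← mul_assoc, h2, one_mul]
  have hks : star k = h + Complex.I • 1 := by rw [← hstar, star_star]
  have hmem : k * r ∈ unitary A := by
    refine Unitary.mem_iff.2 ⟨?_, ?_⟩
    · rw [star_mul, hks]
      calc star r * (h + Complex.I • 1) * (k * r)
          = star r * ((h + Complex.I • 1) * k) * r := by simp only [mul_assoc]
        _ = (star r * k) * ((h + Complex.I • 1) * r) := by rw [← hcomm]; simp only [mul_assoc]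
        _ = 1 := by rw [h3, h1, one_mul]
    · rw [star_mul, hks, ← hrk]
      calc r * k * (star r * (h + Complex.I • 1))
          = r * (k * star r) * (h + Complex.I • 1) := by simp only [mul_assoc]
        _ = 1 := by rw [h4, mul_one, h2]
  refine ⟨k * r, hmem, r, h1, h2, hu.symm, ?_⟩
  have hn : ∀ v ∈ unitary A, ‖v‖ ≤ 1 := fun v hv => by
    rcases subsingleton_or_nontrivial A with h0 | h0
    · rw [Subsingleton.elim v 0, norm_zero]
      exact zero_le_one
    · exact (CStarRing.norm_of_mem_unitary hv).le
  have h5 : (2 * Complex.I) • r = 1 - k * r := by rw [← hu, sub_sub_cancel]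
  rw [h5]
  calc ‖1 - k * r‖ ≤ ‖(1 : A)‖ + ‖k * r‖ := norm_sub_le _ _
    _ ≤ 1 + 1 := add_le_add (hn 1 (one_mem _)) (hn _ hmem)
    _ = 2 := by norm_num

lemma IsCompleteTrace.norm_sq_trace_le {A : Type*} [CStarAlgebra A] {τ : A →ₗ[ℂ] ℂ}
    (h : IsCompleteTrace τ) (x : A) : ‖τ x‖ ^ 2 ≤ (τ (star x * x)).re := by
  have h1 := norm_inner_le_norm (𝕜 := ℂ) (PreHilbert.of h.core (1 : A)) (PreHilbert.of h.core x)
  have h2 : ‖PreHilbert.of h.core (1 : A)‖ ^ 2 = 1 := by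
    rw [h.norm_sq_L2, star_one, one_mul, h.map_one, Complex.one_re]
  have h3 : ‖PreHilbert.of h.core (1 : A)‖ = 1 := by
    nlinarith [norm_nonneg (PreHilbert.of h.core (1 : A))]
  rw [h.inner_L2, star_one, one_mul, h3, one_mul] at h1
  rw [← h.norm_sq_L2]
  gcongr

namespace TracialVonNeumannAlgebra

variable {H : Type u} [NormedAddCommGroup H] [InnerProductSpace ℂ H] [CompleteSpace H]
variable {K : Type u} [NormedAddCommGroup K] [InnerProductSpace ℂ K] [CompleteSpace K]

/-- A self-adjoint element is replaced by a unitary with comparable commutators. -/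
lemma exists_unitary_commutator (N : TracialVonNeumannAlgebra K) {h : N} (hh : IsSelfAdjoint h) :
    ∃ u ∈ unitary (N : Type u), ∀ m : N,
      N.normSq (m * u - u * m) ≤ 4 * N.normSq (m * h - h * m) ∧
      N.normSq (m * h - h * m) ≤ (‖h‖ + 1) ^ 4 * N.normSq (m * u - u * m) := by
  obtain ⟨u, hu, r, h1, h2, hur, hr⟩ := exists_cayley hh
  refine ⟨u, hu, fun m => ?_⟩
  have hr1 : ‖r‖ ≤ 1 := by
    rw [norm_smul, show ‖2 * Complex.I‖ = 2 by simp] at hr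
    linarith
  -- The resolvent `r = (h + i)⁻¹` satisfies `[m, r] = -r[m, h]r`, and `u = 1 - 2ir`. The constants
  -- come from `‖2ir‖ ≤ 2` and `‖r‖ ≤ 1` here, and from `‖h + i‖ ≤ ‖h‖ + 1` in the inverted formula
  -- `e2`.
  have e1 : m * u - u * m = ((2 * Complex.I) • r) * (m * h - h * m) * r := by
    have e0 : m * r - r * m = - (r * (m * h - h * m) * r) := by
      calc m * r - r * m = (r * (h + Complex.I • 1)) * m * r - r * m * ((h + Complex.I • 1) * r) := by
            rw [h1, h2, one_mul, mul_one]
        _ = - (r * (m * h - h * m) * r) := by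
          simp only [mul_add, add_mul, mul_sub, sub_mul, smul_mul_assoc, mul_smul_comm, one_mul,
            mul_one, mul_assoc]
          abel
    calc m * u - u * m = - ((2 * Complex.I) • (m * r - r * m)) := by
          rw [hur]
          simp only [mul_sub, sub_mul, smul_mul_assoc, mul_smul_comm, one_mul, mul_one, smul_sub]
          abel
      _ = _ := by rw [e0, smul_neg, neg_neg, smul_mul_assoc, smul_mul_assoc]
  have e2 : m * h - h * m =
      ((2 * Complex.I)⁻¹ • (h + Complex.I • 1)) * (m * u - u * m) * (h + Complex.I • 1) := by
    rw [e1]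
    calc m * h - h * m = ((h + Complex.I • 1) * r) * (m * h - h * m) *
          (r * (h + Complex.I • 1)) := by rw [h1, h2, one_mul, mul_one]
      _ = ((2 * Complex.I)⁻¹ * (2 * Complex.I)) • (((h + Complex.I • 1) * r) * (m * h - h * m) *
          (r * (h + Complex.I • 1))) := by
        rw [inv_mul_cancel₀ (by simp), one_smul]
      _ = _ := by
        rw [mul_smul]
        simp only [smul_mul_assoc, mul_smul_comm, mul_assoc]
        exact smul_comm _ _ _
  have hh1 : ‖h + Complex.I • (1 : N)‖ ≤ ‖h‖ + 1 := by
    refine (norm_add_le _ _).trans (add_le_add le_rfl ?_)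
    rw [norm_smul, Complex.norm_I, one_mul]
    exact (ContinuousLinearMap.norm_id_le : ‖(1 : K →L[ℂ] K)‖ ≤ 1)
  have hh2 : ‖(2 * Complex.I)⁻¹ • (h + Complex.I • (1 : N))‖ ≤ ‖h‖ + 1 := by
    rw [norm_smul]
    have : ‖(2 * Complex.I)⁻¹‖ ≤ 1 := by
      rw [norm_inv, norm_mul, Complex.norm_I]
      norm_num
    calc _ ≤ 1 * (‖h‖ + 1) := by gcongr
      _ = _ := one_mul _
  have key : ∀ (a b x : N) (α β : ℝ), ‖a‖ ≤ α → ‖b‖ ≤ β →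
      N.normSq (a * x * b) ≤ α ^ 2 * β ^ 2 * N.normSq x := fun a b x α β ha hb => by
    have i1 := N.normSq_mul_le_right (a * x) b
    have i2 := N.normSq_mul_le_left a x
    have i3 : ‖(b : K →L[ℂ] K)‖ ^ 2 ≤ β ^ 2 := by
      gcongr
      exact hb
    have i4 : ‖(a : K →L[ℂ] K)‖ ^ 2 ≤ α ^ 2 := by
      gcongr
      exact ha
    calc _ ≤ _ := i1
      _ ≤ β ^ 2 * (α ^ 2 * N.normSq x) := by
        gcongr
        · exact N.normSq_nonneg _
        · refine i2.trans ?_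
          gcongr
          exact N.normSq_nonneg _
      _ = _ := by ring
  constructor
  · have := key _ _ (m * h - h * m) 2 1 hr hr1
    rw [e1]
    linarith
  · have := key _ _ (m * u - u * m) _ _ hh2 hh1
    rw [← e2] at this
    calc _ ≤ _ := this
      _ = _ := by ring

/-! ### Uniqueness of the trace -/

lemma norm_trace_sq_le (M : TracialVonNeumannAlgebra H) (x : M) : ‖M.trace x‖ ^ 2 ≤ M.normSq x :=
  M.isCompleteTrace.norm_sq_trace_le x

lemma tendsto_trace_of_isLUB (M : TracialVonNeumannAlgebra H) {ι : Type*} [Preorder ι]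
    [IsDirectedOrder ι] [Nonempty ι] {f : ι → M} (hf : Monotone f) {x : M}
    (hx : IsLUB (Set.range f) x) : Tendsto (fun i => M.trace (f i)) atTop (𝓝 (M.trace x)) := by
  have h1 := M.tendsto_trace hf (M.tendsto_of_isLUB hf hx)
  have h2 : ∀ i, (((M.trace (f i)).re : ℝ) : ℂ) + (M.trace x).im * Complex.I = M.trace (f i) :=
    fun i => by
      rw [← (Complex.le_def.1 (M.trace_normal.monotone (hx.1 ⟨i, rfl⟩))).2, Complex.re_add_im]
  have h3 := (((Complex.continuous_ofReal.tendsto _).comp h1).add_const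
    ((M.trace x).im * Complex.I))
  rw [Complex.re_add_im] at h3
  exact h3.congr h2

variable {M : TracialVonNeumannAlgebra H} {N : TracialVonNeumannAlgebra K}

lemma half_nonneg : (0 : ℂ) ≤ 1 / 2 := by
  rw [show (1 / 2 : ℂ) = ((1 / 2 : ℝ) : ℂ) by norm_num]
  exact Complex.zero_le_real.2 (by norm_num)

/-- `M` with the average of its trace and the trace of an extension. -/
noncomputable def withAverageTrace (ι : M →⋆ₐ[ℂ] N) (hι : ScottContinuous ι) :
    TracialVonNeumannAlgebra H where
  toVonNeumannAlgebra := M.toVonNeumannAlgebra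
  trace := (1 / 2 : ℂ) • (M.trace + N.trace ∘ₗ ι.toAlgHom.toLinearMap)
  trace_one := by
    change (1 / 2 : ℂ) * (M.trace 1 + N.trace (ι 1)) = 1
    rw [map_one ι, M.trace_one, N.trace_one]
    norm_num
  trace_mul_comm x y := by
    change (1 / 2 : ℂ) * (M.trace (x * y) + N.trace (ι (x * y))) =
      (1 / 2 : ℂ) * (M.trace (y * x) + N.trace (ι (y * x)))
    rw [map_mul ι, map_mul ι, M.trace_mul_comm, N.trace_mul_comm]
  trace_nonneg x := by
    change 0 ≤ (1 / 2 : ℂ) * (M.trace (star x * x) + N.trace (ι (star x * x)))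
    rw [map_mul ι, map_star ι]
    exact mul_nonneg half_nonneg (add_nonneg (M.trace_nonneg x) (N.trace_nonneg _))
  trace_faithful x hx := by
    change (1 / 2 : ℂ) * (M.trace (star x * x) + N.trace (ι (star x * x))) = 0 at hx
    rw [map_mul ι, map_star ι] at hx
    have h1 := (mul_eq_zero.1 hx).resolve_left (by norm_num)
    exact M.trace_faithful x
      ((add_eq_zero_iff_of_nonneg (M.trace_nonneg x) (N.trace_nonneg (ι x))).1 h1).1
  trace_normal := by
    refine scottContinuous_of_net fun g a hg ha => ?_
    change IsLUB (Set.range fun i => (1 / 2 : ℂ) * (M.trace (g i) + N.trace (ι (g i))))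
      ((1 / 2 : ℂ) * (M.trace a + N.trace (ι a)))
    have h1 : IsLUB (Set.range fun i => ι (g i)) (ι a) := by
      have := hι (Set.range_nonempty g) hg.directed_le.directedOn_range ha
      rwa [← Set.range_comp] at this
    have h2 : Monotone fun i => ι (g i) := hι.monotone.comp hg
    refine isLUB_of_tendsto_atTop (fun i j hij => ?_)
      (((M.tendsto_trace_of_isLUB hg ha).add (N.tendsto_trace_of_isLUB h2 h1)).const_mul _)
    exact mul_le_mul_of_nonneg_left (add_le_add (M.trace_normal.monotone (hg hij))
      (N.trace_normal.monotone (h2 hij))) half_nonneg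

lemma normSq_withAverageTrace (ι : M →⋆ₐ[ℂ] N) (hι : ScottContinuous ι) (x : M) :
    (withAverageTrace ι hι).normSq x = (M.normSq x + N.normSq (ι x)) / 2 := by
  change ((1 / 2 : ℂ) * (M.trace (star x * x) + N.trace (ι (star x * x)))).re = _
  have : (1 / 2 : ℂ) = ((1 / 2 : ℝ) : ℂ) := by norm_num
  rw [this, Complex.re_ofReal_mul, Complex.add_re, map_mul ι, map_star ι, normSq, normSq]
  ring

lemma trace_eq_of_mem_convexHull {A : Type*} [CStarAlgebra A] {τ : A →ₗ[ℂ] ℂ}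
    (hτ : ∀ x y, τ (x * y) = τ (y * x)) {S : Set (unitary A)} {x z : A}
    (hz : z ∈ convexHull ℝ ((fun u : unitary A => (u : A) * x * star (u : A)) '' S)) :
    τ z = τ x := by
  have h1 : Convex ℝ {z : A | τ z = τ x} := fun a ha b hb s t hs ht hst => by
    change τ (s • a + t • b) = τ x
    rw [map_add, ← Complex.coe_smul, ← Complex.coe_smul, map_smul, map_smul,
      show τ a = τ x from ha, show τ b = τ x from hb, ← add_smul, ← Complex.ofReal_add, hst,
      Complex.ofReal_one, one_smul]
  refine convexHull_min ?_ h1 hz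
  rintro _ ⟨u, -, rfl⟩
  change τ ((u : A) * x * star (u : A)) = τ x
  rw [hτ, ← mul_assoc, Unitary.coe_star_mul_self, one_mul]

/-- Averaging for the mean of the two traces makes the same convex combinations approach `y` in both
2-norms at once. -/
lemma exists_common_average (ι : M →⋆ₐ[ℂ] N) (hι : ScottContinuous ι) (x : M) :
    ∃ y : M, (∀ u : unitary (M : Type u), (u : M) * y = y * u) ∧ ∀ ε : ℝ, 0 < ε →
      ∃ z ∈ convexHull ℝ ((fun u : unitary (M : Type u) => (u : M) * x * star (u : M)) '' Set.univ),
        (M.normSq (z - y) + N.normSq (ι (z - y))) / 2 < ε := by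
  have h := (withAverageTrace ι hι).isCompleteTrace
  obtain ⟨y, -, hy, happrox⟩ := h.exists_average ⊤ x
  refine ⟨y, fun u => hy u trivial, fun ε hε => ?_⟩
  obtain ⟨z, hz, hzy⟩ := happrox (√ε) (Real.sqrt_pos.2 hε)
  refine ⟨z, hz, ?_⟩
  rw [← map_sub] at hzy
  refine (normSq_withAverageTrace ι hι (z - y)).symm.trans_lt ?_
  refine (h.norm_sq_L2 (z - y)).symm.trans_lt ?_
  rw [← Real.sq_sqrt hε.le]
  gcongr

/-- A normal embedding of a factor preserves the trace. -/
theorem trace_embedding (hM : M.IsII₁Factor) (ι : M →⋆ₐ[ℂ] N) (hι : ScottContinuous ι) (x : M) :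
    N.trace (ι x) = M.trace x := by
  -- The average is central, hence a scalar `c`. Conjugation by unitaries preserves both traces, so
  -- `τ(x)` and the trace of `ι x` are both arbitrarily close to `c`.
  obtain ⟨y, hy, happrox⟩ := exists_common_average ι hι x
  have hcentral : ∀ z : M, y * z = z * y := fun z =>
    mem_induction_unitary (M := M) le_rfl (fun z => y * z = z * y)
      (fun u _ => (hy u).symm) (by rw [mul_zero, zero_mul])
      (fun a b ha hb => by rw [mul_add, add_mul, ha, hb])
      (fun c a ha => by rw [mul_smul_comm, smul_mul_assoc, ha]) z z.2
  obtain ⟨c, hc⟩ := hM.trivial_center y hcentral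
  have key : ∀ δ : ℝ, 0 < δ → ‖N.trace (ι x) - M.trace x‖ ≤ δ := fun δ hδ => by
    obtain ⟨z, hz, h1⟩ := happrox ((δ / 4) ^ 2) (by positivity)
    have hz1 : M.trace z = M.trace x :=
      trace_eq_of_mem_convexHull (A := M.toStarSubalgebra) M.trace_mul_comm hz
    have hz2 : N.trace (ι z) = N.trace (ι x) :=
      trace_eq_of_mem_convexHull (A := M.toStarSubalgebra)
        (τ := N.trace ∘ₗ ι.toAlgHom.toLinearMap) (fun a b => by
          change N.trace (ι (a * b)) = N.trace (ι (b * a))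
          rw [map_mul ι, map_mul ι, N.trace_mul_comm]) hz
    have h2 := M.norm_trace_sq_le (z - y)
    have h3 := N.norm_trace_sq_le (ι (z - y))
    have h4 := M.normSq_nonneg (z - y)
    have h5 := N.normSq_nonneg (ι (z - y))
    have h6 : ‖M.trace (z - y)‖ ≤ δ / 2 := by
      refine le_of_sq_le_sq (a := _) ?_ (by positivity)
      nlinarith
    have h7 : ‖N.trace (ι (z - y))‖ ≤ δ / 2 := by
      refine le_of_sq_le_sq (a := _) ?_ (by positivity)
      nlinarith
    have h8 : N.trace (ι x) - M.trace x = N.trace (ι (z - y)) - M.trace (z - y) := by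
      rw [map_sub ι, map_sub, map_sub, hz1, hz2, hc, map_smul ι, map_one ι, map_smul, map_smul,
        M.trace_one, N.trace_one]
      ring
    rw [h8]
    refine (norm_sub_le _ _).trans ?_
    linarith
  refine sub_eq_zero.1 (norm_eq_zero.1 (le_antisymm ?_ (norm_nonneg _)))
  exact le_of_forall_pos_le_add fun δ hδ => by simpa using key δ hδ

end TracialVonNeumannAlgebra

namespace IsCompleteTrace

open PreHilbert

variable {A : Type*} [CStarAlgebra A] {τ : A →ₗ[ℂ] ℂ} (h : IsCompleteTrace τ)

lemma left_star_mul_self_nonneg (x : A) : 0 ≤ h.left (star x * x) := by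
  rw [map_mul, StarHomClass.map_star h.left x]
  exact star_mul_self_nonneg (h.left x)

lemma right_star_mul_self_nonneg (x : A) : 0 ≤ h.right (MulOpposite.op (star x * x)) := by
  rw [MulOpposite.op_mul, MulOpposite.op_star, map_mul,
    StarHomClass.map_star h.right (MulOpposite.op x)]
  exact mul_star_self_nonneg (h.right (MulOpposite.op x))

lemma norm_sub_le_of_mem_convexHull {S : Set A} {x z : A} {δ : ℝ}
    (hS : ∀ w ∈ S, ‖of h.core w - of h.core x‖ ≤ δ) (hz : z ∈ convexHull ℝ S) :
    ‖of h.core z - of h.core x‖ ≤ δ := by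
  have hc := (convex_closedBall (of h.core x) δ).linear_preimage ((of h.core).restrictScalars ℝ)
  have h1 := convexHull_min (fun w hw => by
    rw [Set.mem_preimage, mem_closedBall_iff_norm]
    exact hS w hw) hc hz
  rwa [Set.mem_preimage, mem_closedBall_iff_norm] at h1

end IsCompleteTrace

namespace TracialVonNeumannAlgebra

open PreHilbert

variable {H : Type u} [NormedAddCommGroup H] [InnerProductSpace ℂ H] [CompleteSpace H]
variable {K : Type u} [NormedAddCommGroup K] [InnerProductSpace ℂ K] [CompleteSpace K]

/-! ### The bimodule `L²(N)` -/

/-- The space `L²(N, τ)`. -/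
abbrev L2 (N : TracialVonNeumannAlgebra K) : Type u := Hilb N.isCompleteTrace.core

/-- The embedding of `N` into `L²(N, τ)`. -/
noncomputable def toL2 (N : TracialVonNeumannAlgebra K) : N →ₗ[ℂ] N.L2 := of N.isCompleteTrace.core

lemma norm_sq_toL2 (N : TracialVonNeumannAlgebra K) (x : N) : ‖N.toL2 x‖ ^ 2 = N.normSq x :=
  N.isCompleteTrace.norm_sq_L2 x

lemma inner_toL2 (N : TracialVonNeumannAlgebra K) (x y : N) :
    inner ℂ (N.toL2 x) (N.toL2 y) = N.trace (star x * y) :=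
  N.isCompleteTrace.inner_L2 x y

/-- Left multiplication on `L²(N, τ)`. -/
noncomputable def leftL2 (N : TracialVonNeumannAlgebra K) : N →⋆ₐ[ℂ] (N.L2 →L[ℂ] N.L2) :=
  N.isCompleteTrace.left

/-- Right multiplication on `L²(N, τ)`. -/
noncomputable def rightL2 (N : TracialVonNeumannAlgebra K) :
    (N : Type u)ᵐᵒᵖ →⋆ₐ[ℂ] (N.L2 →L[ℂ] N.L2) :=
  N.isCompleteTrace.right

lemma leftL2_apply (N : TracialVonNeumannAlgebra K) (x y : N) :
    N.leftL2 x (N.toL2 y) = N.toL2 (x * y) := N.isCompleteTrace.left_of x y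

lemma rightL2_apply (N : TracialVonNeumannAlgebra K) (x y : N) :
    N.rightL2 (MulOpposite.op x) (N.toL2 y) = N.toL2 (y * x) := N.isCompleteTrace.right_of x y

lemma dense_range_toL2 (N : TracialVonNeumannAlgebra K) : Dense (Set.range N.toL2) :=
  denseRange_of N.isCompleteTrace.core

lemma scottContinuous_leftL2 (N : TracialVonNeumannAlgebra K) : ScottContinuous N.leftL2 := by
  refine N.scottContinuous_of_le_trace N.leftL2.toAlgHom.toLinearMap
    N.isCompleteTrace.left_star_mul_self_nonneg N.dense_range_toL2 ?_
  · rintro _ ⟨z, rfl⟩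
    refine ⟨‖(z : K →L[ℂ] K)‖ ^ 2, fun x => ?_⟩
    change (inner ℂ (N.toL2 z) (N.leftL2 (star x * x) (N.toL2 z))).re ≤ _
    rw [leftL2_apply, inner_toL2]
    refine le_trans (le_of_eq ?_) (N.normSq_mul_le_right x z)
    rw [normSq, star_mul]
    simp only [mul_assoc]

lemma scottContinuous_rightL2 (N : TracialVonNeumannAlgebra K) :
    ScottContinuous fun x : N => N.rightL2 (MulOpposite.op x) := by
  refine N.scottContinuous_of_le_trace
    (N.rightL2.toAlgHom.toLinearMap ∘ₗ (MulOpposite.opLinearEquiv ℂ).toLinearMap)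
    N.isCompleteTrace.right_star_mul_self_nonneg N.dense_range_toL2 ?_
  · rintro _ ⟨z, rfl⟩
    refine ⟨‖(z : K →L[ℂ] K)‖ ^ 2, fun x => ?_⟩
    change (inner ℂ (N.toL2 z) (N.rightL2 (MulOpposite.op (star x * x)) (N.toL2 z))).re ≤ _
    rw [rightL2_apply, inner_toL2, ← N.normSq_star x]
    refine le_trans (le_of_eq ?_) (N.normSq_mul_le_left z (star x))
    rw [normSq, star_mul, star_star, ← mul_assoc z, ← mul_assoc (star z), N.trace_mul_comm]
    simp only [mul_assoc]

variable {M : TracialVonNeumannAlgebra H} {N : TracialVonNeumannAlgebra K}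

/-- A homomorphism, seen between the opposite algebras. -/
noncomputable def opHom (ι : M →⋆ₐ[ℂ] N) : (M : Type u)ᵐᵒᵖ →⋆ₐ[ℂ] (N : Type u)ᵐᵒᵖ where
  toFun x := MulOpposite.op (ι x.unop)
  map_one' := by rw [MulOpposite.unop_one, map_one ι, MulOpposite.op_one]
  map_mul' x y := by rw [MulOpposite.unop_mul, map_mul ι, MulOpposite.op_mul]
  map_zero' := by rw [MulOpposite.unop_zero, map_zero ι, MulOpposite.op_zero]
  map_add' x y := by rw [MulOpposite.unop_add, map_add ι, MulOpposite.op_add]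
  commutes' r := by
    rw [Algebra.algebraMap_eq_smul_one, Algebra.algebraMap_eq_smul_one, MulOpposite.unop_smul,
      map_smul ι, MulOpposite.op_smul, MulOpposite.unop_one, map_one ι, MulOpposite.op_one]
  map_star' x := by rw [MulOpposite.unop_star, map_star ι, MulOpposite.op_star]

/-- `L²(N, τ)` as an `M`-`M`-bimodule. -/
noncomputable def bimoduleL2 (ι : M →⋆ₐ[ℂ] N) (hι : ScottContinuous ι) : Bimodule M N.L2 where
  left := N.leftL2.comp ι
  right := N.rightL2.comp (opHom ι)
  left_normal := hι.comp N.scottContinuous_leftL2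
  right_normal := hι.comp N.scottContinuous_rightL2
  commute _ _ := N.isCompleteTrace.commute_left_right _ _

lemma bimoduleL2_left (ι : M →⋆ₐ[ℂ] N) (hι : ScottContinuous ι) (x : M) (y : N) :
    (bimoduleL2 ι hι).left x (N.toL2 y) = N.toL2 (ι x * y) := N.leftL2_apply (ι x) y

lemma bimoduleL2_right (ι : M →⋆ₐ[ℂ] N) (hι : ScottContinuous ι) (x : M) (y : N) :
    (bimoduleL2 ι hι).right (MulOpposite.op x) (N.toL2 y) = N.toL2 (y * ι x) :=
  N.rightL2_apply (ι x) y

lemma bimoduleL2_commutator (ι : M →⋆ₐ[ℂ] N) (hι : ScottContinuous ι) (x : M) (y : N) :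
    (bimoduleL2 ι hι).commutator x (N.toL2 y) = N.toL2 (ι x * y - y * ι x) := by
  rw [Bimodule.commutator, bimoduleL2_left, bimoduleL2_right, map_sub]

lemma Bimodule.norm_commutator_unitary_le {B : Bimodule M K} {a : M}
    (ha : a ∈ unitary (M : Type u)) {η : K} (hη : B.commutator a η = 0) (ξ : K) :
    ‖B.commutator a ξ‖ ≤ 2 * ‖η - ξ‖ := by
  have e : B.commutator a ξ = B.left a (ξ - η) - B.right (MulOpposite.op a) (ξ - η) := by
    rw [commutator] at hη ⊢
    rw [map_sub, map_sub, sub_sub_sub_comm, hη, sub_zero]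
  rw [e]
  refine (norm_sub_le _ _).trans ?_
  rw [norm_left_unitary ha, norm_right_unitary ha, norm_sub_rev]
  linarith

/-! ### Relative property (T) controls central sequences -/

/-- Relative property (T), applied to unitaries in an extension of `M`. -/
lemma RelativePropertyT.exists_unitary_bound {A : VonNeumannAlgebra H}
    (hT : M.RelativePropertyT A) {ε' : ℝ} (hε' : 0 < ε') : ∃ (F : Finset M) (ε : ℝ), 0 < ε ∧
      ∀ (K : Type u) [NormedAddCommGroup K] [InnerProductSpace ℂ K] [CompleteSpace K]
        (N : TracialVonNeumannAlgebra K) (ι : M →⋆ₐ[ℂ] N), ScottContinuous ι →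
        (∀ x, N.trace (ι x) = M.trace x) → ∀ u ∈ unitary (N : Type u),
        (∀ x ∈ F, N.normSq (ι x * u - u * ι x) ≤ ε ^ 2) →
        ∀ a ∈ M.unitaryIn A, N.normSq (ι (a : M) * u - u * ι (a : M)) ≤ 4 * ε' ^ 2 := by
  obtain ⟨F, ε, hε, h⟩ := hT ε' hε'
  refine ⟨F, ε, hε, fun K _ _ _ N ι hι htr u hu hF a ha => ?_⟩
  have hu1 := (Unitary.mem_iff.1 hu).1
  have hu2 := (Unitary.mem_iff.1 hu).2
  have hnorm : ‖N.toL2 u‖ = 1 := by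
    have : ‖N.toL2 u‖ ^ 2 = 1 := by
      rw [norm_sq_toL2, normSq, hu1, N.trace_one, Complex.one_re]
    nlinarith [norm_nonneg (N.toL2 u)]
  -- Unitarity of `u` gives `⟨u, xu⟩ = τ(u⋆xu) = τ(x) = ⟨u, ux⟩`, which is traciality once `ι`
  -- preserves the trace.
  obtain ⟨η, hη, hle⟩ := h N.L2 (bimoduleL2 ι hι) (N.toL2 u) hnorm (fun x => by
    constructor
    · rw [bimoduleL2_left, inner_toL2, N.trace_mul_comm, mul_assoc, hu2, mul_one, htr]
    · rw [bimoduleL2_right, inner_toL2, ← mul_assoc, hu1, one_mul, htr]) (fun x hx => by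
    rw [bimoduleL2_commutator, ← sq_le_sq₀ (norm_nonneg _) hε.le, norm_sq_toL2]
    exact hF x hx)
  rw [← norm_sq_toL2, ← bimoduleL2_commutator ι hι]
  have h2 := Bimodule.norm_commutator_unitary_le a.2 (hη (a : M) ha) (N.toL2 u)
  calc _ ≤ (2 * ε') ^ 2 := by
        refine pow_le_pow_left₀ (norm_nonneg _) (h2.trans ?_) 2
        linarith
    _ = _ := by ring

/-- The map induced on unitaries. -/
noncomputable def unitaryMap (ι : M →⋆ₐ[ℂ] N) : unitary (M : Type u) →* unitary (N : Type u) :=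
  MonoidHom.mk' (fun u => ⟨ι (u : M), Unitary.mem_iff.2
    ⟨by rw [← map_star ι, ← map_mul ι, (Unitary.mem_iff.1 u.2).1, map_one ι],
      by rw [← map_star ι, ← map_mul ι, (Unitary.mem_iff.1 u.2).2, map_one ι]⟩⟩)
    fun u v => Subtype.ext (map_mul ι (u : M) (v : M))

/-- Averaging over the unitaries of `A` in an extension of `M`. -/
lemma exists_commutant_approx {A : VonNeumannAlgebra H} (hA : A ≤ M.toVonNeumannAlgebra)
    (ι : M →⋆ₐ[ℂ] N) (x : N) : ∃ y : N, ‖y‖ ≤ ‖x‖ ∧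
      y ∈ Set.centralizer (ι '' {a : M | (a : H →L[ℂ] H) ∈ A}) ∧
      ∀ δ : ℝ, 0 ≤ δ → (∀ a ∈ M.unitaryIn A, N.normSq (ι (a : M) * x - x * ι (a : M)) ≤ δ ^ 2) →
        N.normSq (x - y) ≤ δ ^ 2 := by
  obtain ⟨y, hyn, hy, happrox⟩ := N.isCompleteTrace.exists_average
    ((M.unitaryIn A).map (unitaryMap ι)) x
  refine ⟨y, hyn, ?_, fun δ hδ h => ?_⟩
  · rintro _ ⟨a, ha, rfl⟩
    exact mem_induction_unitary hA (fun a => ι a * y = y * ι a)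
      (fun u hu => hy _ ⟨u, hu, rfl⟩) (by rw [map_zero ι, mul_zero, zero_mul])
      (fun a b ha hb => by rw [map_add ι, mul_add, add_mul, ha, hb])
      (fun c a ha => by rw [map_smul ι, mul_smul_comm, smul_mul_assoc, ha]) a ha
  -- Since `axa⋆ - x = [a, x]a⋆`, all conjugates of `x` lie in the ball of radius `δ` about `x`; by
  -- convexity so does the average.
  · have hball : ∀ w ∈ (fun u : unitary (N : Type u) => (u : N) * x * star (u : N)) ''
        ((M.unitaryIn A).map (unitaryMap ι) : Set (unitary (N : Type u))),
        ‖N.toL2 w - N.toL2 x‖ ≤ δ := by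
      rintro _ ⟨_, ⟨a, ha, rfl⟩, rfl⟩
      change ‖N.toL2 (ι (a : M) * x * star (ι (a : M))) - N.toL2 x‖ ≤ δ
      have e : ι (a : M) * x * star (ι (a : M)) - x =
          (ι (a : M) * x - x * ι (a : M)) * ι (star (a : M)) := by
        rw [sub_mul, mul_assoc x, ← map_mul, (Unitary.mem_iff.1 a.2).2, map_one ι, mul_one,
          map_star ι]
      rw [← map_sub, ← sq_le_sq₀ (norm_nonneg _) hδ, norm_sq_toL2, e]
      refine le_trans ?_ (h a ha)
      have hu : star (a : M) ∈ unitary (M : Type u) := Unitary.star_mem a.2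
      calc _ ≤ _ := N.normSq_mul_le_right _ _
        _ ≤ 1 * N.normSq (ι (a : M) * x - x * ι (a : M)) := by
          gcongr
          · exact N.normSq_nonneg _
          · exact norm_sq_embedding_unitary_le ι hu
        _ = _ := one_mul _
    have key : ‖N.toL2 x - N.toL2 y‖ ≤ δ := by
      refine le_of_forall_pos_le_add fun ε hε => ?_
      obtain ⟨z, hz, hzy⟩ := happrox ε hε
      calc _ = ‖(N.toL2 z - N.toL2 y) - (N.toL2 z - N.toL2 x)‖ := by
            congr 1
            abel
        _ ≤ ε + δ := (norm_sub_le _ _).trans (add_le_add hzy.le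
          (N.isCompleteTrace.norm_sub_le_of_mem_convexHull hball hz))
        _ = δ + ε := add_comm _ _
    rw [← norm_sq_toL2, map_sub]
    gcongr

/-- An asymptotically central self-adjoint sequence is close to the relative commutant of `A`. -/
lemma RelativePropertyT.exists_commutant_sequence {A : VonNeumannAlgebra H}
    (hT : M.RelativePropertyT A) (hA : A ≤ M.toVonNeumannAlgebra) (ι : M →⋆ₐ[ℂ] N)
    (hι : ScottContinuous ι) (htr : ∀ x, N.trace (ι x) = M.trace x) {h : ℕ → N}
    (hsa : ∀ n, IsSelfAdjoint (h n)) {C : ℝ} (hC : ∀ n, ‖h n‖ ≤ C) {l : Filter ℕ}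
    (hcomm : ∀ m, Tendsto (fun n => N.normSq (ι m * h n - h n * ι m)) l (𝓝 0)) :
    ∃ y : ℕ → N, (∀ n, ‖y n‖ ≤ C) ∧
      (∀ n, y n ∈ Set.centralizer (ι '' {a : M | (a : H →L[ℂ] H) ∈ A})) ∧
      Tendsto (fun n => N.normSq (h n - y n)) l (𝓝 0) := by
  choose y hyn hyc hy using fun n => exists_commutant_approx hA ι (h n)
  have hC0 : 0 ≤ C := (norm_nonneg _).trans (hC 0)
  refine ⟨y, fun n => (hyn n).trans (hC n), hyc, tendsto_order.2
    ⟨fun a ha => Eventually.of_forall fun n => ha.trans_le (N.normSq_nonneg _), fun δ hδ => ?_⟩⟩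
  have hs : 0 < √(δ / 2) := Real.sqrt_pos.2 (by positivity)
  -- The Cayley transform costs a factor `4` in one direction, hence `ε ^ 2 / 4` below, and `(C + 1)
  -- ^ 4` in the other. This choice of `ε'` makes `(C + 1) ^ 4 * (4 * ε' ^ 2)` equal to `δ / 2`.
  obtain ⟨F, ε, hε, hF⟩ := hT.exists_unitary_bound
    (ε' := √(δ / 2) / (2 * (C + 1) ^ 2)) (by positivity)
  have hev : ∀ᶠ n in l, ∀ x ∈ F, N.normSq (ι x * h n - h n * ι x) < ε ^ 2 / 4 :=
    (eventually_all_finset F).2 fun x _ => (tendsto_order.1 (hcomm x)).2 _ (by positivity)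
  filter_upwards [hev] with n hn
  obtain ⟨u, hu, hcu⟩ := N.exists_unitary_commutator (hsa n)
  have h1 := hF K N ι hι htr u hu fun x hx => by
    have := (hcu (ι x)).1
    have := hn x hx
    linarith
  have h2 : N.normSq (h n - y n) ≤ √(δ / 2) ^ 2 := hy n _ hs.le fun a ha => by
    have h3 : (‖h n‖ + 1) ^ 4 ≤ (C + 1) ^ 4 := by
      gcongr
      exact hC n
    calc _ ≤ _ := (hcu (ι (a : M))).2
      _ ≤ (C + 1) ^ 4 * (4 * (√(δ / 2) / (2 * (C + 1) ^ 2)) ^ 2) :=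
        mul_le_mul h3 (h1 a ha) (N.normSq_nonneg _) (by positivity)
      _ = _ := by
        have : C + 1 ≠ 0 := by positivity
        field_simp
        norm_num
  rw [Real.sq_sqrt (by positivity)] at h2
  linarith

lemma normSq_smul (N : TracialVonNeumannAlgebra K) (c : ℂ) (x : N) :
    N.normSq (c • x) = ‖c‖ ^ 2 * N.normSq x := by
  rw [← norm_sq_toL2, ← norm_sq_toL2, map_smul, norm_smul, mul_pow]

/-- Linear combinations of asymptotically central sequences are asymptotically central. -/
lemma tendsto_normSq_commutator_combination {ι : M → N} {l : Filter ℕ} {x y : ℕ → N}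
    (hx : ∀ m, Tendsto (fun n => N.normSq (ι m * x n - x n * ι m)) l (𝓝 0))
    (hy : ∀ m, Tendsto (fun n => N.normSq (ι m * y n - y n * ι m)) l (𝓝 0)) (c d : ℂ) (m : M) :
    Tendsto (fun n => N.normSq (ι m * (c • x n + d • y n) - (c • x n + d • y n) * ι m)) l
      (𝓝 0) := by
  refine squeeze_zero (fun n => N.normSq_nonneg _) (fun n => ?_)
    (g := fun n => 2 * (‖c‖ ^ 2 * N.normSq (ι m * x n - x n * ι m) +
      ‖d‖ ^ 2 * N.normSq (ι m * y n - y n * ι m))) ?_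
  · have e : ι m * (c • x n + d • y n) - (c • x n + d • y n) * ι m =
        c • (ι m * x n - x n * ι m) + d • (ι m * y n - y n * ι m) := by
      rw [mul_add, add_mul, mul_smul_comm, mul_smul_comm, smul_mul_assoc, smul_mul_assoc,
        smul_sub, smul_sub]
      abel
    rw [e, ← normSq_smul, ← normSq_smul]
    exact N.normSq_add_le _ _
  · simpa using (((hx m).const_mul (‖c‖ ^ 2)).add ((hy m).const_mul (‖d‖ ^ 2))).const_mul 2

/-- Relative property (T) locates the central sequences of every extension. -/
theorem RelativePropertyT.centralizer_subset {A : VonNeumannAlgebra H}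
    (hT : M.RelativePropertyT A) (hM : M.IsII₁Factor) (hA : A ≤ M.toVonNeumannAlgebra)
    (ω : Ultrafilter ℕ) (ι : M →⋆ₐ[ℂ] N) (hι : ScottContinuous ι) :
    Set.centralizer (Set.range fun x : M => N.diagonal ω (ι x)) ⊆
      N.subUltrapower ω (Set.centralizer (ι '' {a : M | (a : H →L[ℂ] H) ∈ A})) := by
  intro X hX
  obtain ⟨x, rfl⟩ : ∃ x, N.toUltrapower ω x = X := RingCon.mk'_surjective _ X
  have hcomm := (mem_centralizer_iff N ω ι x).1 hX
  obtain ⟨C, hC⟩ := x.2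
  have hC1 : ∀ n, ‖x.1 n‖ ≤ C := hC
  have hC2 : ∀ n, ‖star (x.1 n)‖ ≤ C := fun n => (norm_star (x.1 n)).trans_le (hC1 n)
  have hstar : ∀ m, Tendsto (fun n => N.normSq (ι m * star (x.1 n) - star (x.1 n) * ι m)) ω
      (𝓝 0) := fun m => by
    refine (hcomm (star m)).congr fun n => ?_
    rw [← N.normSq_star, ← N.normSq_neg, map_star ι, star_sub, star_mul, star_mul, star_star,
      neg_sub]
  have hnorm : ∀ (c d : ℂ) (n : ℕ), ‖c‖ = 1 / 2 → ‖d‖ = 1 / 2 →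
      ‖c • x.1 n + d • star (x.1 n)‖ ≤ C := fun c d n hc hd => by
    refine (norm_add_le _ _).trans ?_
    rw [norm_smul, norm_smul, hc, hd]
    linarith [hC1 n, hC2 n]
  have htr := trace_embedding hM ι hι
  -- The real part is treated here and the imaginary part next, each bounded by `C`; the
  -- recombination `y + iz` is bounded by `2 * C`.
  obtain ⟨y, hyC, hyc, hy⟩ := hT.exists_commutant_sequence hA ι hι htr
    (h := fun n => (1 / 2 : ℂ) • x.1 n + (1 / 2 : ℂ) • star (x.1 n))
    (fun n => by
      rw [isSelfAdjoint_iff, star_add, star_smul, star_smul, star_star, add_comm]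
      simp) (fun n => hnorm _ _ n (by simp) (by simp))
    (tendsto_normSq_commutator_combination hcomm hstar _ _)
  obtain ⟨z, hzC, hzc, hz⟩ := hT.exists_commutant_sequence hA ι hι htr
    (h := fun n => (-Complex.I / 2) • x.1 n + (Complex.I / 2) • star (x.1 n))
    (fun n => by
      rw [isSelfAdjoint_iff, star_add, star_smul, star_smul, star_star, add_comm]
      simp) (fun n => hnorm _ _ n (by simp) (by simp))
    (tendsto_normSq_commutator_combination hcomm hstar _ _)
  have hbound : ∀ n, ‖y n + Complex.I • z n‖ ≤ 2 * C := fun n => by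
    refine (norm_add_le _ _).trans ?_
    rw [norm_smul, Complex.norm_I, one_mul]
    linarith [hyC n, hzC n]
  refine ⟨⟨fun n => y n + Complex.I • z n, 2 * C, hbound⟩, fun n => ?_, ?_⟩
  · intro a ha
    change a * (y n + Complex.I • z n) = (y n + Complex.I • z n) * a
    rw [mul_add, add_mul, mul_smul_comm, smul_mul_assoc, hyc n a ha, hzc n a ha]
  · rw [eq_comm, toUltrapower_eq_iff]
    have hlim := (hy.add hz).const_mul 2
    rw [add_zero, mul_zero] at hlim
    refine squeeze_zero (fun n => N.normSq_nonneg _) (fun n => ?_)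
      hlim
    have e : x.1 n - (y n + Complex.I • z n) =
        ((1 / 2 : ℂ) • x.1 n + (1 / 2 : ℂ) • star (x.1 n) - y n) +
        Complex.I • ((-Complex.I / 2) • x.1 n + (Complex.I / 2) • star (x.1 n) - z n) := by
      have h1 : Complex.I * (-Complex.I / 2) = 1 / 2 := by
        linear_combination (-1 / 2 : ℂ) * Complex.I_mul_I
      have h2 : Complex.I * (Complex.I / 2) = -(1 / 2) := by
        linear_combination (1 / 2 : ℂ) * Complex.I_mul_I
      have h3 : x.1 n = (1 / 2 : ℂ) • x.1 n + (1 / 2 : ℂ) • x.1 n := by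
        rw [← add_smul]
        norm_num
      rw [smul_sub, smul_add, smul_smul, smul_smul, h1, h2, neg_smul]
      nth_rewrite 1 [h3]
      abel
    change N.normSq (x.1 n - (y n + Complex.I • z n)) ≤ _
    rw [e]
    refine (N.normSq_add_le _ _).trans (le_of_eq ?_)
    rw [normSq_smul N Complex.I, Complex.norm_I, one_pow, one_mul]

end TracialVonNeumannAlgebra

theorem theorem3p2 {H : Type u} [NormedAddCommGroup H] [InnerProductSpace ℂ H] [CompleteSpace H]
    (M : TracialVonNeumannAlgebra H) (hM : M.IsII₁Factor) (hsep : M.IsSeparable)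
    (A : VonNeumannAlgebra H) (hA : A ≤ M.toVonNeumannAlgebra)
    (ω : Ultrafilter ℕ) (hω : (ω : Filter ℕ) ≤ Filter.cofinite) :
    M.RelativePropertyT A ↔
      ∀ (K : Type u) [NormedAddCommGroup K] [InnerProductSpace ℂ K] [CompleteSpace K]
        (N : TracialVonNeumannAlgebra K) (ι : M →⋆ₐ[ℂ] N),
        Function.Injective ι → ScottContinuous ι →
        Set.centralizer (Set.range fun x : M => N.diagonal ω (ι x)) ⊆
          N.subUltrapower ω (Set.centralizer (ι '' {a : M | (a : H →L[ℂ] H) ∈ A})) := by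
  refine ⟨fun hT K _ _ _ N ι _ hι => hT.centralizer_subset hM hA ω ι hι, fun h => ?_⟩
  exact TracialVonNeumannAlgebra.relativePropertyT_of_forall_centralizer_subset hsep hA hω h
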